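/- Let $(M,\mathsf c)$ be an oriented (Riemannian) conformal $4$-manifold with a $2$-dimensional Lie algebra $\mathfrak h$ of pointwise linearly independent conformal vector fields, such that the projection $\pi\colon M\to N$ onto the space of orbits is a submersion over a Riemann surface $N$ (whose conformal structure is the one induced by $\mathsf c$ on vectors orthogonal to the orbits). Let $\mathcal W\to N$ be a complex line bundle such that $\pi^*\mathcal W$ is the vertical bundle of $M$, sections of $\mathcal W$ corresponding to the vertical vector fields that commute with $\mathfrak h$. The complex structure of $\mathcal W$ is orthogonal, and it is oriented so that the almost complex structure $J$ on $TM=\pi^*(\mathcal W\oplus TN)$ is compatible with the orientation of $M$. The conformal structure of $M$ identifies the length scales of $\mathcal W$ and $TN$, that is, it gives a Hermitian metric on $\mathcal W^{-1}TN$; below $\langle\cdot,\cdot\rangle$ denotes Hermitian metrics (conjugate linear in the first variable) on $\mathcal W$ and $TN$ with a common length scale, and norms are taken with respect to them. For a section $U$ of $\mathcal W$ and a vector field $X$ on $N$, denote by the same letters the corresponding invariant vertical vector field and the horizontal lift on $M$. Define a holomorphic structure $\overline\partial{}^a$ on $\mathcal W$, a section $\mathcal C$ of $\mathcal W^{-2}TN$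 and a section $\psi$ of $\mathcal W^{-1}$, with metric dual $\psi^\sharp\in\mathcal W$ given by $\psi(U)=\langle\psi^\sharp,U\rangle$, by the equations $$ [X,U]+[JX,JU]-2\,\overline\partial{}^a_XU=\langle\mathcal C(U),X\rangle+\langle\mathcal C(JU),JX\rangle, \qquad -[X,JX]^{\mathrm{vert}}+[U,JU]=2|X|^2\,J\psi^\sharp\quad\text{whenever } |U|=|X| , $$ where $\langle\mathcal C(U),X\rangle\in\mathcal W$ is determined by $\mathrm{Re}\,\langle\langle\mathcal C(U),X\rangle,V\rangle=\mathrm{Re}\,\langle\mathcal C(U,V),X\rangle$ for all $V\in\mathcal W$. Then $M$ is selfdual ($W^-=0$) if and only if $(N,\mathcal W)$ with $(\overline\partial{}^a,\mathcal C,\psi)$ is a spinor-vortex space, that is, $$\overline\partial{}^a\mathcal C=0,\qquad (\overline\partial{}^a_X\psi)(U)=-3\,\langle X,\mathcal C(\psi^\sharp,U)\rangle,\qquad s=|\psi|^2-2|\mathcal C|^2 .$$ Here $s$ is the normalized scalar curvature of the Chern connection on $\mathcal W^{-1}TN$, i.e. $s=s_N-s_{\mathcal W}$, where for a holomorphic Hermitian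 line bundle with Chern curvature $R$ the function $s$ is defined by $R(X,JX)=-s|X|^2\boldsymbol i$ (so $s_N$ is the Gaussian curvature). The norm $|\mathcal C|^2=\sum_{i,j}|\mathcal C(e_i,e_j)|^2$, for a real orthonormal basis $e_1,e_2$ of $\mathcal W$, is that of the real tensor $\mathcal C$, and $|\psi|^2=4|\psi^\sharp|^2$ is the squared norm of the $\mathcal W$-valued $2$-form $\psi(X,Y)=2\,\Omega(X,Y)J\psi^\sharp$ corresponding to $\psi$, where $\Omega$ is the area form of $N$. -/

import Mathlib

open Bundle Manifold VectorField
open scoped ContDiff Topology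

noncomputable section

/-! ## Smooth sections and curvature -/

section General

variable {E : Type*} [NormedAddCommGroup E] [NormedSpace ℝ E]
  {H : Type*} [TopologicalSpace H] (I : ModelWithCorners ℝ E H)
  {B : Type*} [TopologicalSpace B] [ChartedSpace H B]
  (F : Type*) [NormedAddCommGroup F] [NormedSpace ℝ F]
  {V : B → Type*} [TopologicalSpace (TotalSpace F V)]
  [∀ x, AddCommGroup (V x)] [∀ x, Module ℝ (V x)] [∀ x, TopologicalSpace (V x)]
  [∀ x, IsTopologicalAddGroup (V x)] [∀ x, ContinuousSMul ℝ (V x)]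
  [FiberBundle F V]

/-- The section `s` of the bundle `V` is smooth at the point `x`. -/
def SmoothSectionAt (s : Π x, V x) (x : B) : Prop :=
  ContMDiffAt I (I.prod 𝓘(ℝ, F)) ∞ (fun y => TotalSpace.mk' F y (s y)) x

variable {I F}

/-- The connection `D` maps smooth sections to smooth sections. -/
def IsSmoothConnection [IsManifold I 1 B] (D : CovariantDerivative I F V) : Prop :=
  ∀ (x : B) (s : Π x, V x) (X : Π x : B, TangentSpace I x),
    SmoothSectionAt I F s x → SmoothSectionAt I E X x →
      SmoothSectionAt I F (fun y => D s y (X y)) x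

/-- The curvature `R(u, v) w = D_u D_v w - D_v D_u w - D_[u, v] w` of a connection `D` at a point,
computed by extending `u`, `v`, `w` to local smooth sections. -/
def curvatureAt [IsManifold I 1 B] (D : CovariantDerivative I F V) (x : B)
    (u v : TangentSpace I x) (w : V x) : V x :=
  D (fun y => D (FiberBundle.extend F w) y (FiberBundle.extend E v y)) x u
    - D (fun y => D (FiberBundle.extend F w) y (FiberBundle.extend E u y)) x v
    - D (FiberBundle.extend F w) x
        (mlieBracket I (FiberBundle.extend E u) (FiberBundle.extend E v) x)

end General

/-! ## Oriented conformal 4-manifolds and selfduality -/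

section FourManifold

/-- The model space of a 4-manifold. -/
abbrev E4 : Type := EuclideanSpace ℝ (Fin 4)

variable (M : Type*) [TopologicalSpace M] [ChartedSpace E4 M] [IsManifold (𝓡 4) ∞ M]

/-- A smooth Riemannian metric on a 4-manifold; it represents the conformal structure it
generates. -/
abbrev Metric4 : Type _ :=
  ContMDiffRiemannianMetric (𝓡 4) ∞ E4 (fun x : M => TangentSpace (𝓡 4) x)

/-- An orientation of a 4-manifold, given by a nowhere vanishing smooth 4-form. -/
structure OrientationForm where
  /-- the 4-form -/
  form : Π x : M, (TangentSpace (𝓡 4) x) [⋀^Fin 4]→ₗ[ℝ] ℝ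
  ne_zero : ∀ x, form x ≠ 0
  smooth : ∀ (x : M) (X : Fin 4 → Π y : M, TangentSpace (𝓡 4) y),
    (∀ i, SmoothSectionAt (𝓡 4) E4 (X i) x) →
      ContMDiffAt (𝓡 4) 𝓘(ℝ, ℝ) ∞ (fun y => form y (fun i => X i y)) x

variable {M}

/-- `D` is the Levi-Civita connection of `g`: smooth, torsion-free and metric. -/
structure IsLeviCivita (g : Metric4 M)
    (D : CovariantDerivative (𝓡 4) E4 (fun x : M => TangentSpace (𝓡 4) x)) : Prop where
  smooth : IsSmoothConnection D
  torsion_free : ∀ (x : M) (X Y : Π y : M, TangentSpace (𝓡 4) y),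
    SmoothSectionAt (𝓡 4) E4 X x → SmoothSectionAt (𝓡 4) E4 Y x →
      D Y x (X x) - D X x (Y x) = mlieBracket (𝓡 4) X Y x
  metric : ∀ (x : M) (X Y : Π y : M, TangentSpace (𝓡 4) y) (u : TangentSpace (𝓡 4) x),
    SmoothSectionAt (𝓡 4) E4 X x → SmoothSectionAt (𝓡 4) E4 Y x →
      mvfderiv (𝓡 4) (fun y => g.inner y (X y) (Y y)) x u
        = g.inner x (D X x u) (Y x) + g.inner x (X x) (D Y x u)

/-- `e` is a positively oriented `g`-orthonormal frame of the tangent space at `x`. -/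
def IsOrientedFrame (g : Metric4 M) (o : OrientationForm M) (x : M)
    (e : Fin 4 → TangentSpace (𝓡 4) x) : Prop :=
  (∀ i j, g.inner x (e i) (e j) = if i = j then 1 else 0) ∧ 0 < o.form x e

variable (g : Metric4 M) (D : CovariantDerivative (𝓡 4) E4 (fun x : M => TangentSpace (𝓡 4) x))
  (x : M) (e : Fin 4 → TangentSpace (𝓡 4) x)

/-- Components `⟨R(eᵢ, eⱼ) eₖ, eₗ⟩` of the Riemann tensor in the frame `e`. -/
def riemannComp (i j k l : Fin 4) : ℝ :=
  g.inner x (curvatureAt D x (e i) (e j) (e k)) (e l)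

/-- Components of the Ricci tensor in the orthonormal frame `e`. -/
def ricciComp (j k : Fin 4) : ℝ := ∑ i, riemannComp g D x e i j k i

/-- The scalar curvature, computed in the orthonormal frame `e`. -/
def scalarComp : ℝ := ∑ j, ricciComp g D x e j j

/-- Components of the normalized Ricci (Schouten) tensor `(Ric - scal g / 6) / 2` in the
orthonormal frame `e`. -/
def schoutenComp (j k : Fin 4) : ℝ :=
  (ricciComp g D x e j k - scalarComp g D x e / 6 * (if j = k then 1 else 0)) / 2

/-- Components `⟨W(eᵢ, eⱼ) eₖ, eₗ⟩` of the Weyl tensor in the orthonormal frame `e`. -/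
def weylComp (i j k l : Fin 4) : ℝ :=
  riemannComp g D x e i j k l
    - (schoutenComp g D x e j k * (if i = l then 1 else 0)
      + schoutenComp g D x e i l * (if j = k then 1 else 0)
      - schoutenComp g D x e i k * (if j = l then 1 else 0)
      - schoutenComp g D x e j l * (if i = k then 1 else 0))

/-- The oriented conformal manifold `(M, [g], o)` is selfdual, `W⁻ = 0`: the Weyl tensor of the
Levi-Civita connection vanishes on antiselfdual bivectors. These are spanned by the bivectors
`e₀ ∧ e₁ - e₂ ∧ e₃`, where `e` runs through the positively oriented orthonormal frames. -/
def IsSelfdual (o : OrientationForm M) : Prop :=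
  ∃ D : CovariantDerivative (𝓡 4) E4 (fun x : M => TangentSpace (𝓡 4) x), IsLeviCivita g D ∧
    ∀ (x : M) (e : Fin 4 → TangentSpace (𝓡 4) x), IsOrientedFrame g o x e →
      ∀ k l, weylComp g D x e 0 1 k l = weylComp g D x e 2 3 k l

/-- `K` is a (smooth) conformal vector field: `𝓛_K g = σ g` for some function `σ`. -/
def IsConformalField (K : Π x : M, TangentSpace (𝓡 4) x) : Prop :=
  (∀ x, SmoothSectionAt (𝓡 4) E4 K x) ∧
  ∃ σ : M → ℝ, ∀ (x : M) (X Y : Π y : M, TangentSpace (𝓡 4) y),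
    SmoothSectionAt (𝓡 4) E4 X x → SmoothSectionAt (𝓡 4) E4 Y x →
      mvfderiv (𝓡 4) (fun y => g.inner y (X y) (Y y)) x (K x)
        - g.inner x (mlieBracket (𝓡 4) K X x) (Y x)
        - g.inner x (X x) (mlieBracket (𝓡 4) K Y x)
      = σ x * g.inner x (X x) (Y x)

/-- `𝔥` is a 2-dimensional Lie algebra of (pointwise) linearly independent conformal vector
fields. -/
structure IsConformalSymmetryAlgebra (𝔥 : Submodule ℝ (Π x : M, TangentSpace (𝓡 4) x)) :
    Prop where
  conformal : ∀ K ∈ 𝔥, IsConformalField g K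
  bracket : ∀ K ∈ 𝔥, ∀ L ∈ 𝔥, mlieBracket (𝓡 4) K L ∈ 𝔥
  finrank_eq : Module.finrank ℝ 𝔥 = 2
  independent : ∀ K ∈ 𝔥, ∀ x, K x = 0 → K = 0

/-- Two points lie on the same orbit of `𝔥`: they are joined by a finite chain of integral curves
of vector fields in `𝔥`. -/
def SameOrbit (𝔥 : Submodule ℝ (Π x : M, TangentSpace (𝓡 4) x)) : M → M → Prop :=
  Relation.EqvGen fun x y => ∃ K ∈ 𝔥, ∃ γ : ℝ → M,
    IsMIntegralCurveOn γ K (Set.Icc 0 1) ∧ γ 0 = x ∧ γ 1 = y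

/-- The tangent vector `u` at `x` is orthogonal to the orbits of `𝔥`. -/
def IsHorizontal (𝔥 : Submodule ℝ (Π x : M, TangentSpace (𝓡 4) x)) (u : TangentSpace (𝓡 4) x) :
    Prop :=
  ∀ K ∈ 𝔥, g.inner x (K x) u = 0

end FourManifold

/-! ## Riemann surfaces and Hermitian line bundles over them -/

section RiemannSurface

/-- The smooth surface underlying a Riemann surface. -/
instance realSurface (N : Type*) [TopologicalSpace N] [ChartedSpace ℂ N] [IsManifold 𝓘(ℂ) ω N] :
    IsManifold 𝓘(ℝ, ℂ) ∞ N := by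
  refine isManifold_of_contDiffOn 𝓘(ℝ, ℂ) ∞ N fun e e' he he' => ?_
  have h := (contDiffGroupoid ω 𝓘(ℂ)).compatible (H := ℂ) he he'
  rw [contDiffGroupoid, mem_groupoid_of_pregroupoid] at h
  have h2 : ContDiffOn ℂ ω (e.symm ≫ₕ e') (e.symm ≫ₕ e').source := by
    simpa [contDiffPregroupoid] using h.1
  simpa using (h2.restrict_scalars ℝ).of_le le_top

variable {N : Type*} [TopologicalSpace N] [ChartedSpace ℂ N]

/-- The complex structure of the tangent spaces of a Riemann surface. A tangent space is
represented by `ℂ` through a holomorphic chart. -/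
instance tangentModuleComplex (p : N) : Module ℂ (TangentSpace 𝓘(ℝ, ℂ) p) :=
  inferInstanceAs (Module ℂ ℂ)

/-- The operator `∂̄` on functions: `∂̄_X f = (df(X) + i df(iX)) / 2`. -/
def dbarFun (f : N → ℂ) (p : N) (X : TangentSpace 𝓘(ℝ, ℂ) p) : ℂ :=
  (mvfderiv 𝓘(ℝ, ℂ) f p X + Complex.I * mvfderiv 𝓘(ℝ, ℂ) f p (Complex.I • X)) / 2

variable [IsManifold 𝓘(ℂ) ω N]

/-- The holomorphic structure of the tangent bundle of a Riemann surface, acting on vector fields: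
`∂̄_X Z = ([X, Z] + i [iX, Z]) / 2`. -/
def dbarTangent (Z : Π p : N, TangentSpace 𝓘(ℝ, ℂ) p) (p : N) (X : TangentSpace 𝓘(ℝ, ℂ) p) :
    TangentSpace 𝓘(ℝ, ℂ) p :=
  (1 / 2 : ℂ) • (mlieBracket 𝓘(ℝ, ℂ) (FiberBundle.extend ℂ X) Z p
    + Complex.I • mlieBracket 𝓘(ℝ, ℂ) (fun q => Complex.I • FiberBundle.extend ℂ X q) Z p)

section LineBundle

variable (L : N → Type*) [TopologicalSpace (TotalSpace ℂ L)]
  [∀ p, AddCommGroup (L p)] [∀ p, Module ℝ (L p)] [∀ p, Module ℂ (L p)]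
  [∀ p, TopologicalSpace (L p)] [∀ p, IsTopologicalAddGroup (L p)]
  [∀ p, ContinuousSMul ℝ (L p)] [FiberBundle ℂ L]

/-- A smooth Hermitian metric on a complex line bundle, conjugate linear in the first argument. -/
structure HermitianMetric where
  /-- the Hermitian form -/
  form : Π p : N, L p →ₗ⋆[ℂ] L p →ₗ[ℂ] ℂ
  symm : ∀ p v w, form p w v = starRingEnd ℂ (form p v w)
  pos : ∀ p v, v ≠ 0 → 0 < (form p v v).re
  smooth : ∀ (p : N) (s t : Π p, L p),
    SmoothSectionAt 𝓘(ℝ, ℂ) ℂ s p → SmoothSectionAt 𝓘(ℝ, ℂ) ℂ t p →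
      ContMDiffAt 𝓘(ℝ, ℂ) 𝓘(ℝ, ℂ) ∞ (fun q => form q (s q) (t q)) p

/-- A holomorphic structure `∂̄` on a smooth complex line bundle over a Riemann surface:
`op s p X` is the value `∂̄_X s` at `p`. -/
structure HolomorphicStructure where
  /-- the operator -/
  op : (Π p, L p) → Π p : N, TangentSpace 𝓘(ℝ, ℂ) p →ₗ[ℝ] L p
  antilinear : ∀ (s : Π p, L p) (p : N) (X : TangentSpace 𝓘(ℝ, ℂ) p),
    SmoothSectionAt 𝓘(ℝ, ℂ) ℂ s p → op s p (Complex.I • X) = -(Complex.I • op s p X)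
  add : ∀ (s t : Π p, L p) (p : N) (X : TangentSpace 𝓘(ℝ, ℂ) p),
    SmoothSectionAt 𝓘(ℝ, ℂ) ℂ s p → SmoothSectionAt 𝓘(ℝ, ℂ) ℂ t p →
      op (fun q => s q + t q) p X = op s p X + op t p X
  leibniz : ∀ (f : N → ℂ) (s : Π p, L p) (p : N) (X : TangentSpace 𝓘(ℝ, ℂ) p),
    ContMDiffAt 𝓘(ℝ, ℂ) 𝓘(ℝ, ℂ) ∞ f p → SmoothSectionAt 𝓘(ℝ, ℂ) ℂ s p →
      op (fun q => f q • s q) p X = f p • op s p X + dbarFun f p X • s p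
  smooth : ∀ (s : Π p, L p) (X : Π p : N, TangentSpace 𝓘(ℝ, ℂ) p) (p : N),
    SmoothSectionAt 𝓘(ℝ, ℂ) ℂ s p → SmoothSectionAt 𝓘(ℝ, ℂ) ℂ X p →
      SmoothSectionAt 𝓘(ℝ, ℂ) ℂ (fun q => op s q (X q)) p

variable {L}

/-- `D` is the Chern connection of the holomorphic structure `dbar` and the Hermitian metric `h`:
smooth, complex, Hermitian, and with `(0,1)`-part `dbar`. -/
structure IsChernConnection
    (dbar : (Π p, L p) → Π p : N, TangentSpace 𝓘(ℝ, ℂ) p → L p)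
    (h : HermitianMetric L) (D : CovariantDerivative 𝓘(ℝ, ℂ) ℂ L) : Prop where
  smooth : IsSmoothConnection D
  complex : ∀ (s : Π p, L p) (p : N) (X : TangentSpace 𝓘(ℝ, ℂ) p),
    SmoothSectionAt 𝓘(ℝ, ℂ) ℂ s p → D (fun q => Complex.I • s q) p X = Complex.I • D s p X
  hermitian : ∀ (s t : Π p, L p) (p : N) (X : TangentSpace 𝓘(ℝ, ℂ) p),
    SmoothSectionAt 𝓘(ℝ, ℂ) ℂ s p → SmoothSectionAt 𝓘(ℝ, ℂ) ℂ t p →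
      mvfderiv 𝓘(ℝ, ℂ) (fun q => h.form q (s q) (t q)) p X
        = h.form p (D s p X) (t p) + h.form p (s p) (D t p X)
  dbar_eq : ∀ (s : Π p, L p) (p : N) (X : TangentSpace 𝓘(ℝ, ℂ) p),
    SmoothSectionAt 𝓘(ℝ, ℂ) ℂ s p →
      (1 / 2 : ℂ) • (D s p X + Complex.I • D s p (Complex.I • X)) = dbar s p X

/-- `κ` is the normalized scalar curvature, with respect to the metric `hN` on the surface, of the
Chern connection of `(dbar, h)`: the curvature is `R(X, iX) = -κ |X|² i`. For the Levi-Civita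
connection on the tangent bundle, `κ` is the Gaussian curvature, half the scalar curvature. -/
def IsNormalizedScalarCurvature
    (hN : HermitianMetric (fun p : N => TangentSpace 𝓘(ℝ, ℂ) p))
    (dbar : (Π p, L p) → Π p : N, TangentSpace 𝓘(ℝ, ℂ) p → L p)
    (h : HermitianMetric L) (κ : N → ℝ) : Prop :=
  ∃ D : CovariantDerivative 𝓘(ℝ, ℂ) ℂ L, IsChernConnection dbar h D ∧
    ∀ (p : N) (X : TangentSpace 𝓘(ℝ, ℂ) p) (w : L p),
      curvatureAt D p X (Complex.I • X) w
        = (-(κ p * (hN.form p X X).re : ℝ) * Complex.I : ℂ) • w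

end LineBundle

/-! ## Spinor-vortex spaces -/

section SpinorVortex

variable (W : N → Type*) [TopologicalSpace (TotalSpace ℂ W)]
  [∀ p, AddCommGroup (W p)] [∀ p, Module ℝ (W p)] [∀ p, Module ℂ (W p)]
  [∀ p, TopologicalSpace (W p)] [∀ p, IsTopologicalAddGroup (W p)]
  [∀ p, ContinuousSMul ℝ (W p)] [FiberBundle ℂ W]

/-- A holomorphic structure on `W`, a smooth section `C` of `W⁻² TN`, and a smooth section `ψ` of
`W⁻¹`. -/
structure SpinorVortexData where
  /-- the holomorphic structure -/
  dbar : HolomorphicStructure W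
  /-- the section of `W⁻² TN` -/
  C : Π p : N, W p →ₗ[ℂ] W p →ₗ[ℂ] TangentSpace 𝓘(ℝ, ℂ) p
  C_smooth : ∀ (p : N) (s t : Π p, W p),
    SmoothSectionAt 𝓘(ℝ, ℂ) ℂ s p → SmoothSectionAt 𝓘(ℝ, ℂ) ℂ t p →
      SmoothSectionAt 𝓘(ℝ, ℂ) ℂ (fun q => C q (s q) (t q)) p
  /-- the section of `W⁻¹` -/
  ψ : Π p : N, W p →ₗ[ℂ] ℂ
  ψ_smooth : ∀ (p : N) (s : Π p, W p), SmoothSectionAt 𝓘(ℝ, ℂ) ℂ s p →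
    ContMDiffAt 𝓘(ℝ, ℂ) 𝓘(ℝ, ℂ) ∞ (fun q => ψ q (s q)) p

variable {W}

/-- `v` is the vector of `W p` metrically dual to `ψ`: `ψ(w) = h(v, w)` for all `w`. -/
def IsDualVector (hW : HermitianMetric W) (p : N) (ψ : W p →ₗ[ℂ] ℂ) (v : W p) : Prop :=
  ∀ w, ψ w = hW.form p v w

/-- The squared norm of `C` as a real tensor, `∑ |C(eᵢ, eⱼ)|²` over the real orthonormal basis
`w, i w` given by a unit vector `w`. -/
def tensorNormSq (hN : HermitianMetric (fun p : N => TangentSpace 𝓘(ℝ, ℂ) p)) (p : N)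
    (C : W p →ₗ[ℂ] W p →ₗ[ℂ] TangentSpace 𝓘(ℝ, ℂ) p) (w : W p) : ℝ :=
  (hN.form p (C w w) (C w w)).re
    + (hN.form p (C w (Complex.I • w)) (C w (Complex.I • w))).re
    + (hN.form p (C (Complex.I • w) w) (C (Complex.I • w) w)).re
    + (hN.form p (C (Complex.I • w) (Complex.I • w)) (C (Complex.I • w) (Complex.I • w))).re

/-- The spinor-vortex equations for `(∂̄, C, ψ)` on `(N, W)`. The identification `L¹_W = L¹_N`,
i.e. the Hermitian metric on `W⁻¹ TN`, is given by Hermitian metrics `hW` on `W` and `hN` on `TN`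
(a common choice of length scale); the equations only depend on this pair up to a common
factor. -/
structure SpinorVortexData.IsSpinorVortex (S : SpinorVortexData W)
    (hN : HermitianMetric (fun p : N => TangentSpace 𝓘(ℝ, ℂ) p)) (hW : HermitianMetric W) :
    Prop where
  /-- `∂̄ C = 0` -/
  dbar_C : ∀ (p : N) (s t : Π p, W p) (X : TangentSpace 𝓘(ℝ, ℂ) p),
    SmoothSectionAt 𝓘(ℝ, ℂ) ℂ s p → SmoothSectionAt 𝓘(ℝ, ℂ) ℂ t p →
      dbarTangent (fun q => S.C q (s q) (t q)) p X
        - S.C p (S.dbar.op s p X) (t p) - S.C p (s p) (S.dbar.op t p X) = 0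
  /-- `∂̄ ψ = -3 C ψ̄`, where `C ψ̄` is the `W⁻¹`-valued `(0,1)`-form
  `(X, w) ↦ ⟨X, C(ψ♯, w)⟩`, with `ψ♯` the vector dual to `ψ` -/
  dbar_ψ : ∀ (p : N) (s : Π p, W p) (X : TangentSpace 𝓘(ℝ, ℂ) p) (v : W p),
    SmoothSectionAt 𝓘(ℝ, ℂ) ℂ s p → IsDualVector hW p (S.ψ p) v →
      dbarFun (fun q => S.ψ q (s q)) p X - S.ψ p (S.dbar.op s p X)
        = -3 * hN.form p X (S.C p v (s p))
  /-- `s = |ψ|² - 2 |C|²`, where `s = s_N - s_W` is the normalized scalar curvature of the Chern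
  connection on `W⁻¹ TN`, `|C|` is the norm of the real tensor `C`, and `|ψ|` is the norm of the
  `W`-valued 2-form `2 Ω ⊗ i ψ♯` corresponding to `ψ`, `Ω` being the area form of `N` -/
  curvature : ∃ sN sW : N → ℝ,
    IsNormalizedScalarCurvature hN dbarTangent hN sN ∧
    IsNormalizedScalarCurvature hN (fun s p X => S.dbar.op s p X) hW sW ∧
    ∀ (p : N) (w v : W p), hW.form p w w = 1 → IsDualVector hW p (S.ψ p) v →
      sN p - sW p
        = (hW.form p ((2 * Complex.I) • v) ((2 * Complex.I) • v)).re
          - 2 * tensorNormSq hN p (S.C p) w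

end SpinorVortex

end RiemannSurface

/-! ## Reduction of a conformal 4-manifold to a Riemann surface -/

section Reduction

variable {M : Type*} [TopologicalSpace M] [ChartedSpace E4 M] [IsManifold (𝓡 4) ∞ M]
  (g : Metric4 M) (o : OrientationForm M)
  (N : Type*) [TopologicalSpace N] [ChartedSpace ℂ N] [IsManifold 𝓘(ℂ) ω N]
  (W : N → Type*) [TopologicalSpace (TotalSpace ℂ W)]
  [∀ p, AddCommGroup (W p)] [∀ p, Module ℝ (W p)] [∀ p, Module ℂ (W p)]
  [∀ p, TopologicalSpace (W p)] [∀ p, IsTopologicalAddGroup (W p)]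
  [∀ p, ContinuousSMul ℝ (W p)] [FiberBundle ℂ W]

/-- The oriented conformal 4-manifold `(M, [g], o)` has a 2-dimensional Lie algebra `𝔥` of linearly
independent conformal vector fields whose orbit space is, through the submersion `π = proj`, the Riemann
surface `N`, and `W` is a complex line bundle on `N` such that `π^*W` is the vertical bundle,
trivialized along the fibres by invariant vector fields. -/
structure SurfaceReduction where
  /-- the Lie algebra of conformal vector fields -/
  𝔥 : Submodule ℝ (Π x : M, TangentSpace (𝓡 4) x)
  symmetry : IsConformalSymmetryAlgebra g 𝔥
  /-- the projection onto the orbit space -/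
  proj : M → N
  proj_smooth : ContMDiff (𝓡 4) 𝓘(ℝ, ℂ) ∞ proj
  proj_surjective : Function.Surjective proj
  proj_submersion : ∀ x, Function.Surjective (mfderiv (𝓡 4) 𝓘(ℝ, ℂ) proj x)
  proj_orbits : ∀ x y, proj x = proj y ↔ SameOrbit 𝔥 x y
  /-- the identification of `π^*W` with the vertical bundle -/
  ι : Π x : M, W (proj x) →ₗ[ℝ] TangentSpace (𝓡 4) x
  ι_injective : ∀ x, Function.Injective (ι x)
  ι_range : ∀ x (u : TangentSpace (𝓡 4) x),
    u ∈ LinearMap.range (ι x) ↔ mfderiv (𝓡 4) 𝓘(ℝ, ℂ) proj x u = 0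
  ι_smooth : ∀ (x : M) (s : Π p, W p), SmoothSectionAt 𝓘(ℝ, ℂ) ℂ s (proj x) →
    SmoothSectionAt (𝓡 4) E4 (fun y => ι y (s (proj y))) x
  /-- sections of `W` correspond to invariant vertical vector fields -/
  ι_invariant : ∀ (x : M) (s : Π p, W p), SmoothSectionAt 𝓘(ℝ, ℂ) ℂ s (proj x) →
    ∀ K ∈ 𝔥, mlieBracket (𝓡 4) K (fun y => ι y (s (proj y))) x = 0
  /-- a metric in the conformal class of `N` -/
  hN : HermitianMetric (fun p : N => TangentSpace 𝓘(ℝ, ℂ) p)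
  /-- the metric on `W` with the same length scale as `hN` -/
  hW : HermitianMetric W
  /-- the conformal factor between `g` and the direct sum of `hW` and `hN` -/
  f : M → ℝ
  f_pos : ∀ x, 0 < f x
  /-- on the vertical bundle, the conformal structure is that of `W` -/
  conformal_vertical : ∀ x (w : W (proj x)),
    g.inner x (ι x w) (ι x w) = f x * (hW.form (proj x) w w).re
  /-- on the horizontal bundle, the conformal structure is that of `N` -/
  conformal_horizontal : ∀ x (u : TangentSpace (𝓡 4) x), IsHorizontal g x 𝔥 u →
    g.inner x u u = f x * (hN.form (proj x) (mfderiv (𝓡 4) 𝓘(ℝ, ℂ) proj x u)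
      (mfderiv (𝓡 4) 𝓘(ℝ, ℂ) proj x u)).re
  /-- the almost complex structure `J` on `TM = π^*(W ⊕ TN)` is selfdual, that is, it is compatible
  with the orientation of `M` -/
  orientation : ∀ x (w : W (proj x)) (u v : TangentSpace (𝓡 4) x), w ≠ 0 → u ≠ 0 →
    IsHorizontal g x 𝔥 u → IsHorizontal g x 𝔥 v →
    mfderiv (𝓡 4) 𝓘(ℝ, ℂ) proj x v = Complex.I • mfderiv (𝓡 4) 𝓘(ℝ, ℂ) proj x u →
      0 < o.form x ![ι x w, ι x (Complex.I • w), u, v]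

variable {g o N W}

/-- The vector field `X'` on `M` is the horizontal lift of the vector field `X` on `N`. -/
def SurfaceReduction.IsHorizontalLift (R : SurfaceReduction g o N W)
    (X : Π p : N, TangentSpace 𝓘(ℝ, ℂ) p) (X' : Π x : M, TangentSpace (𝓡 4) x) : Prop :=
  ∀ x, IsHorizontal g x R.𝔥 (X' x) ∧ mfderiv (𝓡 4) 𝓘(ℝ, ℂ) R.proj x (X' x) = X (R.proj x)

/-- The invariant vertical vector field on `M` given by a section of `W`. -/
def SurfaceReduction.vert (R : SurfaceReduction g o N W) (U : Π p, W p) :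
    Π x : M, TangentSpace (𝓡 4) x :=
  fun x => R.ι x (U (R.proj x))

/-- The data `(∂̄, C, ψ)` on `(N, W)` are those defined by the reduction, namely the torsion of the
modified conformal connection is selfdual. In terms of invariant vector fields, where `X`, `Y` are
horizontal lifts and `U`, `V` sections of `W`, the terms in the equations are
`φ⁻¹ F^α(X, Y) = -[X, Y]^{vert}`, `φ⁻¹ [φ U, φ V]_𝔥 = -[U, V]` (the bracket of invariant vertical
vector fields is minus the bracket in the Lie algebra bundle), and
`φ⁻¹ (D^α_X φ)(U) = [X, U] - D_X U`. -/
structure SurfaceReduction.Defines (R : SurfaceReduction g o N W) (S : SpinorVortexData W) :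
    Prop where
  /-- `φ⁻¹ (F^α(X, iX) - [φ U, φ (iU)]_𝔥) = ψ(X, iX)` for `|U| = |X|`, where the `W`-valued 2-form
  `ψ` is `2 Ω ⊗ i ψ♯`, so that `ψ(X, iX) = 2 |X|² i ψ♯` -/
  psi_eq : ∀ (x : M) (U : Π p, W p) (X : Π p : N, TangentSpace 𝓘(ℝ, ℂ) p)
    (X' JX' : Π x : M, TangentSpace (𝓡 4) x) (v : W (R.proj x)),
    SmoothSectionAt 𝓘(ℝ, ℂ) ℂ U (R.proj x) → SmoothSectionAt 𝓘(ℝ, ℂ) ℂ X (R.proj x) →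
    R.IsHorizontalLift X X' → R.IsHorizontalLift (fun p => Complex.I • X p) JX' →
    R.hW.form (R.proj x) (U (R.proj x)) (U (R.proj x)) = R.hN.form (R.proj x) (X (R.proj x)) (X (R.proj x)) →
    IsDualVector R.hW (R.proj x) (S.ψ (R.proj x)) v →
      IsHorizontal g x R.𝔥
        (-mlieBracket (𝓡 4) X' JX' x
          + mlieBracket (𝓡 4) (R.vert U) (R.vert fun p => Complex.I • U p) x
          - R.ι x ((2 * R.hN.form (R.proj x) (X (R.proj x)) (X (R.proj x)) * Complex.I) • v))
  /-- `φ⁻¹ (D^α_X φ(U) + D^α_{iX} φ(iU)) = ⟨C(U), X⟩ + ⟨C(iU), iX⟩`, as an identity between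
  inner products with `V`; here `D_X U + D_{iX} (iU) = 2 ∂̄_X U` -/
  C_eq : ∀ (x : M) (U : Π p, W p) (X : Π p : N, TangentSpace 𝓘(ℝ, ℂ) p)
    (X' JX' : Π x : M, TangentSpace (𝓡 4) x) (V : W (R.proj x)),
    SmoothSectionAt 𝓘(ℝ, ℂ) ℂ U (R.proj x) → SmoothSectionAt 𝓘(ℝ, ℂ) ℂ X (R.proj x) →
    R.IsHorizontalLift X X' → R.IsHorizontalLift (fun p => Complex.I • X p) JX' →
      g.inner x
        (mlieBracket (𝓡 4) X' (R.vert U) x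
          + mlieBracket (𝓡 4) JX' (R.vert fun p => Complex.I • U p) x
          - R.ι x ((2 : ℂ) • S.dbar.op U (R.proj x) (X (R.proj x)))) (R.ι x V)
      = R.f x *
        ((R.hN.form (R.proj x) (S.C (R.proj x) (U (R.proj x)) V) (X (R.proj x))).re
          + (R.hN.form (R.proj x) (S.C (R.proj x) (Complex.I • U (R.proj x)) V)
              (Complex.I • X (R.proj x))).re)

end Reduction

end

/-!
The equivalence is checked in a frame adapted to the symmetry. Near a point of `N` choose a unit
section `w` of `W` and a unit vector field `X`. The vertical fields of `w` and `iw`, followed by the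
horizontal lifts of `X` and `iX`, form a positively oriented frame of `M` whose members are mutually
orthogonal and have the same square length `f` (`SurfaceReduction.isConformalFrameAt_frame`,
`SurfaceReduction.orientation_frame`). The members commute with `𝔥`: the vertical ones by assumption,
and the lifts because a conformal vector field which projects to zero preserves both horizontality
and the projection (`SurfaceReduction.mlieBracket_symmetry_lift`). By the Jacobi identity the
structure functions `cᵢⱼᵏ` of the frame are then constant along the orbits. The definition of
`(∂̄, C, ψ)` expresses six combinations of them through the components `β` of `∂̄ w`, `γ` of `C` and
`τ` of `ψ`, and the horizontal part of the last bracket comes from `[X, iX]` on `N`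
(`SurfaceReduction.Defines.isReducedFrame`).

The Koszul formula gives the connection coefficients, and with them the Riemann tensor, of such a
frame in terms of `cᵢⱼᵏ` and the derivatives of `log √f` (`IsLeviCivita.inner_curvature_frame`). On
antiselfdual bivectors the conformal factor only contributes a multiple of the identity, and the
Jacobi identities eliminate all derivatives of structure functions which are not determined by the
spinor-vortex data (`IsReducedFrame.asdForm_frameRiemann`). What remains of the symmetric `3 × 3`
matrix of the curvature on antiselfdual bivectors, up to multiples of the identity, are five real
numbers: the real and imaginary parts of the components of `∂̄ C` and of `∂̄ ψ + 3 C ψ̄`, and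
`s - (|ψ|² - 2 |C|²)`, each with a nonzero constant factor
(`SurfaceReduction.Defines.asdForm_frameCurvature`).

It remains to compare with the two sides of the equivalence. The condition `W⁻ = 0` at a point says
that the curvature acts on the antiselfdual bivectors as a multiple of the identity. It can be tested
in a single frame, since rotations preserve the space of antiselfdual bivectors: complementary
minors of a rotation matrix agree (`IsLeviCivita.weylComp_iff`). The spinor-vortex equations are
tensorial, so they hold if and only if their components vanish in unit frames
(`SpinorVortexData.isSpinorVortex_iff`). Both notions refer to connections which have to be
constructed: the Levi-Civita connection, by the Koszul formula (`isLeviCivita_leviCivita`), and the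
Chern connections of `W` and `TN`, by gluing the connection forms of unit frames
(`HolomorphicStructure.isChernConnection_chernConnection`).
-/

noncomputable section

set_option linter.unusedSectionVars false

/-! ### Derivatives of functions and smooth sections -/

section Calculus

variable {E : Type*} [NormedAddCommGroup E] [NormedSpace ℝ E]
  {H : Type*} [TopologicalSpace H] {I : ModelWithCorners ℝ E H}
  {B : Type*} [TopologicalSpace B] [ChartedSpace H B] [IsManifold I ∞ B]
  {G : Type*} [NormedAddCommGroup G] [NormedSpace ℝ G]

lemma mvfderiv_congr_of_eventuallyEq {φ ψ : B → G} {x : B} (h : φ =ᶠ[𝓝 x] ψ) :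
    mvfderiv I φ x = mvfderiv I ψ x := by
  unfold mvfderiv
  have := h.mfderiv_eq (I := I) (I' := 𝓘(ℝ, G))
  ext v
  simp only [ContinuousLinearMap.comp_apply]
  rw [this]
  simp
  rfl

/-- Smoothness at a point does not imply smoothness nearby, but it implies differentiability nearby. -/
lemma ContMDiffAt.eventually_mdifferentiableAt {f : B → G} {x : B}
    (hf : ContMDiffAt I 𝓘(ℝ, G) ∞ f x) : ∀ᶠ y in 𝓝 x, MDifferentiableAt I 𝓘(ℝ, G) f y := by
  have h1 : ContMDiffAt I 𝓘(ℝ, G) 1 f x := hf.of_le (by simp)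
  filter_upwards [(contMDiffAt_iff_contMDiffAt_nhds (by simp)).1 h1] with y hy
  exact hy.mdifferentiableAt (by simp)

/-- The derivative of a smooth function along a smooth vector field is smooth. -/
lemma ContMDiffAt.mvfderiv_apply {φ : B → G} {X : Π x : B, TangentSpace I x} {x : B}
    (hφ : ContMDiffAt I 𝓘(ℝ, G) ∞ φ x) (hX : SmoothSectionAt I E X x) :
    ContMDiffAt I 𝓘(ℝ, G) ∞ (fun y => mvfderiv I φ y (X y)) x := by
  have h1 := hφ.mfderiv_const (m := ∞) (n := ∞) (by simp)
  have h2 := (contMDiffAt_section x).1 hX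
  have h3 := h1.clm_apply h2
  refine h3.congr_of_eventuallyEq ?_
  have := (trivializationAt E (TangentSpace I) x).open_baseSet.mem_nhds
    (FiberBundle.mem_baseSet_trivializationAt E (TangentSpace I) x)
  filter_upwards [this] with y hy
  have h4 : (trivializationAt E (TangentSpace I) x).symmL ℝ y
      ((trivializationAt E (TangentSpace I) x ⟨y, X y⟩).2) = X y := by
    have := (trivializationAt E (TangentSpace I) x).symmL_continuousLinearMapAt (R := ℝ) hy (X y)
    rwa [Trivialization.continuousLinearMapAt_apply, Trivialization.coe_linearMapAt_of_mem _ hy]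
      at this
  simp only [inTangentCoordinates, ContinuousLinearMap.inCoordinates, mvfderiv,
    ContinuousLinearMap.comp_apply, id]
  rw [h4]
  simp only [TangentBundle.continuousLinearMapAt_model_space]
  rfl

variable {F : Type*} [NormedAddCommGroup F] [NormedSpace ℝ F]
  {V : B → Type*} [TopologicalSpace (TotalSpace F V)]
  [∀ x, AddCommGroup (V x)] [∀ x, Module ℝ (V x)] [∀ x, TopologicalSpace (V x)]
  [∀ x, IsTopologicalAddGroup (V x)] [∀ x, ContinuousSMul ℝ (V x)]
  [FiberBundle F V]

lemma SmoothSectionAt.congr {s t : Π x, V x} {x : B} (hs : SmoothSectionAt I F s x)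
    (h : ∀ᶠ y in 𝓝 x, t y = s y) : SmoothSectionAt I F t x :=
  ContMDiffAt.congr_of_eventuallyEq hs (h.mono fun y hy => by simp [hy])

lemma SmoothSectionAt.mdifferentiableAt {s : Π x, V x} {x : B} (hs : SmoothSectionAt I F s x) :
    MDifferentiableAt I (I.prod 𝓘(ℝ, F)) (fun y => TotalSpace.mk' F y (s y)) x :=
  ContMDiffAt.mdifferentiableAt hs (by simp)

variable [VectorBundle ℝ F V]

lemma SmoothSectionAt.add {s t : Π x, V x} {x : B} (hs : SmoothSectionAt I F s x)
    (ht : SmoothSectionAt I F t x) : SmoothSectionAt I F (fun y => s y + t y) x :=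
  ContMDiffAt.add_section hs ht

lemma SmoothSectionAt.smul {f : B → ℝ} {s : Π x, V x} {x : B}
    (hf : ContMDiffAt I 𝓘(ℝ, ℝ) ∞ f x) (hs : SmoothSectionAt I F s x) :
    SmoothSectionAt I F (fun y => f y • s y) x :=
  ContMDiffAt.smul_section hf hs

lemma SmoothSectionAt.sum {ι : Type*} {a : Finset ι} {s : ι → Π x, V x} {x : B}
    (hs : ∀ i ∈ a, SmoothSectionAt I F (s i) x) :
    SmoothSectionAt I F (fun y => ∑ i ∈ a, s i y) x :=
  ContMDiffAt.sum_section hs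

lemma smoothSectionAt_zero (x : B) : SmoothSectionAt I F (fun y => (0 : V y)) x :=
  (Bundle.contMDiff_zeroSection ℝ V).contMDiffAt

lemma smoothSectionAt_extend [ContMDiffVectorBundle ∞ F V I] {x : B} (v : V x) :
    SmoothSectionAt I F (FiberBundle.extend F v) x :=
  FiberBundle.contMDiffAt_extend I F v

/-- The extension of a vector to a local section is smooth on a neighbourhood. Iterated covariant
derivatives need this, since a section which is smooth at a point may fail to be smooth nearby. -/
lemma eventually_smoothSectionAt_extend [ContMDiffVectorBundle ∞ F V I] {x : B} (v : V x) :
    ∀ᶠ y in 𝓝 x, SmoothSectionAt I F (FiberBundle.extend F v) y := by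
  obtain ⟨s, hs, h⟩ := FiberBundle.exists_contMDiffOn_extend (k := ∞) I F v
  filter_upwards [eventually_mem_nhds_iff.2 hs] with y hy
  exact (h y (mem_of_mem_nhds hy)).contMDiffAt hy

/-- An operation on smooth sections which is additive and linear over germs of smooth functions at
`x` depends only on the value at `x`. -/
lemma eq_of_tensorial_smooth [FiniteDimensional ℝ F] [ContMDiffVectorBundle ∞ F V I]
    {A : Type*} [AddCommGroup A] [Module ℝ A] {x : B} (Φ : (Π x, V x) → A)
    (smul : ∀ (f : B → ℝ) (s : Π x, V x), ContMDiffAt I 𝓘(ℝ, ℝ) ∞ f x →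
      SmoothSectionAt I F s x → Φ (fun y => f y • s y) = f x • Φ s)
    (add : ∀ s t : Π x, V x, SmoothSectionAt I F s x → SmoothSectionAt I F t x →
      Φ (fun y => s y + t y) = Φ s + Φ t)
    {s t : Π x, V x} (hs : SmoothSectionAt I F s x) (ht : SmoothSectionAt I F t x)
    (hst : s x = t x) : Φ s = Φ t := by
  classical
  -- locality: multiply by the indicator function of the set where the sections agree
  have hloc : ∀ {s t : Π x, V x}, SmoothSectionAt I F s x → SmoothSectionAt I F t x →
      (∀ᶠ y in 𝓝 x, s y = t y) → Φ s = Φ t := by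
    intro s t hs ht h
    let ψ (y : B) : ℝ := if s y = t y then 1 else 0
    have hψ : ContMDiffAt I 𝓘(ℝ, ℝ) ∞ ψ x :=
      (contMDiffAt_const (c := (1 : ℝ))).congr_of_eventuallyEq
        (h.mono fun y hy => by simp [ψ, hy])
    have hψx : ψ x = 1 := by simp [ψ, h.self_of_nhds]
    have h1 := smul ψ s hψ hs
    have h2 := smul ψ t hψ ht
    have h3 : (fun y => ψ y • s y) = fun y => ψ y • t y := by
      funext y
      by_cases hy : s y = t y <;> simp [ψ, hy]
    rw [h3, h2, hψx, one_smul, one_smul] at h1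
    exact h1.symm
  have hsum : ∀ {ι : Type _} (a : Finset ι) (s : ι → Π x, V x),
      (∀ i ∈ a, SmoothSectionAt I F (s i) x) →
      Φ (fun y => ∑ i ∈ a, s i y) = ∑ i ∈ a, Φ (s i) := by
    intro ι a s hs
    induction a using Finset.induction_on with
    | empty =>
      have := smul (fun _ => 0) (fun _ => 0) contMDiffAt_const (smoothSectionAt_zero x)
      simpa using this
    | insert i a hi ih =>
      simp only [Finset.sum_insert hi]
      rw [← ih fun j hj => hs j (Finset.mem_insert_of_mem hj)]
      exact add _ _ (hs i (Finset.mem_insert_self ..))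
        (SmoothSectionAt.sum fun j hj => hs j (Finset.mem_insert_of_mem hj))
  -- expand the sections in a smooth local frame
  let e := trivializationAt F V x
  have hx : x ∈ e.baseSet := FiberBundle.mem_baseSet_trivializationAt F V x
  let b := Module.Basis.ofVectorSpace ℝ F
  have hb (i) : SmoothSectionAt I F (e.localFrame b i) x :=
    contMDiffAt_localFrame_of_mem ∞ _ b i hx
  have hc {σ : Π x, V x} (hσ : SmoothSectionAt I F σ x) (i) :
      ContMDiffAt I 𝓘(ℝ, ℝ) ∞ (LinearMap.piApply (e.localFrameCoeff I b i) σ) x :=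
    contMDiffAt_localFrameCoeff b hx hσ i
  have key {σ : Π x, V x} (hσ : SmoothSectionAt I F σ x) :
      Φ σ = ∑ i, e.localFrameCoeff I b i x (σ x) • Φ (e.localFrame b i) := by
    rw [hloc hσ (SmoothSectionAt.sum (a := Finset.univ)
      fun i _ => SmoothSectionAt.smul (hc hσ i) (hb i))
      (e.eventually_eq_localFrame_sum_coeff_smul b hx), hsum]
    · refine Finset.sum_congr rfl fun i _ => ?_
      exact smul _ _ (hc hσ i) (hb i)
    · exact fun i _ => SmoothSectionAt.smul (hc hσ i) (hb i)
  rw [key hs, key ht, hst]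

end Calculus

/-! ### Lie brackets of smooth vector fields -/

section Bracket

variable {E : Type*} [NormedAddCommGroup E] [NormedSpace ℝ E] [CompleteSpace E]
  {H : Type*} [TopologicalSpace H] {I : ModelWithCorners ℝ E H}
  {B : Type*} [TopologicalSpace B] [ChartedSpace H B] [IsManifold I ∞ B]

lemma isManifold_minSmoothness_two : IsManifold I (minSmoothness ℝ 2) B := by
  simpa using (inferInstance : IsManifold I 2 B)

lemma isManifold_minSmoothness_three : IsManifold I (minSmoothness ℝ 3) B := by
  simpa using (inferInstance : IsManifold I 3 B)

lemma SmoothSectionAt.mlieBracket {X Y : Π x : B, TangentSpace I x} {x : B}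
    (hX : SmoothSectionAt I E X x) (hY : SmoothSectionAt I E Y x) :
    SmoothSectionAt I E (mlieBracket I X Y) x := by
  have : IsManifold I (((⊤ : ℕ∞) : ℕ∞ω) + 1) B := by
    simpa using (inferInstance : IsManifold I ∞ B)
  have := isManifold_minSmoothness_two (I := I) (B := B)
  exact ContMDiffAt.mlieBracket_vectorField (m := ⊤) (n := ⊤) hX hY (by simp)

/-- The Jacobi identity, in the form that `[X, ·]` is a derivation of the bracket. -/
lemma mlieBracket_jacobi {X Y Z : Π x : B, TangentSpace I x} {x : B}
    (hX : SmoothSectionAt I E X x) (hY : SmoothSectionAt I E Y x) (hZ : SmoothSectionAt I E Z x) :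
    VectorField.mlieBracket I X (VectorField.mlieBracket I Y Z) x =
      VectorField.mlieBracket I (VectorField.mlieBracket I X Y) Z x
        + VectorField.mlieBracket I Y (VectorField.mlieBracket I X Z) x := by
  have := isManifold_minSmoothness_three (I := I) (B := B)
  have h2 : minSmoothness ℝ 2 ≤ ((⊤ : ℕ∞) : ℕ∞ω) := by
    simpa using (WithTop.coe_le_coe.2 le_top : (((2 : ℕ) : ℕ∞) : ℕ∞ω) ≤ ((⊤ : ℕ∞) : ℕ∞ω))
  exact leibniz_identity_mlieBracket_apply (hX.of_le h2) (hY.of_le h2) (hZ.of_le h2)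

lemma mlieBracket_fun_smul_right {X Y : Π x : B, TangentSpace I x} {f : B → ℝ} {x : B}
    (hf : ContMDiffAt I 𝓘(ℝ, ℝ) ∞ f x) (hY : SmoothSectionAt I E Y x) :
    VectorField.mlieBracket I X (fun y => f y • Y y) x =
      mvfderiv I f x (X x) • Y x + f x • VectorField.mlieBracket I X Y x :=
  mlieBracket_smul_right (hf.mdifferentiableAt (by simp)) hY.mdifferentiableAt

lemma mlieBracket_fun_smul_left {X Y : Π x : B, TangentSpace I x} {f : B → ℝ} {x : B}
    (hf : ContMDiffAt I 𝓘(ℝ, ℝ) ∞ f x) (hX : SmoothSectionAt I E X x) :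
    VectorField.mlieBracket I (fun y => f y • X y) Y x =
      -mvfderiv I f x (Y x) • X x + f x • VectorField.mlieBracket I X Y x :=
  mlieBracket_smul_left (hf.mdifferentiableAt (by simp)) hX.mdifferentiableAt

lemma mlieBracket_fun_add_right {X Y Z : Π x : B, TangentSpace I x} {x : B}
    (hY : SmoothSectionAt I E Y x) (hZ : SmoothSectionAt I E Z x) :
    VectorField.mlieBracket I X (fun y => Y y + Z y) x =
      VectorField.mlieBracket I X Y x + VectorField.mlieBracket I X Z x :=
  mlieBracket_add_right hY.mdifferentiableAt hZ.mdifferentiableAt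

lemma mlieBracket_fun_add_left {X Y Z : Π x : B, TangentSpace I x} {x : B}
    (hY : SmoothSectionAt I E Y x) (hZ : SmoothSectionAt I E Z x) :
    VectorField.mlieBracket I (fun y => Y y + Z y) X x =
      VectorField.mlieBracket I Y X x + VectorField.mlieBracket I Z X x :=
  mlieBracket_add_left hY.mdifferentiableAt hZ.mdifferentiableAt

lemma mlieBracket_fun_sum_right {ι : Type*} (a : Finset ι) {X : Π x : B, TangentSpace I x}
    {Y : ι → Π x : B, TangentSpace I x} {x : B} (hY : ∀ i, SmoothSectionAt I E (Y i) x) :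
    VectorField.mlieBracket I X (fun y => ∑ i ∈ a, Y i y) x =
      ∑ i ∈ a, VectorField.mlieBracket I X (Y i) x := by
  classical
  induction a using Finset.induction_on with
  | empty => exact congrFun (mlieBracket_zero_right (I := I) (W := X)) x
  | insert i a hi ih =>
    simp only [Finset.sum_insert hi]
    rw [← ih, mlieBracket_fun_add_right (hY i) (SmoothSectionAt.sum fun j _ => hY j)]

lemma mlieBracket_congr_of_eventuallyEq {X X' Y Y' : Π x : B, TangentSpace I x} {x : B}
    (hX : ∀ᶠ y in 𝓝 x, X y = X' y) (hY : ∀ᶠ y in 𝓝 x, Y y = Y' y) :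
    VectorField.mlieBracket I X Y x = VectorField.mlieBracket I X' Y' x :=
  Filter.EventuallyEq.mlieBracket_vectorField_eq hX hY

/-- The Lie bracket acts on functions as the commutator of derivations. This follows from the Jacobi
identity for `X`, `Y` and `f Z`, where `Z` does not vanish at the point. -/
lemma mvfderiv_mlieBracket {X Y : Π x : B, TangentSpace I x} {f : B → ℝ} {x : B}
    (hX : SmoothSectionAt I E X x) (hY : SmoothSectionAt I E Y x)
    (hf : ContMDiffAt I 𝓘(ℝ, ℝ) ∞ f x) :
    mvfderiv I f x (VectorField.mlieBracket I X Y x) =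
      mvfderiv I (fun y => mvfderiv I f y (Y y)) x (X x)
        - mvfderiv I (fun y => mvfderiv I f y (X y)) x (Y x) := by
  by_cases h0 : ∃ v : TangentSpace I x, v ≠ 0
  swap
  · push Not at h0
    simp [h0 (X x), h0 (Y x), h0 (VectorField.mlieBracket I X Y x)]
  obtain ⟨v, hv⟩ := h0
  set Z := FiberBundle.extend E v with hZdef
  have hZev := eventually_smoothSectionAt_extend (I := I) (F := E) v
  have hZ : SmoothSectionAt I E Z x := hZev.self_of_nhds
  have hfev := hf.eventually_mdifferentiableAt
  have hbr : ∀ X : Π x : B, TangentSpace I x, ∀ᶠ y in 𝓝 x,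
      VectorField.mlieBracket I X (fun y => f y • Z y) y =
        mvfderiv I f y (X y) • Z y + f y • VectorField.mlieBracket I X Z y := by
    intro X
    filter_upwards [hfev, hZev] with y h1 h2
    exact mlieBracket_smul_right h1 h2.mdifferentiableAt
  have expand : ∀ X Y : Π x : B, TangentSpace I x, SmoothSectionAt I E X x →
      SmoothSectionAt I E Y x →
      VectorField.mlieBracket I X (VectorField.mlieBracket I Y (fun y => f y • Z y)) x =
      (mvfderiv I (fun y => mvfderiv I f y (Y y)) x (X x) • Z x
        + mvfderiv I f x (Y x) • VectorField.mlieBracket I X Z x)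
      + (mvfderiv I f x (X x) • VectorField.mlieBracket I Y Z x
        + f x • VectorField.mlieBracket I X (VectorField.mlieBracket I Y Z) x) := by
    intro X Y hX hY
    rw [mlieBracket_congr_of_eventuallyEq (Filter.Eventually.of_forall fun _ => rfl) (hbr Y),
      mlieBracket_fun_add_right (SmoothSectionAt.smul (hf.mvfderiv_apply hY) hZ)
        (SmoothSectionAt.smul hf (hY.mlieBracket hZ)),
      mlieBracket_fun_smul_right (hf.mvfderiv_apply hY) hZ,
      mlieBracket_fun_smul_right hf (hY.mlieBracket hZ)]
  have hJ := mlieBracket_jacobi hX hY (SmoothSectionAt.smul hf hZ)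
  have hJ0 := mlieBracket_jacobi hX hY hZ
  rw [expand X Y hX hY, expand Y X hY hX, mlieBracket_fun_smul_right hf hZ, hJ0] at hJ
  have h1 : (mvfderiv I f x (VectorField.mlieBracket I X Y x)
      - (mvfderiv I (fun y => mvfderiv I f y (Y y)) x (X x)
        - mvfderiv I (fun y => mvfderiv I f y (X y)) x (Y x))) • Z x = 0 := by
    rw [sub_smul, sub_smul]
    rw [smul_add, ← sub_eq_zero] at hJ
    have hJ' := congrArg Neg.neg hJ
    rw [neg_zero] at hJ'
    rw [← hJ']
    abel
  have hZx : Z x ≠ 0 := by simpa [hZdef] using hv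
  have := (smul_eq_zero.1 h1).resolve_right hZx
  linarith

end Bracket

/-! ### The curvature of a connection -/

section Curvature

variable {E : Type*} [NormedAddCommGroup E] [NormedSpace ℝ E] [CompleteSpace E]
  [FiniteDimensional ℝ E]
  {H : Type*} [TopologicalSpace H] {I : ModelWithCorners ℝ E H}
  {B : Type*} [TopologicalSpace B] [ChartedSpace H B] [IsManifold I ∞ B]
  {F : Type*} [NormedAddCommGroup F] [NormedSpace ℝ F] [FiniteDimensional ℝ F]
  {V : B → Type*} [TopologicalSpace (TotalSpace F V)]
  [∀ x, AddCommGroup (V x)] [∀ x, Module ℝ (V x)] [∀ x, TopologicalSpace (V x)]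
  [∀ x, IsTopologicalAddGroup (V x)] [∀ x, ContinuousSMul ℝ (V x)]
  [FiberBundle F V] [VectorBundle ℝ F V]

lemma SmoothSectionAt.eventually_mdifferentiableAt [ContMDiffVectorBundle ∞ F V I]
    {s : Π x, V x} {x : B} (hs : SmoothSectionAt I F s x) :
    ∀ᶠ y in 𝓝 x, MDifferentiableAt I (I.prod 𝓘(ℝ, F)) (fun y => TotalSpace.mk' F y (s y)) y := by
  have : IsManifold (I.prod 𝓘(ℝ, F)) 1 (TotalSpace F V) := by
    have : IsManifold (I.prod 𝓘(ℝ, F)) ∞ (TotalSpace F V) := Bundle.TotalSpace.isManifold F V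
    infer_instance
  have h1 : ContMDiffAt I (I.prod 𝓘(ℝ, F)) 1 (fun y => TotalSpace.mk' F y (s y)) x :=
    ContMDiffAt.of_le hs (by simp)
  filter_upwards [(contMDiffAt_iff_contMDiffAt_nhds (by simp)).1 h1] with y hy
  exact hy.mdifferentiableAt (by simp)

namespace CovariantDerivative

variable (D : CovariantDerivative I F V)

lemma fun_add_apply {s t : Π x, V x} {x : B}
    (hs : MDifferentiableAt I (I.prod 𝓘(ℝ, F)) (fun y => TotalSpace.mk' F y (s y)) x)
    (ht : MDifferentiableAt I (I.prod 𝓘(ℝ, F)) (fun y => TotalSpace.mk' F y (t y)) x)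
    (u : TangentSpace I x) :
    D (fun y => s y + t y) x u = D s x u + D t x u :=
  congrArg (fun L : TangentSpace I x →L[ℝ] V x => L u) (D.isCovariantDerivativeOnUniv.add hs ht)

lemma fun_smul_apply {f : B → ℝ} {s : Π x, V x} {x : B}
    (hf : MDifferentiableAt I 𝓘(ℝ, ℝ) f x)
    (hs : MDifferentiableAt I (I.prod 𝓘(ℝ, F)) (fun y => TotalSpace.mk' F y (s y)) x)
    (u : TangentSpace I x) :
    D (fun y => f y • s y) x u = f x • D s x u + mvfderiv I f x u • s x :=
  congrArg (fun L : TangentSpace I x →L[ℝ] V x => L u)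
    (D.isCovariantDerivativeOnUniv.leibniz hs hf)

/-- A covariant derivative only depends on the germ of the section. -/
lemma congr_apply {s t : Π x, V x} {x : B}
    (hs : MDifferentiableAt I (I.prod 𝓘(ℝ, F)) (fun y => TotalSpace.mk' F y (s y)) x)
    (h : ∀ᶠ y in 𝓝 x, t y = s y) (u : TangentSpace I x) : D t x u = D s x u := by
  refine congrArg (fun L : TangentSpace I x →L[ℝ] V x => L u)
    (D.isCovariantDerivativeOnUniv.congr_of_eventuallyEq ?_ hs Filter.univ_mem h)
  exact hs.congr_of_eventuallyEq (h.mono fun y hy => by simp [hy])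

lemma sum_smul_apply {ι : Type*} (a : Finset ι) {f : ι → B → ℝ} {s : ι → Π x, V x} {x : B}
    (hf : ∀ i, ContMDiffAt I 𝓘(ℝ, ℝ) ∞ (f i) x) (hs : ∀ i, SmoothSectionAt I F (s i) x)
    (u : TangentSpace I x) :
    D (fun y => ∑ i ∈ a, f i y • s i y) x u
      = ∑ i ∈ a, (f i x • D (s i) x u + mvfderiv I (f i) x u • s i x) := by
  classical
  induction a using Finset.induction_on with
  | empty =>
    have h := D.zero
    exact congrArg (fun T : Π x, TangentSpace I x →L[ℝ] V x => T x u) h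
  | insert i a hi ih =>
    simp only [Finset.sum_insert hi]
    rw [← ih, D.fun_add_apply (SmoothSectionAt.smul (hf i) (hs i)).mdifferentiableAt
      (SmoothSectionAt.sum fun j _ => SmoothSectionAt.smul (hf j) (hs j)).mdifferentiableAt,
      D.fun_smul_apply ((hf i).mdifferentiableAt (by simp)) (hs i).mdifferentiableAt]

/-- The curvature operator `D_X D_Y s - D_Y D_X s - D_[X,Y] s` on sections. -/
def curvatureOp (X Y : Π x : B, TangentSpace I x) (s : Π x, V x) (x : B) : V x :=
  D (fun y => D s y (Y y)) x (X x) - D (fun y => D s y (X y)) x (Y x)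
    - D s x (mlieBracket I X Y x)

variable {D}

lemma curvatureOp_swap (X Y : Π x : B, TangentSpace I x) (s : Π x, V x) (x : B) :
    D.curvatureOp X Y s x = -D.curvatureOp Y X s x := by
  unfold curvatureOp
  rw [mlieBracket_swap_apply, map_neg]
  abel

variable (hD : IsSmoothConnection D) {x : B}
include hD

lemma curvatureOp_add_left {X X' Y : Π x : B, TangentSpace I x} {s : Π x, V x}
    (hX : SmoothSectionAt I E X x) (hX' : SmoothSectionAt I E X' x)
    (hs : SmoothSectionAt I F s x) :
    D.curvatureOp (fun y => X y + X' y) Y s x = D.curvatureOp X Y s x + D.curvatureOp X' Y s x := by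
  unfold curvatureOp
  simp only [map_add]
  rw [D.fun_add_apply (hD x s X hs hX).mdifferentiableAt (hD x s X' hs hX').mdifferentiableAt,
    mlieBracket_fun_add_left hX hX', map_add]
  abel

lemma curvatureOp_smul_left {f : B → ℝ} {X Y : Π x : B, TangentSpace I x} {s : Π x, V x}
    (hf : ContMDiffAt I 𝓘(ℝ, ℝ) ∞ f x)
    (hX : SmoothSectionAt I E X x) (hs : SmoothSectionAt I F s x) :
    D.curvatureOp (fun y => f y • X y) Y s x = f x • D.curvatureOp X Y s x := by
  unfold curvatureOp
  simp only [map_smul]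
  rw [D.fun_smul_apply (hf.mdifferentiableAt (by simp)) (hD x s X hs hX).mdifferentiableAt,
    mlieBracket_fun_smul_left hf hX, map_add, map_smul, map_smul]
  module

variable [ContMDiffVectorBundle ∞ F V I]

lemma curvatureOp_add_right {X Y : Π x : B, TangentSpace I x} {s t : Π x, V x}
    (hX : SmoothSectionAt I E X x) (hY : SmoothSectionAt I E Y x)
    (hs : SmoothSectionAt I F s x) (ht : SmoothSectionAt I F t x) :
    D.curvatureOp X Y (fun y => s y + t y) x = D.curvatureOp X Y s x + D.curvatureOp X Y t x := by
  have key : ∀ {X Y : Π x : B, TangentSpace I x}, SmoothSectionAt I E Y x →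
      D (fun y => D (fun y => s y + t y) y (Y y)) x (X x)
        = D (fun y => D s y (Y y)) x (X x) + D (fun y => D t y (Y y)) x (X x) := by
    intro X Y hY
    rw [← D.fun_add_apply (hD x s Y hs hY).mdifferentiableAt (hD x t Y ht hY).mdifferentiableAt]
    refine D.congr_apply ((hD x s Y hs hY).add (hD x t Y ht hY)).mdifferentiableAt ?_ _
    filter_upwards [hs.eventually_mdifferentiableAt, ht.eventually_mdifferentiableAt] with y h1 h2
    exact D.fun_add_apply h1 h2 _
  unfold curvatureOp
  rw [key hY, key hX, D.fun_add_apply hs.mdifferentiableAt ht.mdifferentiableAt]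
  abel

lemma curvatureOp_smul_right {f : B → ℝ} {X Y : Π x : B, TangentSpace I x} {s : Π x, V x}
    (hf : ContMDiffAt I 𝓘(ℝ, ℝ) ∞ f x)
    (hX : SmoothSectionAt I E X x) (hY : SmoothSectionAt I E Y x)
    (hs : SmoothSectionAt I F s x) :
    D.curvatureOp X Y (fun y => f y • s y) x = f x • D.curvatureOp X Y s x := by
  have key : ∀ {X Y : Π x : B, TangentSpace I x}, SmoothSectionAt I E Y x →
      D (fun y => D (fun y => f y • s y) y (Y y)) x (X x)
        = (f x • D (fun y => D s y (Y y)) x (X x) + mvfderiv I f x (X x) • D s x (Y x))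
          + (mvfderiv I f x (Y x) • D s x (X x)
            + mvfderiv I (fun y => mvfderiv I f y (Y y)) x (X x) • s x) := by
    intro X Y hY
    have h1 := hD x s Y hs hY
    rw [← D.fun_smul_apply (hf.mdifferentiableAt (by simp)) h1.mdifferentiableAt,
      ← D.fun_smul_apply ((hf.mvfderiv_apply hY).mdifferentiableAt (by simp)) hs.mdifferentiableAt,
      ← D.fun_add_apply (SmoothSectionAt.smul hf h1).mdifferentiableAt
        (SmoothSectionAt.smul (hf.mvfderiv_apply hY) hs).mdifferentiableAt]
    refine D.congr_apply ((SmoothSectionAt.smul hf h1).add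
        (SmoothSectionAt.smul (hf.mvfderiv_apply hY) hs)).mdifferentiableAt ?_ _
    filter_upwards [hs.eventually_mdifferentiableAt, hf.eventually_mdifferentiableAt] with y h1 h2
    exact D.fun_smul_apply h2 h1 _
  unfold curvatureOp
  rw [key hY, key hX, D.fun_smul_apply (hf.mdifferentiableAt (by simp)) hs.mdifferentiableAt,
    mvfderiv_mlieBracket hX hY hf]
  module

/-- The curvature at a point may be computed from arbitrary smooth extensions. -/
theorem curvatureAt_eq_curvatureOp {X Y : Π x : B, TangentSpace I x} {s : Π x, V x}
    (hX : SmoothSectionAt I E X x) (hY : SmoothSectionAt I E Y x)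
    (hs : SmoothSectionAt I F s x) :
    curvatureAt D x (X x) (Y x) (s x) = D.curvatureOp X Y s x := by
  have hX' := smoothSectionAt_extend (I := I) (F := E) (X x)
  have hY' := smoothSectionAt_extend (I := I) (F := E) (Y x)
  have hs' := smoothSectionAt_extend (I := I) (F := F) (s x)
  have h0 : curvatureAt D x (X x) (Y x) (s x)
      = D.curvatureOp (FiberBundle.extend E (X x)) (FiberBundle.extend E (Y x))
        (FiberBundle.extend F (s x)) x := by
    simp [curvatureAt, curvatureOp]
  rw [h0]
  -- replace the extensions one at a time
  have step1 := eq_of_tensorial_smooth (I := I)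
    (fun X => D.curvatureOp X (FiberBundle.extend E (Y x)) (FiberBundle.extend F (s x)) x)
    (fun f X hf hX => curvatureOp_smul_left hD hf hX hs')
    (fun X X' hX hX' => curvatureOp_add_left hD hX hX' hs') hX' hX (by simp)
  have step2 := eq_of_tensorial_smooth (I := I)
    (fun Y => D.curvatureOp X Y (FiberBundle.extend F (s x)) x)
    (fun f Y hf hY => by
      rw [curvatureOp_swap, curvatureOp_smul_left hD hf hY hs', curvatureOp_swap, smul_neg, neg_neg])
    (fun Y Y' hY hY' => by
      rw [curvatureOp_swap, curvatureOp_add_left hD hY hY' hs', curvatureOp_swap,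
        curvatureOp_swap Y']
      abel) hY' hY (by simp)
  have step3 := eq_of_tensorial_smooth (I := I) (fun s => D.curvatureOp X Y s x)
    (fun f s hf hs => curvatureOp_smul_right hD hf hX hY hs)
    (fun s t hs ht => curvatureOp_add_right hD hX hY hs ht) hs' hs (by simp)
  exact step1.trans (step2.trans step3)

lemma curvatureAt_swap (u v : TangentSpace I x) (w : V x) :
    curvatureAt D x u v w = -curvatureAt D x v u w := by
  have hu := smoothSectionAt_extend (I := I) (F := E) u
  have hv := smoothSectionAt_extend (I := I) (F := E) v
  have hw := smoothSectionAt_extend (I := I) (F := F) w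
  have h1 := curvatureAt_eq_curvatureOp hD hu hv hw
  have h2 := curvatureAt_eq_curvatureOp hD hv hu hw
  simp only [FiberBundle.extend_apply_self] at h1 h2
  rw [h1, h2, curvatureOp_swap]

lemma curvatureAt_add_left (u u' v : TangentSpace I x) (w : V x) :
    curvatureAt D x (u + u') v w = curvatureAt D x u v w + curvatureAt D x u' v w := by
  have hu := smoothSectionAt_extend (I := I) (F := E) u
  have hu' := smoothSectionAt_extend (I := I) (F := E) u'
  have hv := smoothSectionAt_extend (I := I) (F := E) v
  have hw := smoothSectionAt_extend (I := I) (F := F) w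
  have h1 := curvatureAt_eq_curvatureOp hD hu hv hw
  have h2 := curvatureAt_eq_curvatureOp hD hu' hv hw
  have h3 := curvatureAt_eq_curvatureOp hD (hu.add hu') hv hw
  simp only [FiberBundle.extend_apply_self] at h1 h2 h3
  rw [h1, h2, h3, curvatureOp_add_left hD hu hu' hw]

lemma curvatureAt_smul_left (c : ℝ) (u v : TangentSpace I x) (w : V x) :
    curvatureAt D x (c • u) v w = c • curvatureAt D x u v w := by
  have hu := smoothSectionAt_extend (I := I) (F := E) u
  have hv := smoothSectionAt_extend (I := I) (F := E) v
  have hw := smoothSectionAt_extend (I := I) (F := F) w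
  have hc : ContMDiffAt I 𝓘(ℝ, ℝ) ∞ (fun _ : B => c) x := contMDiffAt_const
  have h1 := curvatureAt_eq_curvatureOp hD hu hv hw
  have h3 := curvatureAt_eq_curvatureOp hD (SmoothSectionAt.smul hc hu) hv hw
  simp only [FiberBundle.extend_apply_self] at h1 h3
  rw [h1, h3, curvatureOp_smul_left hD hc hu hw]

lemma curvatureAt_add_right (u v : TangentSpace I x) (w w' : V x) :
    curvatureAt D x u v (w + w') = curvatureAt D x u v w + curvatureAt D x u v w' := by
  have hu := smoothSectionAt_extend (I := I) (F := E) u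
  have hv := smoothSectionAt_extend (I := I) (F := E) v
  have hw := smoothSectionAt_extend (I := I) (F := F) w
  have hw' := smoothSectionAt_extend (I := I) (F := F) w'
  have h1 := curvatureAt_eq_curvatureOp hD hu hv hw
  have h2 := curvatureAt_eq_curvatureOp hD hu hv hw'
  have h3 := curvatureAt_eq_curvatureOp hD hu hv (hw.add hw')
  simp only [FiberBundle.extend_apply_self] at h1 h2 h3
  rw [h1, h2, h3, curvatureOp_add_right hD hu hv hw hw']

lemma curvatureAt_smul_right (c : ℝ) (u v : TangentSpace I x) (w : V x) :
    curvatureAt D x u v (c • w) = c • curvatureAt D x u v w := by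
  have hu := smoothSectionAt_extend (I := I) (F := E) u
  have hv := smoothSectionAt_extend (I := I) (F := E) v
  have hw := smoothSectionAt_extend (I := I) (F := F) w
  have hc : ContMDiffAt I 𝓘(ℝ, ℝ) ∞ (fun _ : B => c) x := contMDiffAt_const
  have h1 := curvatureAt_eq_curvatureOp hD hu hv hw
  have h3 := curvatureAt_eq_curvatureOp hD hu hv (SmoothSectionAt.smul hc hw)
  simp only [FiberBundle.extend_apply_self] at h1 h3
  rw [h1, h3, curvatureOp_smul_right hD hc hu hv hw]

end CovariantDerivative

end Curvature

/-! ### Symmetries of the Riemann tensor -/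

section LeviCivitaCurvature

variable {M : Type*} [TopologicalSpace M] [ChartedSpace E4 M] [IsManifold (𝓡 4) ∞ M]
  {g : Metric4 M} {D : CovariantDerivative (𝓡 4) E4 (fun x : M => TangentSpace (𝓡 4) x)}

lemma Metric4.contMDiffAt_inner (g : Metric4 M) {X Y : Π x : M, TangentSpace (𝓡 4) x} {x : M}
    (hX : SmoothSectionAt (𝓡 4) E4 X x) (hY : SmoothSectionAt (𝓡 4) E4 Y x) :
    ContMDiffAt (𝓡 4) 𝓘(ℝ, ℝ) ∞ (fun y => g.inner y (X y) (Y y)) x := by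
  have h := ContMDiffAt.clm_bundle_apply₂ (F₁ := E4) (F₂ := E4) (F₃ := ℝ)
    (E₁ := fun x : M => TangentSpace (𝓡 4) x) (E₂ := fun x : M => TangentSpace (𝓡 4) x)
    (E₃ := Bundle.Trivial M ℝ) (ψ := fun y => g.inner y) (g.contMDiff x) hX hY
  exact (contMDiffAt_totalSpace.1 h).2

namespace IsLeviCivita

variable (h : IsLeviCivita g D) {x : M}
include h

/-- The first Bianchi identity: as `D` is torsion-free, the cyclic sum of the curvatures is the cyclic
sum of iterated brackets, which vanishes by the Jacobi identity. -/
lemma bianchi (u v w : TangentSpace (𝓡 4) x) :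
    curvatureAt D x u v w + curvatureAt D x v w u + curvatureAt D x w u v = 0 := by
  set X := FiberBundle.extend E4 u with hXdef
  set Y := FiberBundle.extend E4 v with hYdef
  set Z := FiberBundle.extend E4 w with hZdef
  have hXe := eventually_smoothSectionAt_extend (I := 𝓡 4) (F := E4) u
  have hYe := eventually_smoothSectionAt_extend (I := 𝓡 4) (F := E4) v
  have hZe := eventually_smoothSectionAt_extend (I := 𝓡 4) (F := E4) w
  have key : ∀ (X Y Z : Π x : M, TangentSpace (𝓡 4) x),
      (∀ᶠ y in 𝓝 x, SmoothSectionAt (𝓡 4) E4 X y) → (∀ᶠ y in 𝓝 x, SmoothSectionAt (𝓡 4) E4 Y y) →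
      (∀ᶠ y in 𝓝 x, SmoothSectionAt (𝓡 4) E4 Z y) →
      D (fun y => D Z y (Y y)) x (X x) - D (fun y => D Y y (Z y)) x (X x)
        - D X x (mlieBracket (𝓡 4) Y Z x) = mlieBracket (𝓡 4) X (mlieBracket (𝓡 4) Y Z) x := by
    intro X Y Z hX hY hZ
    have hX := hX.self_of_nhds
    have hY' := hY.self_of_nhds
    have hZ' := hZ.self_of_nhds
    have h1 := h.smooth x Z Y hZ' hY'
    have h2 := h.smooth x Y Z hY' hZ'
    have h3 : D (fun y => D Z y (Y y)) x (X x)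
        = D (fun y => D Y y (Z y) + mlieBracket (𝓡 4) Y Z y) x (X x) := by
      refine D.congr_apply (h2.add (hY'.mlieBracket hZ')).mdifferentiableAt ?_ _
      filter_upwards [hY, hZ] with y h4 h5
      rw [← h.torsion_free y Y Z h4 h5]
      abel
    rw [h3, D.fun_add_apply h2.mdifferentiableAt (hY'.mlieBracket hZ').mdifferentiableAt,
      ← h.torsion_free x X _ hX (hY'.mlieBracket hZ')]
    abel
  have e1 := key X Y Z hXe hYe hZe
  have e2 := key Y Z X hYe hZe hXe
  have e3 := key Z X Y hZe hXe hYe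
  have J := mlieBracket_jacobi hXe.self_of_nhds hYe.self_of_nhds hZe.self_of_nhds
  have J2 : mlieBracket (𝓡 4) (mlieBracket (𝓡 4) X Y) Z x
      = -mlieBracket (𝓡 4) Z (mlieBracket (𝓡 4) X Y) x := mlieBracket_swap_apply
  have J3 : mlieBracket (𝓡 4) Y (mlieBracket (𝓡 4) X Z) x
      = -mlieBracket (𝓡 4) Y (mlieBracket (𝓡 4) Z X) x := by
    rw [mlieBracket_swap (V := X) (W := Z)]
    have : (-mlieBracket (𝓡 4) Z X : Π x : M, TangentSpace (𝓡 4) x)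
        = fun y => (fun _ => (-1 : ℝ)) y • mlieBracket (𝓡 4) Z X y := by
      funext y; simp
    rw [this, mlieBracket_fun_smul_right contMDiffAt_const
      (hZe.self_of_nhds.mlieBracket hXe.self_of_nhds)]
    simp only [mvfderiv_const, zero_apply, zero_smul, zero_add, neg_smul, one_smul]
    rfl
  rw [J2, J3, ← e1, ← e2, ← e3] at J
  have e : ∀ (X Y Z : Π x : M, TangentSpace (𝓡 4) x), D.curvatureOp X Y Z x =
      D (fun y => D Z y (Y y)) x (X x) - D (fun y => D Z y (X y)) x (Y x)
        - D Z x (mlieBracket (𝓡 4) X Y x) := fun _ _ _ => rfl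
  have c1 := CovariantDerivative.curvatureAt_eq_curvatureOp h.smooth hXe.self_of_nhds
    hYe.self_of_nhds hZe.self_of_nhds
  have c2 := CovariantDerivative.curvatureAt_eq_curvatureOp h.smooth hYe.self_of_nhds
    hZe.self_of_nhds hXe.self_of_nhds
  have c3 := CovariantDerivative.curvatureAt_eq_curvatureOp h.smooth hZe.self_of_nhds
    hXe.self_of_nhds hYe.self_of_nhds
  simp only [FiberBundle.extend_apply_self] at c1 c2 c3
  rw [c1, c2, c3, e, e, e]
  rw [← sub_eq_zero] at J
  rw [← J]
  simp only [hXdef, hYdef, hZdef]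
  abel

/-- The curvature of a metric connection is skew: the second derivatives of `g(Z, W)` commute up to the
derivative along the bracket. -/
lemma inner_curvatureAt_swap (u v w z : TangentSpace (𝓡 4) x) :
    g.inner x (curvatureAt D x u v w) z = -g.inner x (curvatureAt D x u v z) w := by
  set X := FiberBundle.extend E4 u with hXdef
  set Y := FiberBundle.extend E4 v with hYdef
  set Z := FiberBundle.extend E4 w with hZdef
  set W := FiberBundle.extend E4 z with hWdef
  have hX := smoothSectionAt_extend (I := 𝓡 4) (F := E4) u
  have hY := smoothSectionAt_extend (I := 𝓡 4) (F := E4) v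
  have hZe := eventually_smoothSectionAt_extend (I := 𝓡 4) (F := E4) w
  have hWe := eventually_smoothSectionAt_extend (I := 𝓡 4) (F := E4) z
  have hZ := hZe.self_of_nhds
  have hW := hWe.self_of_nhds
  have second : ∀ (X Y : Π x : M, TangentSpace (𝓡 4) x), SmoothSectionAt (𝓡 4) E4 X x →
      SmoothSectionAt (𝓡 4) E4 Y x →
      mvfderiv (𝓡 4) (fun y => mvfderiv (𝓡 4) (fun y => g.inner y (Z y) (W y)) y (Y y)) x (X x)
      = (g.inner x (D (fun y => D Z y (Y y)) x (X x)) (W x)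
          + g.inner x (D Z x (Y x)) (D W x (X x)))
        + (g.inner x (D Z x (X x)) (D W x (Y x))
          + g.inner x (Z x) (D (fun y => D W y (Y y)) x (X x))) := by
    intro X Y hX hY
    have hZY := h.smooth x Z Y hZ hY
    have hWY := h.smooth x W Y hW hY
    rw [← h.metric x _ W (X x) hZY hW, ← h.metric x Z _ (X x) hZ hWY]
    rw [← add_apply, ← mvfderiv_fun_add
      ((g.contMDiffAt_inner hZY hW).mdifferentiableAt (by simp))
      ((g.contMDiffAt_inner hZ hWY).mdifferentiableAt (by simp))]
    rw [mvfderiv_congr_of_eventuallyEq]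
    filter_upwards [hZe, hWe] with y h1 h2
    exact h.metric y Z W (Y y) h1 h2
  have hb := mvfderiv_mlieBracket hX hY (g.contMDiffAt_inner hZ hW)
  rw [second X Y hX hY, second Y X hY hX, h.metric x Z W _ hZ hW] at hb
  have c1 := CovariantDerivative.curvatureAt_eq_curvatureOp h.smooth hX hY hZ
  have c2 := CovariantDerivative.curvatureAt_eq_curvatureOp h.smooth hX hY hW
  simp only [FiberBundle.extend_apply_self] at c1 c2
  have hw : w = Z x := by simp [hZdef]
  have hz : z = W x := by simp [hWdef]
  rw [c1, c2, g.symm x _ w, hw, hz]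
  simp only [CovariantDerivative.curvatureOp, map_sub, sub_apply]
  simp only [hXdef, hYdef, hZdef, hWdef] at hb ⊢
  simp only [FiberBundle.extend_apply_self] at hb ⊢
  linarith

end IsLeviCivita

end LeviCivitaCurvature

/-! ### The Koszul form -/

section MetricDual

variable {M : Type*} [TopologicalSpace M] [ChartedSpace E4 M] [IsManifold (𝓡 4) ∞ M]
  (g : Metric4 M)

lemma contMDiffAt_matrix_det {n : Type*} [Fintype n] [DecidableEq n] {A : M → Matrix n n ℝ} {x : M}
    (hA : ∀ i j, ContMDiffAt (𝓡 4) 𝓘(ℝ, ℝ) ∞ (fun y => A y i j) x) :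
    ContMDiffAt (𝓡 4) 𝓘(ℝ, ℝ) ∞ (fun y => (A y).det) x := by
  simp only [Matrix.det_apply']
  refine ContMDiffAt.sum fun σ _ => ?_
  exact contMDiffAt_const.mul (contMDiffAt_finsetProd fun i _ => hA _ _)

lemma Metric4.mdifferentiableAt_inner (g : Metric4 M) {X Y : Π x : M, TangentSpace (𝓡 4) x} {x : M}
    (hX : MDifferentiableAt (𝓡 4) ((𝓡 4).prod 𝓘(ℝ, E4)) (fun y => TotalSpace.mk' E4 y (X y)) x)
    (hY : MDifferentiableAt (𝓡 4) ((𝓡 4).prod 𝓘(ℝ, E4)) (fun y => TotalSpace.mk' E4 y (Y y)) x) :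
    MDifferentiableAt (𝓡 4) 𝓘(ℝ, ℝ) (fun y => g.inner y (X y) (Y y)) x := by
  have h := MDifferentiableAt.clm_bundle_apply₂ (F₁ := E4) (F₂ := E4) (F₃ := ℝ)
    (E₁ := fun x : M => TangentSpace (𝓡 4) x)
    (E₂ := fun x : M => TangentSpace (𝓡 4) x) (E₃ := Bundle.Trivial M ℝ)
    (ψ := fun y => g.inner y) ((g.contMDiff x).mdifferentiableAt (by simp)) hX hY
  exact ((mdifferentiableAt_totalSpace _ _).1 h).2

/-- A vector field with smooth inner products with smooth vector fields is smooth: its components in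
a local frame are given by Cramer's rule for the Gram matrix. -/
lemma Metric4.smoothSectionAt_of_inner {V : Π x : M, TangentSpace (𝓡 4) x} {x : M}
    (h : ∀ Z : Π x : M, TangentSpace (𝓡 4) x, (∀ᶠ y in 𝓝 x, SmoothSectionAt (𝓡 4) E4 Z y) →
      ContMDiffAt (𝓡 4) 𝓘(ℝ, ℝ) ∞ (fun y => g.inner y (V y) (Z y)) x) :
    SmoothSectionAt (𝓡 4) E4 V x := by
  classical
  let e := trivializationAt E4 (fun x : M => TangentSpace (𝓡 4) x) x
  have hx : x ∈ e.baseSet := FiberBundle.mem_baseSet_trivializationAt _ _ x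
  have hbase : ∀ᶠ y in 𝓝 x, y ∈ e.baseSet := e.open_baseSet.mem_nhds hx
  let b := (EuclideanSpace.basisFun (Fin 4) ℝ).toBasis
  let Z : Fin 4 → Π x : M, TangentSpace (𝓡 4) x := fun i => e.localFrame b i
  have hZ (i) : ∀ᶠ y in 𝓝 x, SmoothSectionAt (𝓡 4) E4 (Z i) y :=
    hbase.mono fun y hy => contMDiffAt_localFrame_of_mem ∞ _ b i hy
  let A : M → Matrix (Fin 4) (Fin 4) ℝ := fun y => Matrix.of fun i j => g.inner y (Z i y) (Z j y)
  have hA : ∀ i j, ContMDiffAt (𝓡 4) 𝓘(ℝ, ℝ) ∞ (fun y => A y i j) x := fun i j =>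
    g.contMDiffAt_inner (hZ i).self_of_nhds (hZ j).self_of_nhds
  let c : Fin 4 → M → ℝ := fun i y => e.localFrameCoeff (𝓡 4) b i y (V y)
  have hV : ∀ᶠ y in 𝓝 x, V y = ∑ i, c i y • Z i y :=
    e.eventually_eq_localFrame_sum_coeff_smul b hx
  let r : M → Fin 4 → ℝ := fun y j => g.inner y (V y) (Z j y)
  have hr : ∀ j, ContMDiffAt (𝓡 4) 𝓘(ℝ, ℝ) ∞ (fun y => r y j) x := fun j => h _ (hZ j)
  have hAc : ∀ᶠ y in 𝓝 x, (A y).mulVec (fun i => c i y) = r y := by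
    filter_upwards [hV] with y hy
    funext j
    simp only [r]
    rw [hy]
    simp only [map_sum, sum_apply, map_smul, smul_apply, Matrix.mulVec, dotProduct, A,
      Matrix.of_apply, smul_eq_mul]
    refine Finset.sum_congr rfl fun i _ => ?_
    rw [g.symm y (Z j y), mul_comm]
  -- the Gram matrix of the local frame is invertible, as the metric is definite
  have hdet : (A x).det ≠ 0 := by
    intro h0
    obtain ⟨v, hv0, hv⟩ := Matrix.exists_mulVec_eq_zero_iff.2 h0
    have hz : ∑ i, v i • Z i x = 0 := by
      by_contra hne
      have hp := g.pos x _ hne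
      have : g.inner x (∑ i, v i • Z i x) (∑ i, v i • Z i x) = ∑ i, v i * ((A x).mulVec v) i := by
        simp only [map_sum, sum_apply, map_smul, smul_apply, Matrix.mulVec, dotProduct, A,
          Matrix.of_apply, smul_eq_mul, Finset.mul_sum]
        rw [Finset.sum_comm]
        refine Finset.sum_congr rfl fun i _ => Finset.sum_congr rfl fun j _ => ?_
        ring
      rw [this, hv] at hp
      simp at hp
    have hli := (e.basisAt b hx).linearIndependent
    rw [Fintype.linearIndependent_iff] at hli
    refine hv0 (funext fun i => hli v ?_ i)
    rw [← hz]
    refine Finset.sum_congr rfl fun i _ => ?_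
    rw [← e.localFrame_apply_of_mem_baseSet b hx]
  have hdet' : ∀ᶠ y in 𝓝 x, (A y).det ≠ 0 :=
    (contMDiffAt_matrix_det hA).continuousAt.eventually_ne hdet
  have hc : ∀ i, ContMDiffAt (𝓡 4) 𝓘(ℝ, ℝ) ∞ (c i) x := by
    intro i
    have h1 : ContMDiffAt (𝓡 4) 𝓘(ℝ, ℝ) ∞
        (fun y => ((A y).updateCol i (r y)).det * ((A y).det)⁻¹) x := by
      refine (contMDiffAt_matrix_det fun k l => ?_).mul ?_
      · by_cases hl : l = i
        · subst hl; simpa using hr k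
        · simpa [hl] using hA k l
      · exact (contMDiffAt_matrix_det hA).inv₀ hdet
    refine h1.congr_of_eventuallyEq ?_
    filter_upwards [hAc, hdet'] with y h2 h3
    have h4 : Matrix.cramer (A y) (r y) = (A y).det • fun i => c i y := by
      rw [Matrix.cramer_eq_adjugate_mulVec, ← h2, Matrix.mulVec_mulVec, Matrix.adjugate_mul,
        Matrix.smul_mulVec, Matrix.one_mulVec]
    have h5 := congrFun h4 i
    rw [Matrix.cramer_apply] at h5
    simp only [Pi.smul_apply, smul_eq_mul] at h5
    rw [h5]
    field_simp
  exact SmoothSectionAt.congr (SmoothSectionAt.sum (a := Finset.univ)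
    fun i _ => SmoothSectionAt.smul (hc i) (hZ i).self_of_nhds) hV

variable {g}

lemma Metric4.eq_of_inner_eq {x : M} {u v : TangentSpace (𝓡 4) x}
    (h : ∀ w, g.inner x u w = g.inner x v w) : u = v := by
  by_contra hne
  have := g.pos x (u - v) (sub_ne_zero.2 hne)
  have h' : g.inner x (u - v) (u - v) = 0 := by
    rw [(g.inner x).map_sub u v, sub_apply, h, sub_self]
  rw [h'] at this
  exact lt_irrefl _ this

/-- Bilinear forms on a tangent space are represented by endomorphisms. -/
lemma Metric4.exists_inner_eq {x : M}
    (K : TangentSpace (𝓡 4) x →L[ℝ] TangentSpace (𝓡 4) x →L[ℝ] ℝ) :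
    ∃ A : TangentSpace (𝓡 4) x →L[ℝ] TangentSpace (𝓡 4) x, ∀ u w, g.inner x (A u) w = K u w := by
  have : FiniteDimensional ℝ (TangentSpace (𝓡 4) x) := inferInstanceAs (FiniteDimensional ℝ E4)
  have : T2Space (TangentSpace (𝓡 4) x) := inferInstanceAs (T2Space E4)
  let b : LinearMap.BilinForm ℝ (TangentSpace (𝓡 4) x) :=
    LinearMap.mk₂ ℝ (fun u v => g.inner x u v) (by simp) (by simp) (by simp) (by simp)
  have hb : b.Nondegenerate := by
    constructor
    · intro u hu
      by_contra h0
      exact (g.pos x u h0).ne' (hu u)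
    · intro u hu
      by_contra h0
      exact (g.pos x u h0).ne' (hu u)
  let A : TangentSpace (𝓡 4) x →ₗ[ℝ] TangentSpace (𝓡 4) x :=
    { toFun := fun u => (b.toDual hb).symm (K u).toLinearMap
      map_add' := by intro u v; simp
      map_smul' := by intro c u; simp }
  refine ⟨LinearMap.toContinuousLinearMap A, fun u w => ?_⟩
  have := LinearMap.BilinForm.toDual_def (B := b) hb (m := A u) (n := w)
  simp only [A, LinearMap.coe_mk, AddHom.coe_mk, LinearEquiv.apply_symm_apply] at this
  exact this.symm

variable (g)

/-- The Koszul form, which is `2 g(D_X Y, Z)` for the Levi-Civita connection `D`. The field to be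
differentiated comes first, as it stays fixed when the form is viewed as a tensor in `X` and `Z`. -/
def koszulForm (Y X Z : Π x : M, TangentSpace (𝓡 4) x) (x : M) : ℝ :=
  mvfderiv (𝓡 4) (fun y => g.inner y (Y y) (Z y)) x (X x)
    + mvfderiv (𝓡 4) (fun y => g.inner y (X y) (Z y)) x (Y x)
    - mvfderiv (𝓡 4) (fun y => g.inner y (X y) (Y y)) x (Z x)
    + g.inner x (mlieBracket (𝓡 4) X Y x) (Z x)
    - g.inner x (mlieBracket (𝓡 4) X Z x) (Y x)
    - g.inner x (mlieBracket (𝓡 4) Y Z x) (X x)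

variable {x : M} {Y : Π x : M, TangentSpace (𝓡 4) x}
  (hY : MDifferentiableAt (𝓡 4) ((𝓡 4).prod 𝓘(ℝ, E4)) (fun y => TotalSpace.mk' E4 y (Y y)) x)
include hY

lemma tensorialAt_koszulForm_left {Z : Π x : M, TangentSpace (𝓡 4) x}
    (hZ : MDifferentiableAt (𝓡 4) ((𝓡 4).prod 𝓘(ℝ, E4)) (fun y => TotalSpace.mk' E4 y (Z y)) x) :
    TensorialAt (𝓡 4) E4 (fun X => koszulForm g Y X Z x) x where
  smul {f X} hf hX := by
    have h1 : ∀ W : Π x : M, TangentSpace (𝓡 4) x,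
        (fun y => g.inner y ((f • X) y) (W y)) = fun y => f y * g.inner y (X y) (W y) := by
      intro W; funext y; simp
    simp only [koszulForm, h1]
    rw [mvfderiv_fun_mul hf (g.mdifferentiableAt_inner hX hZ),
      mvfderiv_fun_mul hf (g.mdifferentiableAt_inner hX hY),
      mlieBracket_smul_left hf hX, mlieBracket_smul_left hf hX]
    simp only [Pi.smul_apply', map_smul, map_add, add_apply, smul_apply, smul_eq_mul, map_neg, neg_smul, neg_apply]
    ring
  add {X X'} hX hX' := by
    have h1 : ∀ W : Π x : M, TangentSpace (𝓡 4) x,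
        (fun y => g.inner y ((X + X') y) (W y))
          = fun y => g.inner y (X y) (W y) + g.inner y (X' y) (W y) := by
      intro W; funext y; simp
    simp only [koszulForm, h1]
    rw [mvfderiv_fun_add (g.mdifferentiableAt_inner hX hZ) (g.mdifferentiableAt_inner hX' hZ),
      mvfderiv_fun_add (g.mdifferentiableAt_inner hX hY) (g.mdifferentiableAt_inner hX' hY),
      mlieBracket_add_left hX hX', mlieBracket_add_left hX hX']
    simp only [Pi.add_apply, map_add, add_apply]
    ring

lemma tensorialAt_koszulForm_right {X : Π x : M, TangentSpace (𝓡 4) x}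
    (hX : MDifferentiableAt (𝓡 4) ((𝓡 4).prod 𝓘(ℝ, E4)) (fun y => TotalSpace.mk' E4 y (X y)) x) :
    TensorialAt (𝓡 4) E4 (fun Z => koszulForm g Y X Z x) x where
  smul {f Z} hf hZ := by
    have h1 : ∀ W : Π x : M, TangentSpace (𝓡 4) x,
        (fun y => g.inner y (W y) ((f • Z) y)) = fun y => f y * g.inner y (W y) (Z y) := by
      intro W; funext y; simp
    simp only [koszulForm, h1]
    rw [mvfderiv_fun_mul hf (g.mdifferentiableAt_inner hY hZ),
      mvfderiv_fun_mul hf (g.mdifferentiableAt_inner hX hZ),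
      mlieBracket_smul_right hf hZ, mlieBracket_smul_right hf hZ]
    simp only [Pi.smul_apply', map_smul, map_add, add_apply, smul_apply, smul_eq_mul]
    rw [g.symm x (Z x) (X x), g.symm x (Z x) (Y x)]
    ring
  add {Z Z'} hZ hZ' := by
    have h1 : ∀ W : Π x : M, TangentSpace (𝓡 4) x,
        (fun y => g.inner y (W y) ((Z + Z') y))
          = fun y => g.inner y (W y) (Z y) + g.inner y (W y) (Z' y) := by
      intro W; funext y; simp
    simp only [koszulForm, h1]
    rw [mvfderiv_fun_add (g.mdifferentiableAt_inner hY hZ) (g.mdifferentiableAt_inner hY hZ'),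
      mvfderiv_fun_add (g.mdifferentiableAt_inner hX hZ) (g.mdifferentiableAt_inner hX hZ'),
      mlieBracket_add_right hZ hZ', mlieBracket_add_right hZ hZ']
    simp only [Pi.add_apply, map_add, add_apply]
    ring

lemma exists_koszul_operator :
    ∃ A : TangentSpace (𝓡 4) x →L[ℝ] TangentSpace (𝓡 4) x,
      ∀ X Z : Π x : M, TangentSpace (𝓡 4) x,
      MDifferentiableAt (𝓡 4) ((𝓡 4).prod 𝓘(ℝ, E4)) (fun y => TotalSpace.mk' E4 y (X y)) x →
      MDifferentiableAt (𝓡 4) ((𝓡 4).prod 𝓘(ℝ, E4)) (fun y => TotalSpace.mk' E4 y (Z y)) x →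
      g.inner x (A (X x)) (Z x) = koszulForm g Y X Z x / 2 := by
  obtain ⟨A, hA⟩ := Metric4.exists_inner_eq (g := g)
    (TensorialAt.mkHom₂ (I := 𝓡 4) (F := E4) (F' := E4) (fun X Z => koszulForm g Y X Z x) x
      (fun Z hZ => tensorialAt_koszulForm_left g hY hZ)
      (fun X hX => tensorialAt_koszulForm_right g hY hX))
  refine ⟨(1 / 2 : ℝ) • A, fun X Z hX hZ => ?_⟩
  rw [smul_apply, map_smul, smul_apply, hA, TensorialAt.mkHom₂_apply _ _ hX hZ, smul_eq_mul]
  ring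

end MetricDual

/-! ### The Levi-Civita connection -/

section Existence

variable {M : Type*} [TopologicalSpace M] [ChartedSpace E4 M] [IsManifold (𝓡 4) ∞ M]
  (g : Metric4 M)

open scoped Classical in
/-- The operator `X ↦ D_X Y` of the Levi-Civita connection, determined by the Koszul formula; it is
zero by convention where `Y` is not differentiable. -/
def leviCivitaFun (Y : Π x : M, TangentSpace (𝓡 4) x) (x : M) :
    TangentSpace (𝓡 4) x →L[ℝ] TangentSpace (𝓡 4) x :=
  if hY : MDifferentiableAt (𝓡 4) ((𝓡 4).prod 𝓘(ℝ, E4)) (fun y => TotalSpace.mk' E4 y (Y y)) x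
  then (exists_koszul_operator g hY).choose else 0

lemma inner_leviCivitaFun {x : M} {X Y Z : Π x : M, TangentSpace (𝓡 4) x}
    (hY : MDifferentiableAt (𝓡 4) ((𝓡 4).prod 𝓘(ℝ, E4)) (fun y => TotalSpace.mk' E4 y (Y y)) x)
    (hX : MDifferentiableAt (𝓡 4) ((𝓡 4).prod 𝓘(ℝ, E4)) (fun y => TotalSpace.mk' E4 y (X y)) x)
    (hZ : MDifferentiableAt (𝓡 4) ((𝓡 4).prod 𝓘(ℝ, E4)) (fun y => TotalSpace.mk' E4 y (Z y)) x) :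
    g.inner x (leviCivitaFun g Y x (X x)) (Z x) = koszulForm g Y X Z x / 2 := by
  rw [leviCivitaFun, dif_pos hY]
  exact (exists_koszul_operator g hY).choose_spec X Z hX hZ

/-- The Koszul formula characterizes the Levi-Civita operator. -/
lemma leviCivitaFun_ext {x : M} {A : TangentSpace (𝓡 4) x →L[ℝ] TangentSpace (𝓡 4) x}
    {Y : Π x : M, TangentSpace (𝓡 4) x}
    (hY : MDifferentiableAt (𝓡 4) ((𝓡 4).prod 𝓘(ℝ, E4)) (fun y => TotalSpace.mk' E4 y (Y y)) x)
    (h : ∀ X Z : Π x : M, TangentSpace (𝓡 4) x,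
      MDifferentiableAt (𝓡 4) ((𝓡 4).prod 𝓘(ℝ, E4)) (fun y => TotalSpace.mk' E4 y (X y)) x →
      MDifferentiableAt (𝓡 4) ((𝓡 4).prod 𝓘(ℝ, E4)) (fun y => TotalSpace.mk' E4 y (Z y)) x →
      koszulForm g Y X Z x = 2 * g.inner x (A (X x)) (Z x)) :
    leviCivitaFun g Y x = A := by
  ext u : 1
  refine Metric4.eq_of_inner_eq (g := g) fun w => ?_
  have hX := FiberBundle.mdifferentiableAt_extend (𝓡 4) E4 u
  have hZ := FiberBundle.mdifferentiableAt_extend (𝓡 4) E4 w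
  have h1 := inner_leviCivitaFun g hY hX hZ
  have h2 := h _ _ hX hZ
  simp only [FiberBundle.extend_apply_self] at h1 h2
  rw [h1, h2]
  ring

/-- The Levi-Civita connection of a Riemannian metric. -/
def leviCivita : CovariantDerivative (𝓡 4) E4 (fun x : M => TangentSpace (𝓡 4) x) where
  toFun := leviCivitaFun g
  isCovariantDerivativeOnUniv :=
    { add := by
        intro Y Y' x hY hY' _
        refine leviCivitaFun_ext g (mdifferentiableAt_add_section hY hY') fun X Z hX hZ => ?_
        rw [add_apply, map_add, add_apply, inner_leviCivitaFun g hY hX hZ,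
          inner_leviCivitaFun g hY' hX hZ]
        have h1 : ∀ W : Π x : M, TangentSpace (𝓡 4) x,
            (fun y => g.inner y ((Y + Y') y) (W y))
              = fun y => g.inner y (Y y) (W y) + g.inner y (Y' y) (W y) := by
          intro W; funext y; simp
        have h2 : ∀ W : Π x : M, TangentSpace (𝓡 4) x,
            (fun y => g.inner y (W y) ((Y + Y') y))
              = fun y => g.inner y (W y) (Y y) + g.inner y (W y) (Y' y) := by
          intro W; funext y; simp
        simp only [koszulForm, h1, h2]
        rw [mvfderiv_fun_add (g.mdifferentiableAt_inner hY hZ) (g.mdifferentiableAt_inner hY' hZ),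
          mvfderiv_fun_add (g.mdifferentiableAt_inner hX hY) (g.mdifferentiableAt_inner hX hY'),
          mlieBracket_add_left hY hY', mlieBracket_add_right hY hY']
        simp only [Pi.add_apply, map_add, add_apply]
        ring
      leibniz := by
        intro Y f x hY hf _
        refine leviCivitaFun_ext g (hf.smul_section hY) fun X Z hX hZ => ?_
        rw [add_apply, map_add, add_apply, smul_apply, map_smul, smul_apply,
          inner_leviCivitaFun g hY hX hZ]
        have h1 : ∀ W : Π x : M, TangentSpace (𝓡 4) x,
            (fun y => g.inner y ((f • Y) y) (W y)) = fun y => f y * g.inner y (Y y) (W y) := by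
          intro W; funext y; simp
        have h2 : ∀ W : Π x : M, TangentSpace (𝓡 4) x,
            (fun y => g.inner y (W y) ((f • Y) y)) = fun y => f y * g.inner y (W y) (Y y) := by
          intro W; funext y; simp
        simp only [koszulForm, h1, h2]
        rw [mvfderiv_fun_mul hf (g.mdifferentiableAt_inner hY hZ),
          mvfderiv_fun_mul hf (g.mdifferentiableAt_inner hX hY),
          mlieBracket_smul_left hf hY, mlieBracket_smul_right hf hY]
        simp only [Pi.smul_apply', map_smul, map_add, add_apply, smul_apply, smul_eq_mul,
          ContinuousLinearMap.smulRight_apply, map_neg, neg_smul, neg_apply]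
        rw [g.symm x (Y x) (X x)]
        ring }

theorem isLeviCivita_leviCivita : IsLeviCivita g (leviCivita g) where
  smooth := by
    intro x Y X hY hX
    refine g.smoothSectionAt_of_inner fun Z hZ => ?_
    have hZ' := hZ.self_of_nhds
    have h1 : ContMDiffAt (𝓡 4) 𝓘(ℝ, ℝ) ∞ (fun y => koszulForm g Y X Z y / 2) x := by
      simp only [div_eq_mul_inv]
      exact ((((((g.contMDiffAt_inner hY hZ').mvfderiv_apply hX).add
        ((g.contMDiffAt_inner hX hZ').mvfderiv_apply hY)).sub
        ((g.contMDiffAt_inner hX hY).mvfderiv_apply hZ')).add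
        (g.contMDiffAt_inner (hX.mlieBracket hY) hZ')).sub
        (g.contMDiffAt_inner (hX.mlieBracket hZ') hY)).sub
        (g.contMDiffAt_inner (hY.mlieBracket hZ') hX) |>.mul contMDiffAt_const
    refine h1.congr_of_eventuallyEq ?_
    filter_upwards [hX.eventually_mdifferentiableAt, hY.eventually_mdifferentiableAt, hZ]
      with y h2 h3 h4
    exact inner_leviCivitaFun g h3 h2 h4.mdifferentiableAt
  torsion_free := by
    intro x X Y hX hY
    refine Metric4.eq_of_inner_eq (g := g) fun w => ?_
    have hZ := FiberBundle.mdifferentiableAt_extend (𝓡 4) E4 w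
    have h1 := inner_leviCivitaFun g hY.mdifferentiableAt hX.mdifferentiableAt hZ
    have h2 := inner_leviCivitaFun g hX.mdifferentiableAt hY.mdifferentiableAt hZ
    simp only [FiberBundle.extend_apply_self] at h1 h2
    change g.inner x (leviCivitaFun g Y x (X x) - leviCivitaFun g X x (Y x)) w = _
    rw [map_sub, sub_apply, h1, h2]
    simp only [koszulForm, g.symm _ (Y _) (X _), FiberBundle.extend_apply_self]
    rw [mlieBracket_swap_apply (V := Y) (W := X)]
    simp only [map_neg, neg_apply]
    ring
  metric := by
    intro x Y Z u hY hZ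
    have hX := FiberBundle.mdifferentiableAt_extend (𝓡 4) E4 u
    have h1 := inner_leviCivitaFun g hY.mdifferentiableAt hX hZ.mdifferentiableAt
    have h2 := inner_leviCivitaFun g hZ.mdifferentiableAt hX hY.mdifferentiableAt
    simp only [FiberBundle.extend_apply_self] at h1 h2
    change _ = g.inner x (leviCivitaFun g Y x u) (Z x) + g.inner x (Y x) (leviCivitaFun g Z x u)
    rw [g.symm x (Y x), h1, h2]
    simp only [koszulForm, FiberBundle.extend_apply_self]
    rw [mlieBracket_swap_apply (V := Z) (W := Y)]
    simp only [g.symm _ (Z _) (Y _), map_neg, neg_apply]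
    ring

end Existence

/-! ### Derivatives of complex functions -/

section ComplexFunctions

variable {E : Type*} [NormedAddCommGroup E] [NormedSpace ℝ E]
  {H : Type*} [TopologicalSpace H] {I : ModelWithCorners ℝ E H}
  {B : Type*} [TopologicalSpace B] [ChartedSpace H B] [IsManifold I ∞ B]
  {G G' : Type*} [NormedAddCommGroup G] [NormedSpace ℝ G] [NormedAddCommGroup G'] [NormedSpace ℝ G']

lemma mvfderiv_clm_comp (L : G →L[ℝ] G') {f : B → G} {x : B} (hf : MDifferentiableAt I 𝓘(ℝ, G) f x)
    (u : TangentSpace I x) :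
    mvfderiv I (fun y => L (f y)) x u = L (mvfderiv I f x u) := by
  have h := mfderiv_comp (I := I) (I' := 𝓘(ℝ, G)) (I'' := 𝓘(ℝ, G')) x
    (L.mdifferentiableAt (x := f x)) hf
  change mfderiv I 𝓘(ℝ, G') (fun y => L (f y)) x u = L (mfderiv I 𝓘(ℝ, G) f x u)
  have h2 : (fun y => L (f y)) = L ∘ f := rfl
  rw [h2, h, ContinuousLinearMap.mfderiv_eq]
  rfl

lemma mvfderiv_re {f : B → ℂ} {x : B} (hf : MDifferentiableAt I 𝓘(ℝ, ℂ) f x)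
    (u : TangentSpace I x) :
    mvfderiv I (fun y => (f y).re) x u = (mvfderiv I f x u).re :=
  mvfderiv_clm_comp Complex.reCLM hf u

lemma mvfderiv_im {f : B → ℂ} {x : B} (hf : MDifferentiableAt I 𝓘(ℝ, ℂ) f x)
    (u : TangentSpace I x) :
    mvfderiv I (fun y => (f y).im) x u = (mvfderiv I f x u).im :=
  mvfderiv_clm_comp Complex.imCLM hf u

lemma mvfderiv_conj {f : B → ℂ} {x : B} (hf : MDifferentiableAt I 𝓘(ℝ, ℂ) f x)
    (u : TangentSpace I x) :
    mvfderiv I (fun y => starRingEnd ℂ (f y)) x u = starRingEnd ℂ (mvfderiv I f x u) :=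
  mvfderiv_clm_comp Complex.conjCLE.toContinuousLinearMap hf u

lemma mvfderiv_complex_mul {f g : B → ℂ} {x : B} (hf : MDifferentiableAt I 𝓘(ℝ, ℂ) f x)
    (hg : MDifferentiableAt I 𝓘(ℝ, ℂ) g x) (u : TangentSpace I x) :
    mvfderiv I (fun y => f y * g y) x u = f x * mvfderiv I g x u + mvfderiv I f x u * g x := by
  have h := (hf.hasMFDerivAt.mul hg.hasMFDerivAt).mfderiv
  change mfderiv I 𝓘(ℝ, ℂ) (f * g) x u = _
  rw [h, mul_comm _ (g x)]
  rfl

lemma mvfderiv_const_mul (c : ℂ) {f : B → ℂ} {x : B} (hf : MDifferentiableAt I 𝓘(ℝ, ℂ) f x)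
    (u : TangentSpace I x) :
    mvfderiv I (fun y => c * f y) x u = c * mvfderiv I f x u := by
  rw [mvfderiv_complex_mul mdifferentiableAt_const hf, mvfderiv_const]
  simp

lemma ContMDiffAt.clm_apply_const (L : G →L[ℝ] G') {f : B → G} {x : B}
    (hf : ContMDiffAt I 𝓘(ℝ, G) ∞ f x) : ContMDiffAt I 𝓘(ℝ, G') ∞ (fun y => L (f y)) x :=
  L.contMDiff.contMDiffAt.comp x hf

lemma ContMDiffAt.re {f : B → ℂ} {x : B} (hf : ContMDiffAt I 𝓘(ℝ, ℂ) ∞ f x) :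
    ContMDiffAt I 𝓘(ℝ, ℝ) ∞ (fun y => (f y).re) x := hf.clm_apply_const Complex.reCLM

lemma ContMDiffAt.im {f : B → ℂ} {x : B} (hf : ContMDiffAt I 𝓘(ℝ, ℂ) ∞ f x) :
    ContMDiffAt I 𝓘(ℝ, ℝ) ∞ (fun y => (f y).im) x := hf.clm_apply_const Complex.imCLM

lemma ContMDiffAt.conj {f : B → ℂ} {x : B} (hf : ContMDiffAt I 𝓘(ℝ, ℂ) ∞ f x) :
    ContMDiffAt I 𝓘(ℝ, ℂ) ∞ (fun y => starRingEnd ℂ (f y)) x :=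
  hf.clm_apply_const Complex.conjCLE.toContinuousLinearMap

lemma ContMDiffAt.complex_mul {f g : B → ℂ} {x : B} (hf : ContMDiffAt I 𝓘(ℝ, ℂ) ∞ f x)
    (hg : ContMDiffAt I 𝓘(ℝ, ℂ) ∞ g x) : ContMDiffAt I 𝓘(ℝ, ℂ) ∞ (fun y => f y * g y) x :=
  (hf.clm_apply_const (ContinuousLinearMap.mul ℝ ℂ)).clm_apply hg

lemma mvfderiv_mlieBracket_complex [CompleteSpace E] {X Y : Π x : B, TangentSpace I x} {f : B → ℂ}
    {x : B} (hX : SmoothSectionAt I E X x) (hY : SmoothSectionAt I E Y x)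
    (hf : ContMDiffAt I 𝓘(ℝ, ℂ) ∞ f x) :
    mvfderiv I f x (VectorField.mlieBracket I X Y x) =
      mvfderiv I (fun y => mvfderiv I f y (Y y)) x (X x)
        - mvfderiv I (fun y => mvfderiv I f y (X y)) x (Y x) := by
  have hd {X : Π x : B, TangentSpace I x} (hX : SmoothSectionAt I E X x) :=
    (hf.mvfderiv_apply hX).mdifferentiableAt (by simp)
  have hev := hf.eventually_mdifferentiableAt
  have hre {X Y : Π x : B, TangentSpace I x} (hY : SmoothSectionAt I E Y x) :
      mvfderiv I (fun y => mvfderiv I (fun y => (f y).re) y (Y y)) x (X x)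
        = (mvfderiv I (fun y => mvfderiv I f y (Y y)) x (X x)).re := by
    rw [← mvfderiv_re (hd hY)]
    congr 1
    exact mvfderiv_congr_of_eventuallyEq (hev.mono fun y hy => mvfderiv_re hy _)
  have him {X Y : Π x : B, TangentSpace I x} (hY : SmoothSectionAt I E Y x) :
      mvfderiv I (fun y => mvfderiv I (fun y => (f y).im) y (Y y)) x (X x)
        = (mvfderiv I (fun y => mvfderiv I f y (Y y)) x (X x)).im := by
    rw [← mvfderiv_im (hd hY)]
    congr 1
    exact mvfderiv_congr_of_eventuallyEq (hev.mono fun y hy => mvfderiv_im hy _)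
  have h1 := mvfderiv_mlieBracket hX hY hf.re
  have h2 := mvfderiv_mlieBracket hX hY hf.im
  rw [hre hY, hre hX, mvfderiv_re hev.self_of_nhds] at h1
  rw [him hY, him hX, mvfderiv_im hev.self_of_nhds] at h2
  exact Complex.ext (by simpa using h1) (by simpa using h2)

end ComplexFunctions

/-! ### Hermitian line bundles and unit frames -/

section LineBundles

variable {N : Type*} [TopologicalSpace N] [ChartedSpace ℂ N] [IsManifold 𝓘(ℂ) ω N]

variable (L : N → Type*) [TopologicalSpace (TotalSpace ℂ L)]
  [∀ p, AddCommGroup (L p)] [∀ p, Module ℝ (L p)] [∀ p, Module ℂ (L p)]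
  [∀ p, IsScalarTower ℝ ℂ (L p)]
  [∀ p, TopologicalSpace (L p)] [∀ p, IsTopologicalAddGroup (L p)]
  [∀ p, ContinuousSMul ℝ (L p)] [FiberBundle ℂ L] [VectorBundle ℝ ℂ L]
  [ContMDiffVectorBundle ∞ ℂ L 𝓘(ℝ, ℂ)]

/-- A real vector bundle of rank two over a Riemann surface whose fibres carry complex structures is
a smooth complex line bundle: multiplication of sections by complex functions preserves smoothness,
and fibres have complex dimension one. -/
structure IsComplexLineBundle : Prop where
  smul_smooth : ∀ (p : N) (f : N → ℂ) (s : Π p, L p), ContMDiffAt 𝓘(ℝ, ℂ) 𝓘(ℝ, ℂ) ∞ f p →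
    SmoothSectionAt 𝓘(ℝ, ℂ) ℂ s p → SmoothSectionAt 𝓘(ℝ, ℂ) ℂ (fun q => f q • s q) p
  rank_one : ∀ (p : N) (v w : L p), v ≠ 0 → ∃ c : ℂ, w = c • v

variable {L}

lemma exists_fiber_ne_zero (p : N) : ∃ v : L p, v ≠ 0 := by
  have e := VectorBundle.continuousLinearEquivAt ℝ ℂ L p
  exact ⟨e.symm 1, by simp⟩

/-- `w` is a smooth unit section of the Hermitian line bundle `L` near `p`. Since a section which is
smooth at `p` need not be smooth nearby, smoothness is required on a neighbourhood. -/
def IsUnitFrameAt (h : HermitianMetric L) (w : Π p, L p) (p : N) : Prop :=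
  ∀ᶠ q in 𝓝 p, SmoothSectionAt 𝓘(ℝ, ℂ) ℂ w q ∧ h.form q (w q) (w q) = 1

namespace HermitianMetric

variable (h : HermitianMetric L)

lemma form_self_im (p : N) (v : L p) : (h.form p v v).im = 0 := by
  have := congrArg Complex.im (h.symm p v v)
  simp at this
  linarith

lemma form_self_eq (p : N) (v : L p) : h.form p v v = ((h.form p v v).re : ℂ) :=
  Complex.ext (by simp) (by simpa using h.form_self_im p v)

lemma form_real_smul (p : N) (c : ℝ) (v w : L p) :
    h.form p v (c • w) = c * h.form p v w := by
  rw [← algebraMap_smul ℂ c w, map_smul]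
  simp

lemma form_real_smul_left (p : N) (c : ℝ) (v w : L p) :
    h.form p (c • v) w = c * h.form p v w := by
  rw [← algebraMap_smul ℂ c v, map_smulₛₗ]
  simp

/-- Unit frames exist: normalize the smooth extension of a nonzero vector. -/
lemma exists_isUnitFrameAt (p : N) : ∃ w : Π p, L p, IsUnitFrameAt h w p := by
  obtain ⟨v, hv⟩ := exists_fiber_ne_zero (L := L) p
  set e := FiberBundle.extend ℂ v with hedef
  have he := eventually_smoothSectionAt_extend (I := 𝓘(ℝ, ℂ)) (F := ℂ) v
  have hpos : 0 < (h.form p (e p) (e p)).re := by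
    refine h.pos p _ ?_
    simpa [hedef] using hv
  have hcont : ContinuousAt (fun q => (h.form q (e q) (e q)).re) p :=
    (h.smooth p e e he.self_of_nhds he.self_of_nhds).re.continuousAt
  have hpos' := hcont.eventually (lt_mem_nhds hpos)
  refine ⟨fun q => (√(h.form q (e q) (e q)).re)⁻¹ • e q, ?_⟩
  filter_upwards [he, hpos'] with q h1 h2
  have h3 := (h.smooth q e e h1 h1).re
  constructor
  · refine SmoothSectionAt.smul ?_ h1
    refine ContMDiffAt.inv₀ ?_ (Real.sqrt_ne_zero'.2 h2)
    exact (Real.contDiffAt_sqrt h2.ne').contMDiffAt.comp q h3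
  · rw [form_real_smul, form_real_smul_left, form_self_eq]
    have h4 : (√(h.form q (e q) (e q)).re) * √(h.form q (e q) (e q)).re
      = (h.form q (e q) (e q)).re := Real.mul_self_sqrt h2.le
    have h5 := Real.sqrt_ne_zero'.2 h2
    generalize √(h.form q (e q) (e q)).re = r at *
    rw [← h4]
    norm_cast
    field_simp

end HermitianMetric

lemma IsUnitFrameAt.eventually {h : HermitianMetric L} {w : Π p, L p} {p : N}
    (hw : IsUnitFrameAt h w p) : ∀ᶠ q in 𝓝 p, IsUnitFrameAt h w q :=
  eventually_eventually_nhds.2 hw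

lemma IsUnitFrameAt.smooth {h : HermitianMetric L} {w : Π p, L p} {p : N}
    (hw : IsUnitFrameAt h w p) : SmoothSectionAt 𝓘(ℝ, ℂ) ℂ w p := hw.self_of_nhds.1

lemma IsUnitFrameAt.form_self {h : HermitianMetric L} {w : Π p, L p} {p : N}
    (hw : IsUnitFrameAt h w p) : h.form p (w p) (w p) = 1 := hw.self_of_nhds.2

lemma IsUnitFrameAt.ne_zero {h : HermitianMetric L} {w : Π p, L p} {p : N}
    (hw : IsUnitFrameAt h w p) : w p ≠ 0 := by
  intro h0
  have := hw.form_self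
  rw [h0] at this
  simp at this

lemma IsUnitFrameAt.eq_smul (hL : IsComplexLineBundle L) {h : HermitianMetric L} {w : Π p, L p}
    {p : N} (hw : IsUnitFrameAt h w p) (v : L p) : v = h.form p (w p) v • w p := by
  obtain ⟨c, rfl⟩ := hL.rank_one p (w p) v hw.ne_zero
  simp [hw.form_self]

/-- The components of a differentiable section in a unit frame are differentiable. -/
lemma HermitianMetric.mdifferentiableAt_form (h : HermitianMetric L) {w s : Π p, L p} {p : N}
    (hw : SmoothSectionAt 𝓘(ℝ, ℂ) ℂ w p)
    (hs : MDifferentiableAt 𝓘(ℝ, ℂ) (𝓘(ℝ, ℂ).prod 𝓘(ℝ, ℂ)) (fun y => TotalSpace.mk' ℂ y (s y)) p) :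
    MDifferentiableAt 𝓘(ℝ, ℂ) 𝓘(ℝ, ℂ) (fun q => h.form q (w q) (s q)) p := by
  let e := trivializationAt ℂ L p
  have hp : p ∈ e.baseSet := FiberBundle.mem_baseSet_trivializationAt ℂ L p
  let b := Complex.basisOneI
  have hb (i) : SmoothSectionAt 𝓘(ℝ, ℂ) ℂ (e.localFrame b i) p :=
    contMDiffAt_localFrame_of_mem ∞ _ b i hp
  have hc (i) : MDifferentiableAt 𝓘(ℝ, ℂ) 𝓘(ℝ, ℝ)
      (fun q => e.localFrameCoeff 𝓘(ℝ, ℂ) b i q (s q)) p :=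
    mdifferentiableAt_localFrameCoeff b hp hs i
  have h1 : MDifferentiableAt 𝓘(ℝ, ℂ) 𝓘(ℝ, ℂ) (fun q => ∑ i,
      e.localFrameCoeff 𝓘(ℝ, ℂ) b i q (s q) • h.form q (w q) (e.localFrame b i q)) p := by
    simp only [Fin.sum_univ_two]
    exact ((hc 0).smul ((h.smooth p _ _ hw (hb 0)).mdifferentiableAt (by simp))).add
      ((hc 1).smul ((h.smooth p _ _ hw (hb 1)).mdifferentiableAt (by simp)))
  refine h1.congr_of_eventuallyEq ?_
  filter_upwards [e.eventually_eq_localFrame_sum_coeff_smul (I := 𝓘(ℝ, ℂ)) (s := s) b hp] with q hq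
  conv_lhs => rw [hq]
  simp only [map_sum, form_real_smul, Complex.real_smul]

end LineBundles

/-! ### The Chern connection -/

section HolomorphicStructures

variable {N : Type*} [TopologicalSpace N] [ChartedSpace ℂ N] [IsManifold 𝓘(ℂ) ω N]
  {L : N → Type*} [TopologicalSpace (TotalSpace ℂ L)]
  [∀ p, AddCommGroup (L p)] [∀ p, Module ℝ (L p)] [∀ p, Module ℂ (L p)]
  [∀ p, IsScalarTower ℝ ℂ (L p)]
  [∀ p, TopologicalSpace (L p)] [∀ p, IsTopologicalAddGroup (L p)]
  [∀ p, ContinuousSMul ℝ (L p)] [FiberBundle ℂ L] [VectorBundle ℝ ℂ L]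
  [ContMDiffVectorBundle ∞ ℂ L 𝓘(ℝ, ℂ)]

/-- The real and complex structures of the tangent spaces of a Riemann surface are compatible. -/
instance tangentScalarTower (p : N) : IsScalarTower ℝ ℂ (TangentSpace 𝓘(ℝ, ℂ) p) :=
  inferInstanceAs (IsScalarTower ℝ ℂ ℂ)

namespace HolomorphicStructure

variable (d : HolomorphicStructure L)

/-- A holomorphic structure is a local operator. -/
lemma op_congr {s t : Π p, L p} {p : N} (hs : SmoothSectionAt 𝓘(ℝ, ℂ) ℂ s p)
    (h : ∀ᶠ q in 𝓝 p, t q = s q) : d.op t p = d.op s p := by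
  classical
  have ht := hs.congr h
  let ψ (q : N) : ℂ := if t q = s q then 1 else 0
  have hψ1 : ψ =ᶠ[𝓝 p] fun _ => 1 := h.mono fun q hq => by simp [ψ, hq]
  have hψ : ContMDiffAt 𝓘(ℝ, ℂ) 𝓘(ℝ, ℂ) ∞ ψ p := contMDiffAt_const.congr_of_eventuallyEq hψ1
  have hψp : ψ p = 1 := hψ1.self_of_nhds
  have hd : ∀ X, dbarFun ψ p X = 0 := by
    intro X
    simp [dbarFun, mvfderiv_congr_of_eventuallyEq hψ1, mvfderiv_const]
  have h3 : (fun q => ψ q • t q) = fun q => ψ q • s q := by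
    funext q
    by_cases hq : t q = s q <;> simp [ψ, hq]
  ext X
  have h1 := d.leibniz ψ s p X hψ hs
  have h2 := d.leibniz ψ t p X hψ ht
  rw [h3, h1, hψp, hd] at h2
  simpa using h2.symm

/-- The `(0,1)`-form `b` of a holomorphic structure in a unit frame `w`, given by
`∂̄_X w = b(X) w`. -/
def connForm (h : HermitianMetric L) (w : Π p, L p) (p : N) : TangentSpace 𝓘(ℝ, ℂ) p →ₗ[ℝ] ℂ where
  toFun X := h.form p (w p) (d.op w p X)
  map_add' X Y := by simp
  map_smul' c X := by simp

lemma connForm_apply (h : HermitianMetric L) (w : Π p, L p) (p : N) (X : TangentSpace 𝓘(ℝ, ℂ) p) :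
    d.connForm h w p X = h.form p (w p) (d.op w p X) := rfl

lemma connForm_I_smul {h : HermitianMetric L} {w : Π p, L p} {p : N}
    (hw : SmoothSectionAt 𝓘(ℝ, ℂ) ℂ w p) (X : TangentSpace 𝓘(ℝ, ℂ) p) :
    d.connForm h w p (Complex.I • X) = -(Complex.I * d.connForm h w p X) := by
  simp [connForm_apply, d.antilinear w p X hw]

/-- The connection form of the Chern connection in a unit frame: the imaginary form whose
`(0,1)`-part is the `∂̄` of the frame. -/
def chernForm (h : HermitianMetric L) (w : Π p, L p) (p : N) : TangentSpace 𝓘(ℝ, ℂ) p →ₗ[ℝ] ℂ where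
  toFun X := d.connForm h w p X - starRingEnd ℂ (d.connForm h w p X)
  map_add' X Y := by simp; ring
  map_smul' c X := by simp; ring

lemma chernForm_apply (h : HermitianMetric L) (w : Π p, L p) (p : N)
    (X : TangentSpace 𝓘(ℝ, ℂ) p) :
    d.chernForm h w p X = d.connForm h w p X - starRingEnd ℂ (d.connForm h w p X) := rfl

lemma chernForm_dbar {h : HermitianMetric L} {w : Π p, L p} {p : N}
    (hw : SmoothSectionAt 𝓘(ℝ, ℂ) ℂ w p) (X : TangentSpace 𝓘(ℝ, ℂ) p) :
    (d.chernForm h w p X + Complex.I * d.chernForm h w p (Complex.I • X)) / 2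
      = d.connForm h w p X := by
  simp only [chernForm_apply, d.connForm_I_smul hw, map_neg, map_mul, Complex.conj_I]
  ring_nf
  simp only [Complex.I_sq]
  ring

lemma contMDiffAt_connForm {h : HermitianMetric L} {w : Π p, L p}
    {X : Π p : N, TangentSpace 𝓘(ℝ, ℂ) p} {p : N}
    (hw : SmoothSectionAt 𝓘(ℝ, ℂ) ℂ w p) (hX : SmoothSectionAt 𝓘(ℝ, ℂ) ℂ X p) :
    ContMDiffAt 𝓘(ℝ, ℂ) 𝓘(ℝ, ℂ) ∞ (fun q => d.connForm h w q (X q)) p :=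
  h.smooth p w _ hw (d.smooth w X p hw hX)

lemma contMDiffAt_chernForm {h : HermitianMetric L} {w : Π p, L p}
    {X : Π p : N, TangentSpace 𝓘(ℝ, ℂ) p} {p : N}
    (hw : SmoothSectionAt 𝓘(ℝ, ℂ) ℂ w p) (hX : SmoothSectionAt 𝓘(ℝ, ℂ) ℂ X p) :
    ContMDiffAt 𝓘(ℝ, ℂ) 𝓘(ℝ, ℂ) ∞ (fun q => d.chernForm h w q (X q)) p :=
  (d.contMDiffAt_connForm hw hX).sub (d.contMDiffAt_connForm hw hX).conj

/-- The logarithmic derivative `ū du` of a function of modulus one is imaginary. -/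
lemma conj_mul_mvfderiv_of_norm_one {u : N → ℂ} {p : N}
    (hu : ContMDiffAt 𝓘(ℝ, ℂ) 𝓘(ℝ, ℂ) ∞ u p) (h1 : ∀ᶠ q in 𝓝 p, starRingEnd ℂ (u q) * u q = 1)
    (X : TangentSpace 𝓘(ℝ, ℂ) p) :
    starRingEnd ℂ (u p) * mvfderiv 𝓘(ℝ, ℂ) u p X
      + starRingEnd ℂ (mvfderiv 𝓘(ℝ, ℂ) u p X) * u p = 0 := by
  have hd := hu.mdifferentiableAt (by simp)
  rw [← mvfderiv_conj hd, ← mvfderiv_complex_mul (hu.conj.mdifferentiableAt (by simp)) hd,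
    mvfderiv_congr_of_eventuallyEq (ψ := fun _ => (1 : ℂ)) h1, mvfderiv_const]
  rfl

/-- Gauge transformation of the Chern connection form under a change of unit frames. -/
lemma chernForm_smul {h : HermitianMetric L} {w : Π p, L p} {u : N → ℂ} {p : N}
    (hw : IsUnitFrameAt h w p) (hu : ContMDiffAt 𝓘(ℝ, ℂ) 𝓘(ℝ, ℂ) ∞ u p)
    (h1 : ∀ᶠ q in 𝓝 p, starRingEnd ℂ (u q) * u q = 1) (X : TangentSpace 𝓘(ℝ, ℂ) p) :
    d.chernForm h (fun q => u q • w q) p X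
      = d.chernForm h w p X + starRingEnd ℂ (u p) * mvfderiv 𝓘(ℝ, ℂ) u p X := by
  have e1 := h1.self_of_nhds
  have e2 := conj_mul_mvfderiv_of_norm_one hu h1 X
  have e3 := conj_mul_mvfderiv_of_norm_one hu h1 (Complex.I • X)
  have e4 : d.connForm h (fun q => u q • w q) p X
      = d.connForm h w p X + starRingEnd ℂ (u p) * dbarFun u p X := by
    simp only [connForm_apply, d.leibniz u w p X hu hw.smooth, map_smulₛₗ, map_add,
      LinearMap.smul_apply, smul_eq_mul, hw.form_self]
    linear_combination (h.form p (w p) (d.op w p X)) * e1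
  simp only [chernForm_apply, e4, dbarFun, map_add, map_mul, map_div₀, Complex.conj_I,
    Complex.conj_conj, Complex.conj_ofNat]
  linear_combination -(1 / 2) * e2 + Complex.I / 2 * e3

variable (hL : IsComplexLineBundle L) (h : HermitianMetric L)

/-- The Chern connection as an operator on sections, computed at each point in a chosen unit frame
`w`: the component of `D_X s` is `X⟨w, s⟩ + ⟨w, s⟩ θ(X)`, where `θ` is the Chern connection form. -/
def chernFun (s : Π p, L p) (p : N) : TangentSpace 𝓘(ℝ, ℂ) p →L[ℝ] L p :=
  let w := (h.exists_isUnitFrameAt p).choose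
  have : FiniteDimensional ℝ (TangentSpace 𝓘(ℝ, ℂ) p) := inferInstanceAs (FiniteDimensional ℝ ℂ)
  have : T2Space (TangentSpace 𝓘(ℝ, ℂ) p) := inferInstanceAs (T2Space ℂ)
  LinearMap.toContinuousLinearMap
    { toFun := fun X => (mvfderiv 𝓘(ℝ, ℂ) (fun q => h.form q (w q) (s q)) p X
        + h.form p (w p) (s p) * d.chernForm h w p X) • w p
      map_add' := by
        intro X Y
        simp only [map_add, ← add_smul]
        congr 1
        ring
      map_smul' := by
        intro c X
        simp only [map_smul, Complex.real_smul, RingHom.id_apply]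
        rw [← algebraMap_smul ℂ c (_ • _), smul_smul]
        simp only [Complex.coe_algebraMap]
        congr 1
        ring }

include hL in
/-- The Chern connection may be computed in any unit frame. -/
lemma chernFun_eq {w s : Π p, L p} {p : N} (hw : IsUnitFrameAt h w p)
    (hs : MDifferentiableAt 𝓘(ℝ, ℂ) (𝓘(ℝ, ℂ).prod 𝓘(ℝ, ℂ)) (fun y => TotalSpace.mk' ℂ y (s y)) p)
    (X : TangentSpace 𝓘(ℝ, ℂ) p) :
    d.chernFun h s p X = (mvfderiv 𝓘(ℝ, ℂ) (fun q => h.form q (w q) (s q)) p X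
        + h.form p (w p) (s p) * d.chernForm h w p X) • w p := by
  set w' := (h.exists_isUnitFrameAt p).choose with hw'def
  have hw' : IsUnitFrameAt h w' p := (h.exists_isUnitFrameAt p).choose_spec
  have e0 : d.chernFun h s p X = (mvfderiv 𝓘(ℝ, ℂ) (fun q => h.form q (w' q) (s q)) p X
        + h.form p (w' p) (s p) * d.chernForm h w' p X) • w' p := rfl
  rw [e0]
  let u : N → ℂ := fun q => h.form q (w q) (w' q)
  have hu : ContMDiffAt 𝓘(ℝ, ℂ) 𝓘(ℝ, ℂ) ∞ u p := h.smooth p _ _ hw.smooth hw'.smooth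
  have hww : ∀ᶠ q in 𝓝 p, w' q = u q • w q :=
    hw.eventually.mono fun q hq => hq.eq_smul hL (w' q)
  have hu1 : ∀ᶠ q in 𝓝 p, starRingEnd ℂ (u q) * u q = 1 := by
    filter_upwards [hw.eventually, hw'.eventually, hww] with q h1 h2 h3
    have := h2.form_self
    rw [mul_comm]
    simpa [h3, h1.form_self] using this
  have hform : d.chernForm h w' p X
      = d.chernForm h w p X + starRingEnd ℂ (u p) * mvfderiv 𝓘(ℝ, ℂ) u p X := by
    rw [← d.chernForm_smul hw hu hu1]
    simp only [chernForm_apply, connForm_apply]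
    rw [d.op_congr (hL.smul_smooth p u w hu hw.smooth) hww, hww.self_of_nhds]
  have hsm : ∀ᶠ q in 𝓝 p, h.form q (w' q) (s q) = starRingEnd ℂ (u q) * h.form q (w q) (s q) := by
    filter_upwards [hww] with q hq
    rw [hq, map_smulₛₗ]
    simp
  have hdm := h.mdifferentiableAt_form hw.smooth hs
  rw [hform, mvfderiv_congr_of_eventuallyEq hsm,
    mvfderiv_complex_mul (hu.conj.mdifferentiableAt (by simp)) hdm,
    mvfderiv_conj (hu.mdifferentiableAt (by simp)), hsm.self_of_nhds, hww.self_of_nhds, smul_smul]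
  congr 1
  have e1 := hu1.self_of_nhds
  have e2 := conj_mul_mvfderiv_of_norm_one hu hu1 X
  linear_combination (mvfderiv 𝓘(ℝ, ℂ) (fun q => h.form q (w q) (s q)) p X
      + h.form p (w p) (s p) * d.chernForm h w p X
      + h.form p (w p) (s p) * starRingEnd ℂ (u p) * mvfderiv 𝓘(ℝ, ℂ) u p X) * e1
    + h.form p (w p) (s p) * e2

/-- The Chern connection of a holomorphic Hermitian line bundle. -/
def chernConnection : CovariantDerivative 𝓘(ℝ, ℂ) ℂ L where
  toFun := d.chernFun h
  isCovariantDerivativeOnUniv :=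
    { add := by
        intro s t p hs ht _
        obtain ⟨w, hw⟩ := h.exists_isUnitFrameAt p
        ext X
        rw [add_apply, d.chernFun_eq hL h hw (mdifferentiableAt_add_section hs ht),
          d.chernFun_eq hL h hw hs, d.chernFun_eq hL h hw ht, ← add_smul]
        have h1 : (fun q => h.form q (w q) ((s + t) q))
            = fun q => h.form q (w q) (s q) + h.form q (w q) (t q) := by
          funext q; simp
        rw [h1, mvfderiv_fun_add (h.mdifferentiableAt_form hw.smooth hs)
          (h.mdifferentiableAt_form hw.smooth ht)]
        simp only [Pi.add_apply, map_add, add_apply]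
        congr 1
        ring
      leibniz := by
        intro s f p hs hf _
        obtain ⟨w, hw⟩ := h.exists_isUnitFrameAt p
        ext X
        rw [add_apply, d.chernFun_eq hL h hw (hf.smul_section hs), smul_apply,
          d.chernFun_eq hL h hw hs, ContinuousLinearMap.smulRight_apply]
        have h1 : (fun q => h.form q (w q) ((f • s) q))
            = fun q => f q • h.form q (w q) (s q) := by
          funext q; simp
        have h2 := hw.eq_smul hL (s p)
        rw [h1, mvfderiv_fun_smul hf (h.mdifferentiableAt_form hw.smooth hs)]
        simp only [Pi.smul_apply', add_apply, smul_apply, ContinuousLinearMap.smulRight_apply,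
          HermitianMetric.form_real_smul]
        conv_rhs => rw [h2]
        simp only [← algebraMap_smul ℂ (_ : ℝ) (_ : L p), smul_smul, ← add_smul,
          Complex.coe_algebraMap, Complex.real_smul]
        congr 1
        simp [hw.form_self]
        ring }

include hL in
theorem isChernConnection_chernConnection :
    IsChernConnection (fun s p X => d.op s p X) h (d.chernConnection hL h) where
  smooth := by
    intro p s X hs hX
    obtain ⟨w, hw⟩ := h.exists_isUnitFrameAt p
    have h1 := h.smooth p w s hw.smooth hs
    refine SmoothSectionAt.congr (hL.smul_smooth p _ w ((h1.mvfderiv_apply hX).add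
      (h1.complex_mul (d.contMDiffAt_chernForm (h := h) hw.smooth hX))) hw.smooth) ?_
    filter_upwards [hw.eventually, hs.eventually_mdifferentiableAt] with q h2 h3
    exact d.chernFun_eq hL h h2 h3 (X q)
  complex := by
    intro s p X hs
    obtain ⟨w, hw⟩ := h.exists_isUnitFrameAt p
    have h1 := (h.smooth p w s hw.smooth hs).mdifferentiableAt (n := ∞) (by simp)
    change d.chernFun h _ p X = _ • d.chernFun h s p X
    rw [d.chernFun_eq hL h hw (hL.smul_smooth p (fun _ => Complex.I) s contMDiffAt_const
      hs).mdifferentiableAt, d.chernFun_eq hL h hw hs.mdifferentiableAt, smul_smul]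
    simp only [map_smul, smul_eq_mul]
    rw [mvfderiv_const_mul _ h1]
    congr 1
    ring
  hermitian := by
    intro s t p X hs ht
    obtain ⟨w, hw⟩ := h.exists_isUnitFrameAt p
    have h1 := (h.smooth p w s hw.smooth hs)
    have h2 := (h.smooth p w t hw.smooth ht)
    change _ = h.form p (d.chernFun h s p X) (t p) + h.form p (s p) (d.chernFun h t p X)
    rw [d.chernFun_eq hL h hw hs.mdifferentiableAt, d.chernFun_eq hL h hw ht.mdifferentiableAt]
    have h3 : ∀ᶠ q in 𝓝 p, h.form q (s q) (t q)
        = starRingEnd ℂ (h.form q (w q) (s q)) * h.form q (w q) (t q) := by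
      filter_upwards [hw.eventually] with q hq
      conv_lhs => rw [hq.eq_smul hL (s q), map_smulₛₗ]
      simp
    rw [mvfderiv_congr_of_eventuallyEq h3,
      mvfderiv_complex_mul (h1.conj.mdifferentiableAt (by simp)) (h2.mdifferentiableAt (by simp)),
      mvfderiv_conj (h1.mdifferentiableAt (by simp)), map_smulₛₗ, map_smul, LinearMap.smul_apply,
      h.symm p (s p) (w p)]
    simp only [chernForm_apply, smul_eq_mul, map_add, map_sub, map_mul, Complex.conj_conj]
    ring
  dbar_eq := by
    intro s p X hs
    obtain ⟨w, hw⟩ := h.exists_isUnitFrameAt p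
    have h1 := (h.smooth p w s hw.smooth hs)
    change (1 / 2 : ℂ) • (d.chernFun h s p X + Complex.I • d.chernFun h s p (Complex.I • X)) = _
    rw [d.chernFun_eq hL h hw hs.mdifferentiableAt, d.chernFun_eq hL h hw hs.mdifferentiableAt,
      smul_smul, ← add_smul, smul_smul]
    have h2 : ∀ᶠ q in 𝓝 p, s q = h.form q (w q) (s q) • w q :=
      hw.eventually.mono fun q hq => hq.eq_smul hL (s q)
    rw [d.op_congr (hL.smul_smooth p _ w h1 hw.smooth) h2, d.leibniz _ w p X h1 hw.smooth,
      hw.eq_smul hL (d.op w p X), smul_smul, ← add_smul, ← connForm_apply,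
      ← d.chernForm_dbar hw.smooth X]
    congr 1
    simp only [dbarFun]
    ring

end HolomorphicStructure

end HolomorphicStructures

/-! ### The curvature of the Chern connection -/

section ChernCurvature

open CovariantDerivative

variable {N : Type*} [TopologicalSpace N] [ChartedSpace ℂ N] [IsManifold 𝓘(ℂ) ω N]
  {L : N → Type*} [TopologicalSpace (TotalSpace ℂ L)]
  [∀ p, AddCommGroup (L p)] [∀ p, Module ℝ (L p)] [∀ p, Module ℂ (L p)]
  [∀ p, IsScalarTower ℝ ℂ (L p)]
  [∀ p, TopologicalSpace (L p)] [∀ p, IsTopologicalAddGroup (L p)]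
  [∀ p, ContinuousSMul ℝ (L p)] [FiberBundle ℂ L] [VectorBundle ℝ ℂ L]
  [ContMDiffVectorBundle ∞ ℂ L 𝓘(ℝ, ℂ)]

variable {d : HolomorphicStructure L} {h : HermitianMetric L} {D : CovariantDerivative 𝓘(ℝ, ℂ) ℂ L}

lemma complex_smul_eq_re_add_im (p : N) (c : ℂ) (v : L p) :
    c • v = c.re • v + c.im • (Complex.I • v) := by
  rw [← algebraMap_smul ℂ c.re v, ← algebraMap_smul ℂ c.im (Complex.I • v), smul_smul, ← add_smul]
  congr 1
  simp only [Complex.coe_algebraMap]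
  exact (Complex.re_add_im c).symm

namespace IsChernConnection

variable (hD : IsChernConnection (fun s p X => d.op s p X) h D)

include hD

/-- The connection form of a Chern connection in a unit frame is the imaginary form determined by
the holomorphic structure; in particular the Chern connection is unique. -/
lemma apply_unitFrame (hL : IsComplexLineBundle L) {w : Π p, L p} {p : N} (hw : IsUnitFrameAt h w p)
    (X : TangentSpace 𝓘(ℝ, ℂ) p) : D w p X = d.chernForm h w p X • w p := by
  have skew (X : TangentSpace 𝓘(ℝ, ℂ) p) :
      starRingEnd ℂ (h.form p (w p) (D w p X)) = -h.form p (w p) (D w p X) := by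
    have h1 := hD.hermitian w w p X hw.smooth hw.smooth
    have h2 : (fun q => h.form q (w q) (w q)) =ᶠ[𝓝 p] fun _ => (1 : ℂ) :=
      hw.mono fun q hq => hq.2
    rw [mvfderiv_congr_of_eventuallyEq h2, mvfderiv_const, zero_apply,
      h.symm p (w p) (D w p X)] at h1
    linear_combination -h1
  have h1 := congrArg (h.form p (w p)) (hD.dbar_eq w p X hw.smooth)
  simp only [map_smul, map_add, smul_eq_mul] at h1
  have h2 := congrArg (starRingEnd ℂ) h1
  simp only [map_mul, map_add, skew, Complex.conj_I, map_div₀, map_one, Complex.conj_ofNat] at h2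
  -- the connection form is imaginary and has `(0,1)`-part `connForm`
  rw [hw.eq_smul hL (D w p X)]
  congr 1
  rw [d.chernForm_apply, d.connForm_apply]
  linear_combination h1 - h2

/-- The Leibniz rule of a complex connection for complex functions. -/
lemma complex_smul_apply {f : N → ℂ} {s : Π p, L p} {p : N} (hL : IsComplexLineBundle L)
    (hf : ContMDiffAt 𝓘(ℝ, ℂ) 𝓘(ℝ, ℂ) ∞ f p) (hs : SmoothSectionAt 𝓘(ℝ, ℂ) ℂ s p)
    (X : TangentSpace 𝓘(ℝ, ℂ) p) :
    D (fun q => f q • s q) p X = f p • D s p X + mvfderiv 𝓘(ℝ, ℂ) f p X • s p := by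
  have hIs : SmoothSectionAt 𝓘(ℝ, ℂ) ℂ (fun q => Complex.I • s q) p :=
    hL.smul_smooth p _ s contMDiffAt_const hs
  have h1 : (fun q => f q • s q) = fun q => (f q).re • s q + (f q).im • (Complex.I • s q) :=
    funext fun q => complex_smul_eq_re_add_im q (f q) (s q)
  rw [h1, D.fun_add_apply (SmoothSectionAt.smul hf.re hs).mdifferentiableAt
      (SmoothSectionAt.smul hf.im hIs).mdifferentiableAt,
    D.fun_smul_apply (hf.re.mdifferentiableAt (by simp)) hs.mdifferentiableAt,
    D.fun_smul_apply (hf.im.mdifferentiableAt (by simp)) hIs.mdifferentiableAt,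
    hD.complex s p X hs, mvfderiv_re (hf.mdifferentiableAt (by simp)),
    mvfderiv_im (hf.mdifferentiableAt (by simp)), complex_smul_eq_re_add_im p (f p),
    complex_smul_eq_re_add_im p (mvfderiv 𝓘(ℝ, ℂ) f p X)]
  abel

lemma curvatureAt_I_smul (hL : IsComplexLineBundle L) {p : N} (u v : TangentSpace 𝓘(ℝ, ℂ) p) (w : L p) :
    curvatureAt D p u v (Complex.I • w) = Complex.I • curvatureAt D p u v w := by
  have hu := smoothSectionAt_extend (I := 𝓘(ℝ, ℂ)) (F := ℂ) u
  have hv := smoothSectionAt_extend (I := 𝓘(ℝ, ℂ)) (F := ℂ) v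
  have hw := smoothSectionAt_extend (I := 𝓘(ℝ, ℂ)) (F := ℂ) w
  have hwe := eventually_smoothSectionAt_extend (I := 𝓘(ℝ, ℂ)) (F := ℂ) w
  have hIw : SmoothSectionAt 𝓘(ℝ, ℂ) ℂ (fun q => Complex.I • FiberBundle.extend ℂ w q) p :=
    hL.smul_smooth p _ _ contMDiffAt_const hw
  have h1 := curvatureAt_eq_curvatureOp hD.smooth hu hv hw
  have h2 := curvatureAt_eq_curvatureOp hD.smooth hu hv hIw
  have key {Y : Π p : N, TangentSpace 𝓘(ℝ, ℂ) p} (hY : SmoothSectionAt 𝓘(ℝ, ℂ) ℂ Y p)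
      (x : TangentSpace 𝓘(ℝ, ℂ) p) :
      D (fun q => D (fun q => Complex.I • FiberBundle.extend ℂ w q) q (Y q)) p x
        = Complex.I • D (fun q => D (FiberBundle.extend ℂ w) q (Y q)) p x := by
    have hs := hD.smooth p _ Y hw hY
    rw [← hD.complex _ p x hs]
    refine D.congr_apply (hL.smul_smooth p (fun _ => Complex.I) _ contMDiffAt_const
      hs).mdifferentiableAt ?_ x
    filter_upwards [hwe] with q hq
    exact hD.complex _ q (Y q) hq
  simp only [CovariantDerivative.curvatureOp, FiberBundle.extend_apply_self] at h1 h2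
  rw [h1, h2, key hv, key hu, hD.complex _ p _ hw, smul_sub, smul_sub]

end IsChernConnection

/-- The normalized scalar curvature of the Chern connection, expressed in a unit frame `w` of the
line bundle and a unit frame `X` of the tangent bundle: with `b` the component of `∂̄_X w` and
`[X, iX] = p X + q iX`, it is `2 X(Re b) + 2 (iX)(Im b) + 2 p Im b - 2 q Re b`. -/
def HolomorphicStructure.frameCurvature (d : HolomorphicStructure L) (h : HermitianMetric L)
    (hN : HermitianMetric (fun p : N => TangentSpace 𝓘(ℝ, ℂ) p))
    (w : Π p, L p) (X : Π p : N, TangentSpace 𝓘(ℝ, ℂ) p) (p : N) : ℝ :=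
  let b := fun q => d.connForm h w q (X q)
  let c := hN.form p (X p) (mlieBracket 𝓘(ℝ, ℂ) X (fun q => Complex.I • X q) p)
  2 * (mvfderiv 𝓘(ℝ, ℂ) b p (X p)).re + 2 * (mvfderiv 𝓘(ℝ, ℂ) b p (Complex.I • X p)).im
    + 2 * c.re * (b p).im - 2 * c.im * (b p).re

variable {hN : HermitianMetric (fun p : N => TangentSpace 𝓘(ℝ, ℂ) p)}

lemma IsChernConnection.curvatureAt_unitFrame
    (hD : IsChernConnection (fun s p X => d.op s p X) h D) (hL : IsComplexLineBundle L)
    (hT : IsComplexLineBundle (fun p : N => TangentSpace 𝓘(ℝ, ℂ) p))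
    {w : Π p, L p} {X : Π p : N, TangentSpace 𝓘(ℝ, ℂ) p} {p : N} (hw : IsUnitFrameAt h w p)
    (hX : IsUnitFrameAt hN X p) :
    curvatureAt D p (X p) (Complex.I • X p) (w p)
      = (-(d.frameCurvature h hN w X p : ℝ) * Complex.I : ℂ) • w p := by
  have hXs := hX.smooth
  have hY : SmoothSectionAt 𝓘(ℝ, ℂ) ℂ (fun q => Complex.I • X q) p :=
    hT.smul_smooth p _ _ contMDiffAt_const hXs
  have hb := d.contMDiffAt_connForm (h := h) hw.smooth hXs
  have hbd := hb.mdifferentiableAt (n := ∞) (by simp)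
  have key {Y : Π p : N, TangentSpace 𝓘(ℝ, ℂ) p} (hY : SmoothSectionAt 𝓘(ℝ, ℂ) ℂ Y p)
      (z : TangentSpace 𝓘(ℝ, ℂ) p) :
      D (fun q => D w q (Y q)) p z = (d.chernForm h w p (Y p) * d.chernForm h w p z
        + mvfderiv 𝓘(ℝ, ℂ) (fun q => d.chernForm h w q (Y q)) p z) • w p := by
    have hθ := d.contMDiffAt_chernForm (h := h) hw.smooth hY
    have h1 : ∀ᶠ q in 𝓝 p, D w q (Y q) = d.chernForm h w q (Y q) • w q :=
      hw.eventually.mono fun q hq => hD.apply_unitFrame hL hq (Y q)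
    rw [D.congr_apply (hL.smul_smooth p _ w hθ hw.smooth).mdifferentiableAt h1,
      hD.complex_smul_apply hL hθ hw.smooth, hD.apply_unitFrame hL hw, smul_smul, ← add_smul]
  have hbs : MDifferentiableAt 𝓘(ℝ, ℂ) 𝓘(ℝ, ℂ) (fun q => d.connForm h w q (X q)
      + starRingEnd ℂ (d.connForm h w q (X q))) p := hbd.add (hb.conj.mdifferentiableAt (by simp))
  have hθX : (fun q => d.chernForm h w q (X q))
      = fun q => d.connForm h w q (X q) - starRingEnd ℂ (d.connForm h w q (X q)) := rfl
  have hθY : (fun q => d.chernForm h w q (Complex.I • X q)) =ᶠ[𝓝 p]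
      fun q => -Complex.I * (d.connForm h w q (X q) + starRingEnd ℂ (d.connForm h w q (X q))) := by
    filter_upwards [hw.eventually] with q hq
    simp only [d.chernForm_apply, d.connForm_I_smul hq.smooth, map_neg, map_mul, Complex.conj_I]
    ring
  have hθYp : d.chernForm h w p (Complex.I • X p)
      = -Complex.I * (d.connForm h w p (X p) + starRingEnd ℂ (d.connForm h w p (X p))) :=
    hθY.self_of_nhds
  rw [curvatureAt_eq_curvatureOp hD.smooth hXs hY hw.smooth, CovariantDerivative.curvatureOp,
    key hY, key hXs, hD.apply_unitFrame hL hw, ← sub_smul, ← sub_smul,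
    mvfderiv_congr_of_eventuallyEq hθY, hθX,
    mvfderiv_const_mul _ hbs,
    mvfderiv_fun_add hbd (hb.conj.mdifferentiableAt (by simp)),
    mvfderiv_fun_sub hbd (hb.conj.mdifferentiableAt (by simp)),
    hX.eq_smul hT (mlieBracket 𝓘(ℝ, ℂ) X (fun q => Complex.I • X q) p)]
  congr 1
  simp only [HolomorphicStructure.frameCurvature]
  generalize hN.form p (X p) (mlieBracket 𝓘(ℝ, ℂ) X (fun q => Complex.I • X q) p) = c
  rw [complex_smul_eq_re_add_im p c, map_add,
    LinearMap.map_smul (d.chernForm h w p) c.re, LinearMap.map_smul (d.chernForm h w p) c.im,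
    hθYp, d.chernForm_apply _ _ _ (X p)]
  simp only [add_apply, sub_apply, mvfderiv_conj hbd]
  generalize mvfderiv 𝓘(ℝ, ℂ) (fun q => d.connForm h w q (X q)) p (X p) = b1
  generalize mvfderiv 𝓘(ℝ, ℂ) (fun q => d.connForm h w q (X q)) p (Complex.I • X p) = b2
  generalize d.connForm h w p (X p) = b
  apply Complex.ext <;> simp <;> ring

/-- Any normalized scalar curvature of the Chern connection is given by the frame formula. -/
lemma IsNormalizedScalarCurvature.eq_frameCurvature {κ : N → ℝ}
    (hκ : IsNormalizedScalarCurvature hN (fun s p X => d.op s p X) h κ)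
    (hL : IsComplexLineBundle L) (hT : IsComplexLineBundle (fun p : N => TangentSpace 𝓘(ℝ, ℂ) p))
    {w : Π p, L p} {X : Π p : N, TangentSpace 𝓘(ℝ, ℂ) p} {p : N} (hw : IsUnitFrameAt h w p)
    (hX : IsUnitFrameAt hN X p) : κ p = d.frameCurvature h hN w X p := by
  obtain ⟨D, hD, hc⟩ := hκ
  have h1 := hc p (X p) (w p)
  rw [hD.curvatureAt_unitFrame hL hT hw hX, hX.form_self] at h1
  have h2 := congrArg (fun v => (h.form p (w p) v).im) h1
  simpa [hw.form_self] using h2.symm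

/-- The Chern connection has a normalized scalar curvature: its curvature form at a point is determined
by the value in unit frames, as `R(X, iX)` is quadratic in `X` and complex linear on the fibre. -/
lemma exists_isNormalizedScalarCurvature (d : HolomorphicStructure L) (h : HermitianMetric L)
    (hN : HermitianMetric (fun p : N => TangentSpace 𝓘(ℝ, ℂ) p))
    (hL : IsComplexLineBundle L) (hT : IsComplexLineBundle (fun p : N => TangentSpace 𝓘(ℝ, ℂ) p)) :
    ∃ κ, IsNormalizedScalarCurvature hN (fun s p X => d.op s p X) h κ := by
  have hD := d.isChernConnection_chernConnection hL h
  choose w hw using h.exists_isUnitFrameAt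
  choose X hX using hN.exists_isUnitFrameAt
  refine ⟨fun p => d.frameCurvature h hN (w p) (X p) p, _, hD, fun p Z v => ?_⟩
  obtain ⟨c, rfl⟩ := hT.rank_one p (X p p) Z (hX p).ne_zero
  obtain ⟨a, rfl⟩ := hL.rank_one p (w p p) v (hw p).ne_zero
  have h1 := hD.curvatureAt_unitFrame hL hT (hw p) (hX p)
  have hII : Complex.I • (Complex.I • X p p) = -(X p p) := by
    rw [smul_smul, Complex.I_mul_I, neg_one_smul]
  have h2 : curvatureAt (d.chernConnection hL h) p (c • X p p) (Complex.I • (c • X p p)) (w p p)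
      = (c.re ^ 2 + c.im ^ 2) • curvatureAt (d.chernConnection hL h) p (X p p)
          (Complex.I • X p p) (w p p) := by
    have e1 : Complex.I • (c • X p p) = c.re • (Complex.I • X p p) + (-c.im) • X p p := by
      rw [smul_comm, complex_smul_eq_re_add_im p c (Complex.I • X p p), hII, smul_neg, neg_smul]
    have e2 : ∀ u : TangentSpace 𝓘(ℝ, ℂ) p,
        curvatureAt (d.chernConnection hL h) p u u (w p p) = 0 := by
      intro u
      have h2 : (2 : ℝ) • curvatureAt (d.chernConnection hL h) p u u (w p p) = 0 := by
        rw [two_smul]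
        nth_rewrite 1 [curvatureAt_swap hD.smooth]
        simp
      exact (smul_eq_zero.1 h2).resolve_left two_ne_zero
    have e3 := curvatureAt_swap hD.smooth (Complex.I • X p p) (X p p) (w p p)
    rw [e1, complex_smul_eq_re_add_im p c (X p p), curvatureAt_swap hD.smooth]
    simp only [curvatureAt_add_left hD.smooth, curvatureAt_smul_left hD.smooth]
    rw [curvatureAt_swap hD.smooth (X p p), curvatureAt_swap hD.smooth (Complex.I • X p p)]
    simp only [curvatureAt_add_left hD.smooth, curvatureAt_smul_left hD.smooth, e2, e3]
    module
  rw [complex_smul_eq_re_add_im p a, curvatureAt_add_right hD.smooth,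
    curvatureAt_smul_right hD.smooth, curvatureAt_smul_right hD.smooth,
    hD.curvatureAt_I_smul hL, ← complex_smul_eq_re_add_im p a, ← complex_smul_eq_re_add_im p a, h2, h1]
  have h3 : (hN.form p (c • X p p) (c • X p p)).re = c.re ^ 2 + c.im ^ 2 := by
    simp [(hX p).form_self]
    ring
  rw [h3, ← algebraMap_smul ℂ (c.re ^ 2 + c.im ^ 2), smul_smul, smul_smul, smul_smul]
  congr 1
  simp only [Complex.coe_algebraMap]
  push_cast
  ring

end ChernCurvature

/-! ### The tangent bundle of a Riemann surface as a holomorphic line bundle -/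

section TangentLineBundle

variable {N : Type*} [TopologicalSpace N] [ChartedSpace ℂ N]

lemma I_smul_I_smul {p : N} (X : TangentSpace 𝓘(ℝ, ℂ) p) :
    Complex.I • (Complex.I • X) = -X := by
  rw [smul_smul, Complex.I_mul_I, neg_one_smul]

lemma dbarFun_I_smul (f : N → ℂ) (p : N) (X : TangentSpace 𝓘(ℝ, ℂ) p) :
    dbarFun f p (Complex.I • X) = -(Complex.I * dbarFun f p X) := by
  simp only [dbarFun, I_smul_I_smul, map_neg]
  linear_combination (mvfderiv 𝓘(ℝ, ℂ) f p (Complex.I • X)) / 2 * Complex.I_mul_I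

lemma dbarFun_add {f g : N → ℂ} {p : N} (hf : MDifferentiableAt 𝓘(ℝ, ℂ) 𝓘(ℝ, ℂ) f p)
    (hg : MDifferentiableAt 𝓘(ℝ, ℂ) 𝓘(ℝ, ℂ) g p) (X : TangentSpace 𝓘(ℝ, ℂ) p) :
    dbarFun (fun q => f q + g q) p X = dbarFun f p X + dbarFun g p X := by
  simp only [dbarFun, mvfderiv_fun_add hf hg, add_apply]
  ring

lemma dbarFun_vector_add (f : N → ℂ) (p : N) (X Y : TangentSpace 𝓘(ℝ, ℂ) p) :
    dbarFun f p (X + Y) = dbarFun f p X + dbarFun f p Y := by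
  simp only [dbarFun, map_add, smul_add]
  ring

lemma dbarFun_vector_smul (f : N → ℂ) (p : N) (c : ℝ) (X : TangentSpace 𝓘(ℝ, ℂ) p) :
    dbarFun f p (c • X) = c • dbarFun f p X := by
  simp only [dbarFun, smul_comm Complex.I c X, map_smul, Complex.real_smul]
  ring

variable [IsManifold 𝓘(ℂ) ω N]

lemma dbarFun_congr {f g : N → ℂ} {p : N} (h : f =ᶠ[𝓝 p] g) (X : TangentSpace 𝓘(ℝ, ℂ) p) :
    dbarFun f p X = dbarFun g p X := by
  rw [dbarFun, dbarFun, mvfderiv_congr_of_eventuallyEq h]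

lemma dbarFun_mul {f g : N → ℂ} {p : N} (hf : MDifferentiableAt 𝓘(ℝ, ℂ) 𝓘(ℝ, ℂ) f p)
    (hg : MDifferentiableAt 𝓘(ℝ, ℂ) 𝓘(ℝ, ℂ) g p) (X : TangentSpace 𝓘(ℝ, ℂ) p) :
    dbarFun (fun q => f q * g q) p X = f p * dbarFun g p X + dbarFun f p X * g p := by
  simp only [dbarFun, mvfderiv_complex_mul hf hg]
  ring

/-- The derivative at `q` of the holomorphic chart at `p`, the fibre coordinate of the tangent
bundle given by this chart. -/
def dChart (p q : N) : TangentSpace 𝓘(ℝ, ℂ) q →L[ℝ] ℂ :=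
  mvfderiv 𝓘(ℝ, ℂ) (extChartAt 𝓘(ℝ, ℂ) p) q

lemma contMDiffAt_chart {p q : N} (hq : q ∈ (chartAt ℂ p).source) :
    ContMDiffAt 𝓘(ℝ, ℂ) 𝓘(ℝ, ℂ) ∞ (extChartAt 𝓘(ℝ, ℂ) p) q :=
  contMDiffAt_extChartAt' hq

lemma eventually_mem_chart {p q : N} (hq : q ∈ (chartAt ℂ p).source) :
    ∀ᶠ q' in 𝓝 q, q' ∈ (chartAt ℂ p).source :=
  (chartAt ℂ p).open_source.mem_nhds hq

/-- The derivatives of the charts are complex linear, since transition maps are holomorphic. -/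
lemma dChart_I_smul {p q : N} (hq : q ∈ (chartAt ℂ p).source) (X : TangentSpace 𝓘(ℝ, ℂ) q) :
    dChart p q (Complex.I • X) = Complex.I * dChart p q X := by
  have hd := (contMDiffAt_chart hq).mdifferentiableAt (by simp)
  have h := (contDiffGroupoid ω 𝓘(ℂ)).compatible (H := ℂ) (chart_mem_atlas ℂ q) (chart_mem_atlas ℂ p)
  rw [contDiffGroupoid, mem_groupoid_of_pregroupoid] at h
  have h2 : ContDiffOn ℂ ω ((chartAt ℂ q).symm ≫ₕ chartAt ℂ p)
      ((chartAt ℂ q).symm ≫ₕ chartAt ℂ p).source := by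
    simpa [contDiffPregroupoid] using h.1
  have hmem : chartAt ℂ q q ∈ ((chartAt ℂ q).symm ≫ₕ chartAt ℂ p).source := by
    simp [hq]
  have h3 : DifferentiableAt ℂ ((chartAt ℂ q).symm ≫ₕ chartAt ℂ p) (chartAt ℂ q q) :=
    ((h2.differentiableOn (by simp)) _ hmem).differentiableAt
      (((chartAt ℂ q).symm ≫ₕ chartAt ℂ p).open_source.mem_nhds hmem)
  have h4 : dChart p q = (fderiv ℂ ((chartAt ℂ q).symm ≫ₕ chartAt ℂ p)
      (chartAt ℂ q q)).restrictScalars ℝ := by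
    rw [← h3.fderiv_restrictScalars ℝ]
    change mfderiv 𝓘(ℝ, ℂ) 𝓘(ℝ, ℂ) (extChartAt 𝓘(ℝ, ℂ) p) q = _
    refine hd.mfderiv.trans ?_
    simp [writtenInExtChartAt, fderivWithin_univ, Function.comp_def, chartAt_self_eq]
    rfl
  rw [h4]
  exact (fderiv ℂ ((chartAt ℂ q).symm ≫ₕ chartAt ℂ p) (chartAt ℂ q q)).map_smul Complex.I X

lemma dChart_smul {p q : N} (hq : q ∈ (chartAt ℂ p).source) (c : ℂ) (X : TangentSpace 𝓘(ℝ, ℂ) q) :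
    dChart p q (c • X) = c * dChart p q X := by
  rw [complex_smul_eq_re_add_im q c X, map_add, (dChart p q).map_smul c.re,
    (dChart p q).map_smul c.im, dChart_I_smul hq, Complex.real_smul, Complex.real_smul]
  linear_combination dChart p q X * Complex.re_add_im c

lemma dChart_injective {p q : N} (hq : q ∈ (chartAt ℂ p).source) :
    Function.Injective (dChart p q) := by
  have h := isInvertible_mfderiv_extChartAt (I := 𝓘(ℝ, ℂ)) (x := p) (y := q) (by simpa using hq)
  exact h.injective

lemma dChart_self (p : N) (X : TangentSpace 𝓘(ℝ, ℂ) p) : dChart p p X = X := by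
  have h := mfderiv_extChartAt_self (I := 𝓘(ℝ, ℂ)) (x := p)
  exact congrArg (fun A : TangentSpace 𝓘(ℝ, ℂ) p →L[ℝ] ℂ => A X) h

lemma trivializationAt_eq_dChart {p q : N} (hq : q ∈ (chartAt ℂ p).source)
    (X : TangentSpace 𝓘(ℝ, ℂ) q) :
    (trivializationAt ℂ (TangentSpace 𝓘(ℝ, ℂ)) p ⟨q, X⟩).2 = dChart p q X := by
  have h := TangentBundle.continuousLinearMapAt_trivializationAt (I := 𝓘(ℝ, ℂ)) hq
  have h2 := congrArg (fun A : TangentSpace 𝓘(ℝ, ℂ) q →L[ℝ] ℂ => A X) h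
  refine Eq.trans ?_ h2
  symm
  exact Trivialization.continuousLinearMapAt_apply_of_mem
    (e := trivializationAt ℂ (TangentSpace 𝓘(ℝ, ℂ)) p) (R := ℝ)
    (by rw [TangentBundle.trivializationAt_baseSet]; exact hq) X

/-- A vector field is smooth if and only if its coordinate in a chart is smooth. -/
lemma smoothSectionAt_iff_dChart {X : Π p : N, TangentSpace 𝓘(ℝ, ℂ) p} {p : N} :
    SmoothSectionAt 𝓘(ℝ, ℂ) ℂ X p
      ↔ ContMDiffAt 𝓘(ℝ, ℂ) 𝓘(ℝ, ℂ) ∞ (fun q => dChart p q (X q)) p := by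
  refine ⟨fun h => (contMDiffAt_chart (mem_chart_source ℂ p)).mvfderiv_apply h, fun h => ?_⟩
  refine (contMDiffAt_section p).2 (h.congr_of_eventuallyEq ?_)
  filter_upwards [eventually_mem_chart (mem_chart_source ℂ p)] with q hq
  exact trivializationAt_eq_dChart hq (X q)

theorem isComplexLineBundle_tangent :
    IsComplexLineBundle (fun p : N => TangentSpace 𝓘(ℝ, ℂ) p) where
  smul_smooth p f X hf hX := by
    refine smoothSectionAt_iff_dChart.2
      ((hf.complex_mul (smoothSectionAt_iff_dChart.1 hX)).congr_of_eventuallyEq ?_)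
    filter_upwards [eventually_mem_chart (mem_chart_source ℂ p)] with q hq
    exact dChart_smul hq (f q) (X q)
  rank_one p v w hv :=
    ⟨(show ℂ from w) / (show ℂ from v), (div_mul_cancel₀ (show ℂ from w) hv).symm⟩

lemma SmoothSectionAt.I_smul {X : Π p : N, TangentSpace 𝓘(ℝ, ℂ) p} {p : N}
    (hX : SmoothSectionAt 𝓘(ℝ, ℂ) ℂ X p) :
    SmoothSectionAt 𝓘(ℝ, ℂ) ℂ (fun q => Complex.I • X q) p :=
  isComplexLineBundle_tangent.smul_smooth p _ X contMDiffAt_const hX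

/-- In a chart, `([X, Z] + i [iX, Z]) / 2` is the `∂̄` of the coordinate of `Z`. -/
lemma dChart_bracket {p q : N} (hq : q ∈ (chartAt ℂ p).source)
    {X Z : Π p : N, TangentSpace 𝓘(ℝ, ℂ) p} (hX : SmoothSectionAt 𝓘(ℝ, ℂ) ℂ X q)
    (hZ : SmoothSectionAt 𝓘(ℝ, ℂ) ℂ Z q) :
    dChart p q ((1 / 2 : ℂ) • (mlieBracket 𝓘(ℝ, ℂ) X Z q
      + Complex.I • mlieBracket 𝓘(ℝ, ℂ) (fun q => Complex.I • X q) Z q))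
      = dbarFun (fun q' => dChart p q' (Z q')) q (X q) := by
  have hc := contMDiffAt_chart hq
  have h1 := mvfderiv_mlieBracket_complex hX hZ hc
  have h2 := mvfderiv_mlieBracket_complex hX.I_smul hZ hc
  have h3 : (fun y => mvfderiv 𝓘(ℝ, ℂ) (extChartAt 𝓘(ℝ, ℂ) p) y (Complex.I • X y)) =ᶠ[𝓝 q]
      fun y => Complex.I * mvfderiv 𝓘(ℝ, ℂ) (extChartAt 𝓘(ℝ, ℂ) p) y (X y) := by
    filter_upwards [eventually_mem_chart hq] with y hy
    exact dChart_I_smul hy (X y)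
  rw [mvfderiv_congr_of_eventuallyEq h3,
    mvfderiv_const_mul _ ((hc.mvfderiv_apply hX).mdifferentiableAt (by simp))] at h2
  rw [dChart_smul hq, map_add, dChart_smul hq]
  unfold dChart dbarFun
  rw [h1, h2]
  linear_combination -(1 / 2) * mvfderiv 𝓘(ℝ, ℂ)
    (fun y => mvfderiv 𝓘(ℝ, ℂ) (extChartAt 𝓘(ℝ, ℂ) p) y (X y)) q (Z q) * Complex.I_mul_I

lemma dChart_dbarTangent {p q : N} (hq : q ∈ (chartAt ℂ p).source)
    {Z : Π p : N, TangentSpace 𝓘(ℝ, ℂ) p} (hZ : SmoothSectionAt 𝓘(ℝ, ℂ) ℂ Z q)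
    (X : TangentSpace 𝓘(ℝ, ℂ) q) :
    dChart p q (dbarTangent Z q X) = dbarFun (fun q' => dChart p q' (Z q')) q X := by
  have h := dChart_bracket hq (smoothSectionAt_extend (I := 𝓘(ℝ, ℂ)) (F := ℂ) X) hZ
  rw [FiberBundle.extend_apply_self] at h
  exact h

/-- `∂̄_X Z` may be computed with any extension of `X`. -/
lemma dbarTangent_eq {q : N} {X Z : Π p : N, TangentSpace 𝓘(ℝ, ℂ) p}
    (hX : SmoothSectionAt 𝓘(ℝ, ℂ) ℂ X q) (hZ : SmoothSectionAt 𝓘(ℝ, ℂ) ℂ Z q) :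
    dbarTangent Z q (X q) = (1 / 2 : ℂ) • (mlieBracket 𝓘(ℝ, ℂ) X Z q
      + Complex.I • mlieBracket 𝓘(ℝ, ℂ) (fun q => Complex.I • X q) Z q) := by
  apply dChart_injective (mem_chart_source ℂ q)
  rw [dChart_dbarTangent (mem_chart_source ℂ q) hZ, dChart_bracket (mem_chart_source ℂ q) hX hZ]

variable (hN : HermitianMetric (fun p : N => TangentSpace 𝓘(ℝ, ℂ) p))

include hN in
/-- The `∂̄` of the chart coordinate of a vector field does not depend on the chart, for vector
fields which are only differentiable. -/
lemma dChart_dbarFun {p q : N} (hq : q ∈ (chartAt ℂ p).source)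
    {Z : Π p : N, TangentSpace 𝓘(ℝ, ℂ) p}
    (hZ : MDifferentiableAt 𝓘(ℝ, ℂ) (𝓘(ℝ, ℂ).prod 𝓘(ℝ, ℂ)) (fun y => TotalSpace.mk' ℂ y (Z y)) q)
    (X : TangentSpace 𝓘(ℝ, ℂ) q) :
    dChart p q (show TangentSpace 𝓘(ℝ, ℂ) q from dbarFun (fun q' => dChart q q' (Z q')) q X)
      = dbarFun (fun q' => dChart p q' (Z q')) q X := by
  obtain ⟨V, hV⟩ := hN.exists_isUnitFrameAt q
  have hVs := hV.smooth
  have hg := hN.mdifferentiableAt_form hVs hZ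
  have key {r : N} (hr : q ∈ (chartAt ℂ r).source) : dbarFun (fun q' => dChart r q' (Z q')) q X
      = hN.form q (V q) (Z q) * dChart r q (dbarTangent V q X)
        + dbarFun (fun q' => hN.form q' (V q') (Z q')) q X * dChart r q (V q) := by
    have h1 : (fun q' => dChart r q' (Z q'))
        =ᶠ[𝓝 q] fun q' => hN.form q' (V q') (Z q') * dChart r q' (V q') := by
      filter_upwards [hV.eventually, eventually_mem_chart hr] with q' h1 h2
      conv_lhs => rw [h1.eq_smul isComplexLineBundle_tangent (Z q')]
      exact dChart_smul h2 _ _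
    have h2 : MDifferentiableAt 𝓘(ℝ, ℂ) 𝓘(ℝ, ℂ) (fun q' => dChart r q' (V q')) q :=
      ((contMDiffAt_chart hr).mvfderiv_apply hVs).mdifferentiableAt (by simp)
    rw [dbarFun_congr h1, dbarFun_mul hg h2, ← dChart_dbarTangent hr hVs X]
  rw [key hq, key (mem_chart_source ℂ q), dChart_self, dChart_self]
  have h2 := (dChart p q).map_add (hN.form q (V q) (Z q) • dbarTangent V q X)
    (dbarFun (fun q' => hN.form q' (V q') (Z q')) q X • V q)
  rw [dChart_smul hq, dChart_smul hq] at h2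
  exact h2

/-- The holomorphic structure of the tangent bundle of a Riemann surface; on smooth vector fields it
is given by `dbarTangent`. It is defined as the `∂̄` of the coordinate in the chart at the point,
which is real linear in `X` for arbitrary vector fields. -/
def tangentHolomorphicStructure :
    HolomorphicStructure (fun p : N => TangentSpace 𝓘(ℝ, ℂ) p) where
  op Z p :=
    { toFun := fun X => dbarFun (fun q => dChart p q (Z q)) p X
      map_add' := dbarFun_vector_add _ p
      map_smul' := dbarFun_vector_smul _ p }
  antilinear Z p X hZ := dbarFun_I_smul _ p X
  add Z Z' p X hZ hZ' := by
    have h1 := (smoothSectionAt_iff_dChart.1 hZ).mdifferentiableAt (by simp)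
    have h2 := (smoothSectionAt_iff_dChart.1 hZ').mdifferentiableAt (by simp)
    have h3 := dbarFun_add h1 h2 X
    simp only [← map_add] at h3
    exact h3
  leibniz f Z p X hf hZ := by
    have h1 := (smoothSectionAt_iff_dChart.1 hZ).mdifferentiableAt (by simp)
    have h2 : (fun q => dChart p q (f q • Z q)) =ᶠ[𝓝 p] fun q => f q * dChart p q (Z q) := by
      filter_upwards [eventually_mem_chart (mem_chart_source ℂ p)] with q hq
      exact dChart_smul hq _ _
    change dbarFun _ p X = _
    rw [dbarFun_congr h2, dbarFun_mul (hf.mdifferentiableAt (by simp)) h1, dChart_self]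
    rfl
  smooth Z X p hZ hX := by
    have h1 := smoothSectionAt_iff_dChart.1 hZ
    refine smoothSectionAt_iff_dChart.2 ?_
    have h2 : ContMDiffAt 𝓘(ℝ, ℂ) 𝓘(ℝ, ℂ) ∞
        (fun q => (1 / 2 : ℂ) * (mvfderiv 𝓘(ℝ, ℂ) (fun q' => dChart p q' (Z q')) q (X q)
          + Complex.I * mvfderiv 𝓘(ℝ, ℂ) (fun q' => dChart p q' (Z q')) q (Complex.I • X q))) p :=
      contMDiffAt_const.complex_mul ((h1.mvfderiv_apply hX).add
        (contMDiffAt_const.complex_mul (h1.mvfderiv_apply hX.I_smul)))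
    refine h2.congr_of_eventuallyEq ?_
    filter_upwards [eventually_mem_chart (mem_chart_source ℂ p),
      hZ.eventually_mdifferentiableAt] with q hq hd
    refine (dChart_dbarFun hN hq hd (X q)).trans ?_
    simp only [dbarFun]
    ring

lemma tangentHolomorphicStructure_op {Z : Π p : N, TangentSpace 𝓘(ℝ, ℂ) p} {p : N}
    (hZ : SmoothSectionAt 𝓘(ℝ, ℂ) ℂ Z p) (X : TangentSpace 𝓘(ℝ, ℂ) p) :
    (tangentHolomorphicStructure hN).op Z p X = dbarTangent Z p X := by
  apply dChart_injective (mem_chart_source ℂ p)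
  rw [dChart_dbarTangent (mem_chart_source ℂ p) hZ, dChart_self]
  rfl

/-- Chern connections only test `∂̄` on smooth sections, so `dbarTangent` may be replaced by the
holomorphic structure of the tangent bundle. -/
lemma isNormalizedScalarCurvature_tangent_iff {κ : N → ℝ} :
    IsNormalizedScalarCurvature hN dbarTangent hN κ ↔
      IsNormalizedScalarCurvature hN
        (fun s p X => (tangentHolomorphicStructure hN).op s p X) hN κ := by
  refine exists_congr fun D => and_congr_left fun _ => ⟨fun h => ?_, fun h => ?_⟩
  · exact ⟨h.smooth, h.complex, h.hermitian, fun s p X hs => by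
      rw [tangentHolomorphicStructure_op hN hs]; exact h.dbar_eq s p X hs⟩
  · exact ⟨h.smooth, h.complex, h.hermitian, fun s p X hs => by
      rw [← tangentHolomorphicStructure_op hN hs]; exact h.dbar_eq s p X hs⟩

/-- The component of the bracket `[X, iX]` of a unit vector field along `X`, a complex function
`p + iq` with `[X, iX] = p X + q iX`. -/
def frameBracket (X : Π p : N, TangentSpace 𝓘(ℝ, ℂ) p) (p : N) : ℂ :=
  hN.form p (X p) (mlieBracket 𝓘(ℝ, ℂ) X (fun q => Complex.I • X q) p)

variable {hN} {X : Π p : N, TangentSpace 𝓘(ℝ, ℂ) p} {p : N}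

/-- Since `[X, X] = 0`, the `∂̄` of a unit vector field is determined by `[X, iX]`. -/
lemma dbarTangent_unitFrame (hX : IsUnitFrameAt hN X p) :
    dbarTangent X p (X p) = (-(Complex.I / 2) * frameBracket hN X p) • X p := by
  have h1 : mlieBracket 𝓘(ℝ, ℂ) X X p = 0 := by simp
  rw [dbarTangent_eq hX.smooth hX.smooth, h1, zero_add, mlieBracket_swap_apply,
    hX.eq_smul isComplexLineBundle_tangent (mlieBracket 𝓘(ℝ, ℂ) X _ p)]
  rw [smul_neg, smul_neg, smul_smul, smul_smul, ← neg_smul]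
  congr 1
  simp only [frameBracket]
  ring

lemma contMDiffAt_frameBracket (hX : SmoothSectionAt 𝓘(ℝ, ℂ) ℂ X p) :
    ContMDiffAt 𝓘(ℝ, ℂ) 𝓘(ℝ, ℂ) ∞ (frameBracket hN X) p :=
  hN.smooth p X _ hX (hX.mlieBracket hX.I_smul)

/-- The Gaussian curvature in terms of the bracket `[X, iX] = a X + b iX` of a unit frame. -/
lemma frameCurvature_tangent (hX : IsUnitFrameAt hN X p) :
    (tangentHolomorphicStructure hN).frameCurvature hN hN X X p
      = (mvfderiv 𝓘(ℝ, ℂ) (frameBracket hN X) p (X p)).im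
        - (mvfderiv 𝓘(ℝ, ℂ) (frameBracket hN X) p (Complex.I • X p)).re
        - (frameBracket hN X p).re ^ 2 - (frameBracket hN X p).im ^ 2 := by
  have h1 : (fun q => (tangentHolomorphicStructure hN).connForm hN X q (X q)) =ᶠ[𝓝 p]
      fun q => -(Complex.I / 2) * frameBracket hN X q := by
    filter_upwards [hX.eventually] with q hq
    rw [HolomorphicStructure.connForm_apply, tangentHolomorphicStructure_op hN hq.smooth,
      dbarTangent_unitFrame hq, map_smul, hq.form_self, smul_eq_mul, mul_one]
  have h2 := (contMDiffAt_frameBracket (hN := hN) hX.smooth).mdifferentiableAt (by simp)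
  have h3 : (tangentHolomorphicStructure hN).connForm hN X p (X p)
    = -(Complex.I / 2) * frameBracket hN X p := h1.self_of_nhds
  simp only [HolomorphicStructure.frameCurvature]
  rw [mvfderiv_congr_of_eventuallyEq h1, mvfderiv_const_mul _ h2, mvfderiv_const_mul _ h2, h3]
  change _ + 2 * (frameBracket hN X p).re * _ - 2 * (frameBracket hN X p).im * _ = _
  simp
  ring

end TangentLineBundle

/-! ### Complex vector bundles of rank one -/

section VectorBundleComplex

variable {N : Type*} [TopologicalSpace N] [ChartedSpace ℂ N] [IsManifold 𝓘(ℂ) ω N]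
  {W : N → Type*} [TopologicalSpace (TotalSpace ℂ W)]
  [∀ p, AddCommGroup (W p)] [∀ p, Module ℝ (W p)] [∀ p, Module ℂ (W p)]
  [∀ p, TopologicalSpace (W p)] [FiberBundle ℂ W] [VectorBundle ℂ ℂ W]

/-- The compatibility of the trivializations with the complex structures makes `W` a complex line bundle. -/
theorem isComplexLineBundle_of_vectorBundle : IsComplexLineBundle W where
  smul_smooth p f s hf hs := by
    refine (contMDiffAt_section p).2 ?_
    have hs' := (contMDiffAt_section p).1 hs
    refine (hf.complex_mul hs').congr_of_eventuallyEq ?_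
    filter_upwards [(trivializationAt ℂ W p).open_baseSet.mem_nhds
      (FiberBundle.mem_baseSet_trivializationAt ℂ W p)] with q hq
    exact ((trivializationAt ℂ W p).linear ℂ hq).map_smul (f q) (s q)
  rank_one p v w hv := by
    let e := (trivializationAt ℂ W p).continuousLinearEquivAt ℂ p
      (FiberBundle.mem_baseSet_trivializationAt ℂ W p)
    have hev : e v ≠ 0 := by simpa using hv
    refine ⟨e w / e v, e.injective ?_⟩
    rw [map_smul, smul_eq_mul, div_mul_cancel₀ _ hev]

end VectorBundleComplex

/-! ### Horizontal and vertical vector fields of a reduction -/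

section ReductionGeometry

variable {M : Type*} [TopologicalSpace M] [ChartedSpace E4 M] [IsManifold (𝓡 4) ∞ M]
  {g : Metric4 M} {o : OrientationForm M}
  {N : Type*} [TopologicalSpace N] [ChartedSpace ℂ N] [IsManifold 𝓘(ℂ) ω N]
  {W : N → Type*} [TopologicalSpace (TotalSpace ℂ W)]
  [∀ p, AddCommGroup (W p)] [∀ p, Module ℝ (W p)] [∀ p, Module ℂ (W p)]
  [∀ p, IsScalarTower ℝ ℂ (W p)]
  [∀ p, TopologicalSpace (W p)] [∀ p, IsTopologicalAddGroup (W p)]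
  [∀ p, ContinuousSMul ℝ (W p)] [FiberBundle ℂ W]
  [VectorBundle ℝ ℂ W] [VectorBundle ℂ ℂ W] [ContMDiffVectorBundle ∞ ℂ W 𝓘(ℝ, ℂ)]

instance (x : M) : FiniteDimensional ℝ (TangentSpace (𝓡 4) x) :=
  inferInstanceAs (FiniteDimensional ℝ E4)

lemma finrank_tangentSpace (x : M) : Module.finrank ℝ (TangentSpace (𝓡 4) x) = 4 :=
  (finrank_euclideanSpace_fin (𝕜 := ℝ) (n := 4) :)

namespace SurfaceReduction

variable (R : SurfaceReduction g o N W)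

/-- The differential of the projection onto the orbit space. -/
abbrev dproj (x : M) : TangentSpace (𝓡 4) x →L[ℝ] TangentSpace 𝓘(ℝ, ℂ) (R.proj x) :=
  mfderiv (𝓡 4) 𝓘(ℝ, ℂ) R.proj x

lemma mdifferentiableAt_proj (x : M) : MDifferentiableAt (𝓡 4) 𝓘(ℝ, ℂ) R.proj x :=
  (R.proj_smooth x).mdifferentiableAt (by simp)

lemma sameOrbit_of_isMIntegralCurveAt {K : Π x : M, TangentSpace (𝓡 4) x} (hK : K ∈ R.𝔥) {γ : ℝ → M}
    (hγ : IsMIntegralCurveAt γ K 0) : ∀ᶠ t in 𝓝 0, SameOrbit R.𝔥 (γ 0) (γ t) := by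
  obtain ⟨ε, hε, h⟩ := isMIntegralCurveAt_iff'.1 hγ
  filter_upwards [Metric.ball_mem_nhds 0 hε] with t ht
  -- `s ↦ γ (s t)` is an integral curve of `t K ∈ 𝔥` on the unit interval
  refine Relation.EqvGen.rel _ _ ⟨t • K, R.𝔥.smul_mem t hK, γ ∘ (· * t), ?_, by simp, by simp⟩
  refine (h.comp_mul t).mono fun s hs => ?_
  have h1 : |t| < ε := by simpa using ht
  have h2 : |s| ≤ 1 := abs_le.2 ⟨by linarith [hs.1], hs.2⟩
  have h3 : |s * t| < ε := by
    rw [abs_mul]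
    nlinarith [abs_nonneg s, abs_nonneg t]
  simpa using h3

/-- The projection is constant along the integral curves of the fields in `𝔥`, as these stay in an
orbit. -/
lemma dproj_symmetry {K : Π x : M, TangentSpace (𝓡 4) x} (hK : K ∈ R.𝔥) (x : M) :
    R.dproj x (K x) = 0 := by
  have hs : ContMDiffAt (𝓡 4) ((𝓡 4).prod 𝓘(ℝ, E4)) 1 (fun y => TotalSpace.mk' E4 y (K y)) x :=
    ContMDiffAt.of_le ((R.symmetry.conformal K hK).1 x) (by simp)
  obtain ⟨γ, h0, hγ⟩ := exists_isMIntegralCurveAt_of_contMDiffAt_boundaryless (t₀ := 0) hs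
  have h1 : R.proj ∘ γ =ᶠ[𝓝 0] fun _ => R.proj x := by
    filter_upwards [R.sameOrbit_of_isMIntegralCurveAt hK hγ] with t ht
    rw [h0] at ht
    exact ((R.proj_orbits x (γ t)).2 ht).symm
  have h2 := hγ.hasMFDerivAt
  have h3 := (R.mdifferentiableAt_proj (γ 0)).hasMFDerivAt.comp 0 h2
  have h4 := h3.mfderiv
  rw [h1.mfderiv_eq, mfderiv_const] at h4
  have h5 := congrArg (fun A : ℝ →L[ℝ] ℂ => A 1) h4
  have h6 : R.dproj (γ 0) ((1 : ℝ) • K (γ 0)) = 0 := h5.symm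
  rw [one_smul] at h6
  rw [← h0]
  exact h6

/-- The vertical tangent vectors are the values of the conformal vector fields in `𝔥`. -/
lemma exists_symmetry_eq {x : M} {u : TangentSpace (𝓡 4) x} (hu : R.dproj x u = 0) :
    ∃ K ∈ R.𝔥, K x = u := by
  let ev : R.𝔥 →ₗ[ℝ] TangentSpace (𝓡 4) x := (LinearMap.proj x).comp R.𝔥.subtype
  have hinj : Function.Injective ev := by
    refine (injective_iff_map_eq_zero ev).2 fun K hK => ?_
    exact Subtype.ext (R.symmetry.independent K K.2 x hK)
  have h1 : Module.finrank ℝ (LinearMap.range ev) = 2 := by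
    rw [LinearMap.finrank_range_of_inj hinj, R.symmetry.finrank_eq]
  have h2 := LinearMap.finrank_range_add_finrank_ker (R.dproj x).toLinearMap
  rw [LinearMap.range_eq_top.2 (R.proj_submersion x), finrank_top, finrank_tangentSpace] at h2
  have h3 : Module.finrank ℝ (TangentSpace 𝓘(ℝ, ℂ) (R.proj x)) = 2 := Complex.finrank_real_complex
  have h4 : LinearMap.range ev ≤ LinearMap.ker (R.dproj x).toLinearMap := by
    rintro _ ⟨K, rfl⟩
    exact R.dproj_symmetry K.2 x
  have h5 := Submodule.eq_of_le_of_finrank_eq h4 (by omega)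
  have h6 : u ∈ LinearMap.range ev := by
    rw [h5]
    exact hu
  obtain ⟨K, hK⟩ := h6
  exact ⟨K, K.2, hK⟩

lemma dproj_ι (x : M) (w : W (R.proj x)) : R.dproj x (R.ι x w) = 0 :=
  (R.ι_range x _).1 ⟨w, rfl⟩

lemma exists_ι_eq {x : M} {u : TangentSpace (𝓡 4) x} (hu : R.dproj x u = 0) :
    ∃ w, R.ι x w = u := (R.ι_range x u).2 hu

/-- Horizontality can be tested on the image of `W`, which is the vertical space. -/
lemma isHorizontal_iff {x : M} {u : TangentSpace (𝓡 4) x} :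
    IsHorizontal g x R.𝔥 u ↔ ∀ w, g.inner x (R.ι x w) u = 0 := by
  constructor
  · intro h w
    obtain ⟨K, hK, hKx⟩ := R.exists_symmetry_eq (R.dproj_ι x w)
    rw [← hKx]
    exact h K hK
  · intro h K hK
    obtain ⟨w, hw⟩ := R.exists_ι_eq (R.dproj_symmetry hK x)
    rw [← hw]
    exact h w

lemma IsHorizontal.add_smul {x : M} {u v : TangentSpace (𝓡 4) x} (hu : IsHorizontal g x R.𝔥 u)
    (hv : IsHorizontal g x R.𝔥 v) (a b : ℝ) : IsHorizontal g x R.𝔥 (a • u + b • v) := by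
  intro K hK
  simp [hu K hK, hv K hK]

/-- Polarization of the conformal identification of the vertical spaces with `W`. -/
lemma inner_ι_ι (x : M) (w w' : W (R.proj x)) :
    g.inner x (R.ι x w) (R.ι x w') = R.f x * (R.hW.form (R.proj x) w w').re := by
  have h1 := R.conformal_vertical x (w + w')
  have h2 := R.conformal_vertical x w
  have h3 := R.conformal_vertical x w'
  have h4 := g.symm x (R.ι x w) (R.ι x w')
  have h5 := R.hW.symm (R.proj x) w' w
  have h6 := congrArg Complex.re h5
  simp only [map_add, add_apply, LinearMap.add_apply, Complex.add_re, Complex.conj_re] at h1 h6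
  linear_combination (h1 - h2 - h3 + h4) / 2 - R.f x / 2 * h6

/-- Polarization of the conformal identification of the horizontal spaces with `TN`. -/
lemma inner_horizontal {x : M} {u v : TangentSpace (𝓡 4) x} (hu : IsHorizontal g x R.𝔥 u)
    (hv : IsHorizontal g x R.𝔥 v) :
    g.inner x u v = R.f x * (R.hN.form (R.proj x) (R.dproj x u) (R.dproj x v)).re := by
  have huv := IsHorizontal.add_smul R hu hv 1 1
  rw [one_smul, one_smul] at huv
  have h1 := R.conformal_horizontal x (u + v) huv
  have h2 := R.conformal_horizontal x u hu
  have h3 := R.conformal_horizontal x v hv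
  have h4 := g.symm x u v
  have h5 := R.hN.symm (R.proj x) (R.dproj x v) (R.dproj x u)
  have h6 := congrArg Complex.re h5
  simp only [map_add, add_apply, LinearMap.add_apply, Complex.add_re, Complex.conj_re] at h1 h6
  linear_combination (h1 - h2 - h3 + h4) / 2 - R.f x / 2 * h6

lemma eq_zero_of_horizontal_of_dproj {x : M} {u : TangentSpace (𝓡 4) x}
    (hu : IsHorizontal g x R.𝔥 u) (h0 : R.dproj x u = 0) : u = 0 := by
  by_contra hne
  obtain ⟨K, hK, hKx⟩ := R.exists_symmetry_eq h0
  have h1 := hu K hK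
  rw [hKx] at h1
  exact (g.pos x u hne).ne' h1

lemma exists_horizontal (x : M) (v : TangentSpace 𝓘(ℝ, ℂ) (R.proj x)) :
    ∃ u, IsHorizontal g x R.𝔥 u ∧ R.dproj x u = v := by
  obtain ⟨u, hu⟩ := R.proj_submersion x v
  obtain ⟨w, hw⟩ := R.hW.exists_isUnitFrameAt (R.proj x)
  set e := w (R.proj x)
  have he : R.hW.form (R.proj x) e e = 1 := hw.form_self
  have hI : ∀ w', w' = (R.hW.form (R.proj x) e w').re • e
      + (R.hW.form (R.proj x) e w').im • (Complex.I • e) := by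
    intro w'
    rw [← complex_smul_eq_re_add_im]
    exact hw.eq_smul isComplexLineBundle_of_vectorBundle w'
  -- subtract the vertical part of an arbitrary lift
  set a := g.inner x (R.ι x e) u
  set b := g.inner x (R.ι x (Complex.I • e)) u
  have hf := (R.f_pos x).ne'
  have horth : g.inner x (R.ι x e)
      (u - (a / R.f x) • R.ι x e - (b / R.f x) • R.ι x (Complex.I • e)) = 0 := by
    simp only [map_sub, map_smul, inner_ι_ι, he, smul_eq_mul]
    simp
    field_simp
    simp [a]
  have horth2 : g.inner x (R.ι x (Complex.I • e))
      (u - (a / R.f x) • R.ι x e - (b / R.f x) • R.ι x (Complex.I • e)) = 0 := by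
    simp only [map_sub, map_smul, inner_ι_ι, he, smul_eq_mul, map_smulₛₗ, LinearMap.smul_apply]
    simp
    field_simp
    simp [b]
  refine ⟨u - (a / R.f x) • R.ι x e - (b / R.f x) • R.ι x (Complex.I • e), ?_, ?_⟩
  · refine R.isHorizontal_iff.2 fun w' => ?_
    rw [hI w', map_add, map_smul, map_smul, map_add, map_smul, map_smul, add_apply, smul_apply,
      smul_apply, horth, horth2]
    simp
  · simp [hu, dproj_ι]

/-- The horizontal lift of a tangent vector. -/
def hlift (x : M) (v : TangentSpace 𝓘(ℝ, ℂ) (R.proj x)) : TangentSpace (𝓡 4) x :=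
  (R.exists_horizontal x v).choose

lemma isHorizontal_hlift (x : M) (v : TangentSpace 𝓘(ℝ, ℂ) (R.proj x)) :
    IsHorizontal g x R.𝔥 (R.hlift x v) := (R.exists_horizontal x v).choose_spec.1

lemma dproj_hlift (x : M) (v : TangentSpace 𝓘(ℝ, ℂ) (R.proj x)) :
    R.dproj x (R.hlift x v) = v := (R.exists_horizontal x v).choose_spec.2

lemma inner_ι_hlift (x : M) (w : W (R.proj x)) (v : TangentSpace 𝓘(ℝ, ℂ) (R.proj x)) :
    g.inner x (R.ι x w) (R.hlift x v) = 0 := R.isHorizontal_iff.1 (R.isHorizontal_hlift x v) w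

lemma inner_hlift_ι (x : M) (w : W (R.proj x)) (v : TangentSpace 𝓘(ℝ, ℂ) (R.proj x)) :
    g.inner x (R.hlift x v) (R.ι x w) = 0 := by
  rw [g.symm, inner_ι_hlift]

/-- Every tangent vector is the sum of a vertical vector and the horizontal lift of its
projection. -/
lemma exists_eq_ι_add_hlift (x : M) (u : TangentSpace (𝓡 4) x) :
    ∃ w, u = R.ι x w + R.hlift x (R.dproj x u) := by
  obtain ⟨w, hw⟩ := R.exists_ι_eq (x := x) (u := u - R.hlift x (R.dproj x u))
    (by rw [map_sub, dproj_hlift, sub_self])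
  exact ⟨w, by rw [hw]; abel⟩

lemma inner_hlift (x : M) (v : TangentSpace 𝓘(ℝ, ℂ) (R.proj x)) (u : TangentSpace (𝓡 4) x) :
    g.inner x (R.hlift x v) u = R.f x * (R.hN.form (R.proj x) v (R.dproj x u)).re := by
  obtain ⟨w, hw⟩ := R.exists_eq_ι_add_hlift x u
  conv_lhs => rw [hw]
  rw [map_add, inner_hlift_ι, zero_add, R.inner_horizontal (R.isHorizontal_hlift _ _)
    (R.isHorizontal_hlift _ _), dproj_hlift, dproj_hlift]

/-- The horizontal lift of a vector field. -/
def lift (X : Π p : N, TangentSpace 𝓘(ℝ, ℂ) p) (x : M) : TangentSpace (𝓡 4) x :=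
  R.hlift x (X (R.proj x))

lemma isHorizontalLift_lift (X : Π p : N, TangentSpace 𝓘(ℝ, ℂ) p) :
    R.IsHorizontalLift X (R.lift X) :=
  fun x => ⟨R.isHorizontal_hlift x _, R.dproj_hlift x _⟩

/-- The chain rule for functions pulled back from the orbit space. -/
lemma mvfderiv_comp_proj {G : Type*} [NormedAddCommGroup G] [NormedSpace ℝ G] {φ : N → G} {x : M}
    (hφ : MDifferentiableAt 𝓘(ℝ, ℂ) 𝓘(ℝ, G) φ (R.proj x)) (u : TangentSpace (𝓡 4) x) :
    mvfderiv (𝓡 4) (fun y => φ (R.proj y)) x u = mvfderiv 𝓘(ℝ, ℂ) φ (R.proj x) (R.dproj x u) := by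
  have h := mfderiv_comp x hφ (R.mdifferentiableAt_proj x)
  exact congrArg (fun A : TangentSpace (𝓡 4) x →L[ℝ] G => A u) h

lemma contMDiffAt_comp_proj {G : Type*} [NormedAddCommGroup G] [NormedSpace ℝ G] {φ : N → G} {x : M}
    (hφ : ContMDiffAt 𝓘(ℝ, ℂ) 𝓘(ℝ, G) ∞ φ (R.proj x)) :
    ContMDiffAt (𝓡 4) 𝓘(ℝ, G) ∞ (fun y => φ (R.proj y)) x :=
  hφ.comp x (R.proj_smooth x)

lemma eventually_proj {P : N → Prop} {x : M} (h : ∀ᶠ p in 𝓝 (R.proj x), P p) :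
    ∀ᶠ y in 𝓝 x, P (R.proj y) :=
  (R.proj_smooth x).continuousAt.eventually h

lemma contMDiffAt_f (x : M) : ContMDiffAt (𝓡 4) 𝓘(ℝ, ℝ) ∞ R.f x := by
  obtain ⟨w, hw⟩ := R.hW.exists_isUnitFrameAt (R.proj x)
  have h1 := R.ι_smooth x w hw.smooth
  refine (g.contMDiffAt_inner h1 h1).congr_of_eventuallyEq ?_
  filter_upwards [R.eventually_proj hw.eventually] with y hy
  rw [inner_ι_ι, hy.form_self]
  simp

/-- The horizontal lift of a smooth vector field is smooth: its inner products with smooth vector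
fields are smooth, as they only involve the differential of the projection. -/
lemma smoothSectionAt_lift {X : Π p : N, TangentSpace 𝓘(ℝ, ℂ) p} {x : M}
    (hX : SmoothSectionAt 𝓘(ℝ, ℂ) ℂ X (R.proj x)) : SmoothSectionAt (𝓡 4) E4 (R.lift X) x := by
  refine g.smoothSectionAt_of_inner fun Z hZ => ?_
  obtain ⟨V, hV⟩ := R.hN.exists_isUnitFrameAt (R.proj x)
  set c := fun p => dChart (R.proj x) p (V p) with hcdef
  have hc : ContMDiffAt 𝓘(ℝ, ℂ) 𝓘(ℝ, ℂ) ∞ c (R.proj x) := smoothSectionAt_iff_dChart.1 hV.smooth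
  have hmem := mem_chart_source ℂ (R.proj x)
  have hc0 : c (R.proj x) ≠ 0 := by
    intro h0
    exact hV.ne_zero (dChart_injective hmem (h0.trans (map_zero _).symm))
  have hψ := contMDiffAt_chart hmem
  have h1 : ContMDiffAt (𝓡 4) 𝓘(ℝ, ℂ) ∞ (fun y => mvfderiv (𝓡 4)
      (fun y => extChartAt 𝓘(ℝ, ℂ) (R.proj x) (R.proj y)) y (Z y)) x :=
    (R.contMDiffAt_comp_proj hψ).mvfderiv_apply hZ.self_of_nhds
  have hcinv : ContMDiffAt 𝓘(ℝ, ℂ) 𝓘(ℝ, ℂ) ∞ (fun p => (c p)⁻¹) (R.proj x) :=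
    ((contDiffAt_inv ℂ hc0).restrict_scalars ℝ).contMDiffAt.comp (R.proj x) hc
  have h2 : ContMDiffAt (𝓡 4) 𝓘(ℝ, ℝ) ∞ (fun y => R.f y *
      (mvfderiv (𝓡 4) (fun y => extChartAt 𝓘(ℝ, ℂ) (R.proj x) (R.proj y)) y (Z y)
        * ((c (R.proj y))⁻¹ * R.hN.form (R.proj y) (X (R.proj y)) (V (R.proj y)))).re) x :=
    (R.contMDiffAt_f x).mul (h1.complex_mul ((R.contMDiffAt_comp_proj hcinv).complex_mul
      (R.contMDiffAt_comp_proj (R.hN.smooth _ _ _ hX hV.smooth)))).re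
  refine h2.congr_of_eventuallyEq ?_
  filter_upwards [R.eventually_proj hV.eventually, R.eventually_proj (eventually_mem_chart hmem)]
    with y hy hy2
  have h3 := hy.eq_smul isComplexLineBundle_tangent (R.dproj y (Z y))
  have h4 : dChart (R.proj x) (R.proj y) (R.dproj y (Z y))
      = R.hN.form (R.proj y) (V (R.proj y)) (R.dproj y (Z y)) * c (R.proj y) := by
    conv_lhs => rw [h3]
    exact dChart_smul hy2 _ _
  have h5 : c (R.proj y) ≠ 0 := by
    intro h0
    exact hy.ne_zero (dChart_injective hy2 (h0.trans (map_zero _).symm))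
  rw [lift, inner_hlift, R.mvfderiv_comp_proj ((contMDiffAt_chart hy2).mdifferentiableAt (by simp))]
  change _ = R.f y * (dChart (R.proj x) (R.proj y) (R.dproj y (Z y)) * _).re
  conv_lhs => rw [h3, map_smul, smul_eq_mul]
  rw [h4]
  congr 2
  field_simp

/-- Projectable vector fields: the projection intertwines Lie brackets. -/
lemma dproj_mlieBracket {A B : Π x : M, TangentSpace (𝓡 4) x} {X Y : Π p : N, TangentSpace 𝓘(ℝ, ℂ) p}
    {x : M} (hA : SmoothSectionAt (𝓡 4) E4 A x) (hB : SmoothSectionAt (𝓡 4) E4 B x)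
    (hX : SmoothSectionAt 𝓘(ℝ, ℂ) ℂ X (R.proj x)) (hY : SmoothSectionAt 𝓘(ℝ, ℂ) ℂ Y (R.proj x))
    (hAX : ∀ᶠ y in 𝓝 x, R.dproj y (A y) = X (R.proj y))
    (hBY : ∀ᶠ y in 𝓝 x, R.dproj y (B y) = Y (R.proj y)) :
    R.dproj x (mlieBracket (𝓡 4) A B x) = mlieBracket 𝓘(ℝ, ℂ) X Y (R.proj x) := by
  have hmem := mem_chart_source ℂ (R.proj x)
  have hψ := contMDiffAt_chart hmem
  apply dChart_injective hmem
  have h1 := mvfderiv_mlieBracket_complex hX hY hψ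
  have h2 := mvfderiv_mlieBracket_complex hA hB (R.contMDiffAt_comp_proj hψ)
  have key {A B : Π x : M, TangentSpace (𝓡 4) x} {X Y : Π p : N, TangentSpace 𝓘(ℝ, ℂ) p}
      (hY : SmoothSectionAt 𝓘(ℝ, ℂ) ℂ Y (R.proj x))
      (hAX : ∀ᶠ y in 𝓝 x, R.dproj y (A y) = X (R.proj y))
      (hBY : ∀ᶠ y in 𝓝 x, R.dproj y (B y) = Y (R.proj y)) :
      mvfderiv (𝓡 4) (fun y => mvfderiv (𝓡 4)
        (fun y => extChartAt 𝓘(ℝ, ℂ) (R.proj x) (R.proj y)) y (B y)) x (A x)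
      = mvfderiv 𝓘(ℝ, ℂ) (fun p => mvfderiv 𝓘(ℝ, ℂ) (extChartAt 𝓘(ℝ, ℂ) (R.proj x)) p (Y p))
          (R.proj x) (X (R.proj x)) := by
    have h3 : (fun y => mvfderiv (𝓡 4)
        (fun y => extChartAt 𝓘(ℝ, ℂ) (R.proj x) (R.proj y)) y (B y)) =ᶠ[𝓝 x]
        fun y => mvfderiv 𝓘(ℝ, ℂ) (extChartAt 𝓘(ℝ, ℂ) (R.proj x)) (R.proj y) (Y (R.proj y)) := by
      filter_upwards [hBY, R.eventually_proj (eventually_mem_chart hmem)] with y hy hy2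
      rw [R.mvfderiv_comp_proj ((contMDiffAt_chart hy2).mdifferentiableAt (by simp)), hy]
    rw [mvfderiv_congr_of_eventuallyEq h3, R.mvfderiv_comp_proj
      (φ := fun p => mvfderiv 𝓘(ℝ, ℂ) (extChartAt 𝓘(ℝ, ℂ) (R.proj x)) p (Y p))
      ((hψ.mvfderiv_apply hY).mdifferentiableAt (by simp)), hAX.self_of_nhds]
  rw [R.mvfderiv_comp_proj (hψ.mdifferentiableAt (by simp)), key hY hAX hBY, key hX hBY hAX,
    ← h1] at h2
  exact h2

/-- Horizontal lifts are invariant under the conformal symmetries: the bracket with a symmetry is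
horizontal, as symmetries preserve the conformal structure and the vertical fields of sections of
`W`, and it projects to zero. -/
lemma mlieBracket_symmetry_lift {K : Π x : M, TangentSpace (𝓡 4) x} (hK : K ∈ R.𝔥)
    {X : Π p : N, TangentSpace 𝓘(ℝ, ℂ) p} {x : M} (hX : SmoothSectionAt 𝓘(ℝ, ℂ) ℂ X (R.proj x)) :
    mlieBracket (𝓡 4) K (R.lift X) x = 0 := by
  obtain ⟨hKs, σ, hσ⟩ := R.symmetry.conformal K hK
  have hL := R.smoothSectionAt_lift hX
  refine R.eq_zero_of_horizontal_of_dproj (R.isHorizontal_iff.2 fun w => ?_) ?_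
  · set s := FiberBundle.extend ℂ w with hsdef
    have hs : SmoothSectionAt 𝓘(ℝ, ℂ) ℂ s (R.proj x) := smoothSectionAt_extend w
    have h1 := hσ x _ _ (R.ι_smooth x s hs) hL
    have h2 : (fun y => g.inner y (R.ι y (s (R.proj y))) (R.lift X y)) = fun _ => 0 :=
      funext fun y => R.inner_ι_hlift y _ _
    have h3 : g.inner x (R.ι x (s (R.proj x))) (R.lift X x) = 0 := R.inner_ι_hlift x _ _
    rw [h2, mvfderiv_const, R.ι_invariant x s hs K hK, h3] at h1
    have h4 : s (R.proj x) = w := FiberBundle.extend_apply_self ..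
    simpa [h4] using h1
  · rw [R.dproj_mlieBracket (hKs x) hL (smoothSectionAt_zero _) hX
      (Filter.Eventually.of_forall fun y => R.dproj_symmetry hK y)
      (Filter.Eventually.of_forall fun y => R.dproj_hlift y _)]
    exact congrFun (mlieBracket_zero_left (I := 𝓘(ℝ, ℂ)) (W := X)) (R.proj x)

end SurfaceReduction

end ReductionGeometry

/-! ### Conformal frames -/

section ConformalFrames

variable {M : Type*} [TopologicalSpace M] [ChartedSpace E4 M] [IsManifold (𝓡 4) ∞ M]
  {g : Metric4 M} {f : M → ℝ} {E : Fin 4 → Π x : M, TangentSpace (𝓡 4) x} {x : M}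

variable (g f E x) in
/-- Near `x`, the vector fields `E i` are smooth, mutually orthogonal, and of the same square
length `f`. -/
def IsConformalFrameAt : Prop :=
  ∀ᶠ y in 𝓝 x, 0 < f y ∧ ContMDiffAt (𝓡 4) 𝓘(ℝ, ℝ) ∞ f y ∧
    (∀ i, SmoothSectionAt (𝓡 4) E4 (E i) y) ∧
    ∀ i j, g.inner y (E i y) (E j y) = if i = j then f y else 0

lemma IsConformalFrameAt.eventually (hE : IsConformalFrameAt g f E x) :
    ∀ᶠ y in 𝓝 x, IsConformalFrameAt g f E y := eventually_eventually_nhds.2 hE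

lemma IsConformalFrameAt.smooth (hE : IsConformalFrameAt g f E x) (i : Fin 4) :
    SmoothSectionAt (𝓡 4) E4 (E i) x := hE.self_of_nhds.2.2.1 i

lemma IsConformalFrameAt.pos (hE : IsConformalFrameAt g f E x) : 0 < f x := hE.self_of_nhds.1

lemma IsConformalFrameAt.smooth_factor (hE : IsConformalFrameAt g f E x) :
    ContMDiffAt (𝓡 4) 𝓘(ℝ, ℝ) ∞ f x := hE.self_of_nhds.2.1

lemma IsConformalFrameAt.inner_eq (hE : IsConformalFrameAt g f E x) (i j : Fin 4) :
    g.inner x (E i x) (E j x) = if i = j then f x else 0 := hE.self_of_nhds.2.2.2 i j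

/-- The expansion of a tangent vector in an orthogonal frame of vectors of the same length. -/
lemma Metric4.sum_orthogonal_eq {e : Fin 4 → TangentSpace (𝓡 4) x} {r : ℝ} (hr : 0 < r)
    (he : ∀ i j, g.inner x (e i) (e j) = if i = j then r else 0) (v : TangentSpace (𝓡 4) x) :
    v = ∑ k, (g.inner x v (e k) / r) • e k := by
  have hli : LinearIndependent ℝ e := by
    rw [Fintype.linearIndependent_iff]
    intro a ha i
    have h1 := congrArg (fun u => g.inner x u (e i)) ha
    simp only [map_sum, map_smul, sum_apply, smul_apply, he, map_zero, zero_apply] at h1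
    simpa [hr.ne'] using h1
  have hspan : v ∈ Submodule.span ℝ (Set.range e) := by
    rw [hli.span_eq_top_of_card_eq_finrank' (by rw [finrank_tangentSpace]; rfl)]
    trivial
  obtain ⟨a, rfl⟩ := (Submodule.mem_span_range_iff_exists_fun ℝ).1 hspan
  refine Finset.sum_congr rfl fun k _ => ?_
  simp only [map_sum, map_smul, sum_apply, smul_apply, he]
  simp [hr.ne']

variable (g f E) in
/-- The structure functions of a conformal frame, `[Eᵢ, Eⱼ] = ∑ cᵢⱼᵏ Eₖ`. -/
def structureFun (i j k : Fin 4) (y : M) : ℝ :=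
  g.inner y (mlieBracket (𝓡 4) (E i) (E j) y) (E k y) / f y

variable (f E) in
/-- The derivative of `log √f` along the frame. -/
def logFactor (i : Fin 4) (y : M) : ℝ :=
  mvfderiv (𝓡 4) (fun z => Real.log (f z) / 2) y (E i y)

variable (g f E) in
/-- The connection coefficients `∇_{Eᵢ} Eⱼ = ∑ Gᵢⱼᵏ Eₖ` of the Levi-Civita connection in a
conformal frame. -/
def connectionFun (i j k : Fin 4) (y : M) : ℝ :=
  (structureFun g f E i j k y - structureFun g f E i k j y - structureFun g f E j k i y) / 2
    + logFactor f E i y * (if j = k then 1 else 0) + logFactor f E j y * (if i = k then 1 else 0)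
    - logFactor f E k y * (if i = j then 1 else 0)

namespace IsConformalFrameAt

variable (hE : IsConformalFrameAt g f E x)

include hE

lemma eq_sum (v : TangentSpace (𝓡 4) x) : v = ∑ k, (g.inner x v (E k x) / f x) • E k x :=
  Metric4.sum_orthogonal_eq hE.pos hE.inner_eq v

lemma inner_sum (a : Fin 4 → ℝ) (l : Fin 4) :
    g.inner x (∑ k, a k • E k x) (E l x) = f x * a l := by
  simp only [map_sum, map_smul, sum_apply, smul_apply, hE.inner_eq]
  simp [mul_comm]

lemma mlieBracket_eq (i j : Fin 4) :
    mlieBracket (𝓡 4) (E i) (E j) x = ∑ k, structureFun g f E i j k x • E k x := hE.eq_sum _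

lemma contMDiffAt_structureFun (i j k : Fin 4) :
    ContMDiffAt (𝓡 4) 𝓘(ℝ, ℝ) ∞ (structureFun g f E i j k) x :=
  (g.contMDiffAt_inner ((hE.smooth i).mlieBracket (hE.smooth j)) (hE.smooth k)).div₀
    hE.smooth_factor hE.pos.ne'

lemma contMDiffAt_log : ContMDiffAt (𝓡 4) 𝓘(ℝ, ℝ) ∞ (fun z => Real.log (f z) / 2) x :=
  ((Real.contDiffAt_log.2 hE.pos.ne').contMDiffAt.comp x hE.smooth_factor).div_const 2

lemma contMDiffAt_logFactor (i : Fin 4) : ContMDiffAt (𝓡 4) 𝓘(ℝ, ℝ) ∞ (logFactor f E i) x :=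
  hE.contMDiffAt_log.mvfderiv_apply (hE.smooth i)

lemma contMDiffAt_connectionFun (i j k : Fin 4) :
    ContMDiffAt (𝓡 4) 𝓘(ℝ, ℝ) ∞ (connectionFun g f E i j k) x := by
  have hc := hE.contMDiffAt_structureFun
  have hl := hE.contMDiffAt_logFactor
  exact (((((hc i j k).sub (hc i k j)).sub (hc j k i)).div_const 2).add
    ((hl i).mul contMDiffAt_const)).add ((hl j).mul contMDiffAt_const) |>.sub
    ((hl k).mul contMDiffAt_const)

/-- The frame derivatives of `f` in terms of those of `log √f`. -/
lemma mvfderiv_factor (i : Fin 4) :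
    mvfderiv (𝓡 4) f x (E i x) = 2 * f x * logFactor f E i x := by
  have h1 := hE.contMDiffAt_log
  have hev : f =ᶠ[𝓝 x] fun z => Real.exp (2 * (Real.log (f z) / 2)) := by
    filter_upwards [hE.eventually] with z hz
    rw [mul_div_cancel₀ _ two_ne_zero, Real.exp_log hz.pos]
  have h2 : HasMFDerivAt (𝓡 4) 𝓘(ℝ, ℝ) (fun z => Real.log (f z) / 2) x _ :=
    (h1.mdifferentiableAt (by simp)).hasMFDerivAt
  have h3 : HasFDerivAt (fun r : ℝ => Real.exp (2 * r)) _ (Real.log (f x) / 2) :=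
    (((hasDerivAt_id (Real.log (f x) / 2)).const_mul 2).exp).hasFDerivAt
  have h4 := (h3.hasMFDerivAt.comp x h2).mfderiv
  rw [mvfderiv_congr_of_eventuallyEq hev]
  refine (congrArg (fun A : TangentSpace (𝓡 4) x →L[ℝ] ℝ => A (E i x)) h4).trans ?_
  change logFactor f E i x * (Real.exp (2 * (Real.log (f x) / 2)) * (2 * 1)) = _
  rw [mul_div_cancel₀ _ two_ne_zero, Real.exp_log hE.pos]
  ring

/-- The second derivatives of the conformal factor commute up to the structure functions. -/
lemma mvfderiv_logFactor_comm (i j : Fin 4) :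
    mvfderiv (𝓡 4) (logFactor f E j) x (E i x) - mvfderiv (𝓡 4) (logFactor f E i) x (E j x)
      = ∑ k, structureFun g f E i j k x * logFactor f E k x := by
  have h := mvfderiv_mlieBracket (hE.smooth i) (hE.smooth j) hE.contMDiffAt_log
  rw [hE.mlieBracket_eq, map_sum] at h
  simp only [map_smul, smul_eq_mul] at h
  exact h.symm

lemma mlieBracket_sum_right {φ : Fin 4 → M → ℝ} (hφ : ∀ k, ContMDiffAt (𝓡 4) 𝓘(ℝ, ℝ) ∞ (φ k) x)
    (i : Fin 4) :
    mlieBracket (𝓡 4) (E i) (fun y => ∑ k, φ k y • E k y) x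
      = ∑ l, (mvfderiv (𝓡 4) (φ l) x (E i x) + ∑ m, φ m x * structureFun g f E i m l x) • E l x := by
  rw [mlieBracket_fun_sum_right _ fun k => SmoothSectionAt.smul (hφ k) (hE.smooth k)]
  simp only [mlieBracket_fun_smul_right (hφ _) (hE.smooth _), hE.mlieBracket_eq, Finset.smul_sum,
    Finset.sum_add_distrib, add_smul, Finset.sum_smul, smul_smul]
  congr 1
  exact Finset.sum_comm

lemma mlieBracket_mlieBracket (i j k : Fin 4) :
    mlieBracket (𝓡 4) (E i) (mlieBracket (𝓡 4) (E j) (E k)) x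
      = ∑ l, (mvfderiv (𝓡 4) (structureFun g f E j k l) x (E i x)
        + ∑ m, structureFun g f E j k m x * structureFun g f E i m l x) • E l x := by
  rw [← hE.mlieBracket_sum_right fun l => hE.contMDiffAt_structureFun j k l]
  exact mlieBracket_congr_of_eventuallyEq (Filter.Eventually.of_forall fun _ => rfl)
    (hE.eventually.mono fun y hy => hy.mlieBracket_eq j k)

lemma structureFun_swap (i j k : Fin 4) (y : M) :
    structureFun g f E i j k y = -structureFun g f E j i k y := by
  rw [structureFun, mlieBracket_swap_apply, map_neg, neg_apply, neg_div]
  rfl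

/-- The Jacobi identity in terms of structure functions. -/
lemma jacobi (i j k l : Fin 4) :
    (mvfderiv (𝓡 4) (structureFun g f E j k l) x (E i x)
        + ∑ m, structureFun g f E j k m x * structureFun g f E i m l x)
      + (mvfderiv (𝓡 4) (structureFun g f E k i l) x (E j x)
        + ∑ m, structureFun g f E k i m x * structureFun g f E j m l x)
      + (mvfderiv (𝓡 4) (structureFun g f E i j l) x (E k x)
        + ∑ m, structureFun g f E i j m x * structureFun g f E k m l x) = 0 := by
  have h := mlieBracket_jacobi (hE.smooth i) (hE.smooth j) (hE.smooth k)
  rw [mlieBracket_swap_apply (V := mlieBracket (𝓡 4) (E i) (E j))] at h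
  have h2 : mlieBracket (𝓡 4) (E i) (E k) = fun y => (-1 : ℝ) • mlieBracket (𝓡 4) (E k) (E i) y := by
    funext y
    rw [mlieBracket_swap_apply, neg_one_smul]
  have h3 := mlieBracket_fun_smul_right (X := E j) (f := fun _ => (-1 : ℝ)) (x := x)
    contMDiffAt_const ((hE.smooth k).mlieBracket (hE.smooth i))
  rw [h2, h3, mvfderiv_const, zero_apply, zero_smul, zero_add, neg_one_smul,
    hE.mlieBracket_mlieBracket, hE.mlieBracket_mlieBracket, hE.mlieBracket_mlieBracket] at h
  have h4 := congrArg (fun u => g.inner x u (E l x)) h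
  simp only [map_add, map_neg, add_apply, neg_apply, hE.inner_sum] at h4
  refine mul_left_cancel₀ hE.pos.ne' ?_
  linear_combination h4

end IsConformalFrameAt

namespace IsLeviCivita

variable {D : CovariantDerivative (𝓡 4) E4 (fun x : M => TangentSpace (𝓡 4) x)}
  (hD : IsLeviCivita g D) (hE : IsConformalFrameAt g f E x)

include hD hE

/-- The Koszul formula in a conformal frame. -/
lemma inner_frame (i j k : Fin 4) :
    g.inner x (D (E j) x (E i x)) (E k x) = f x * connectionFun g f E i j k x := by
  have hm (i j k : Fin 4) : g.inner x (D (E j) x (E i x)) (E k x)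
      + g.inner x (D (E k) x (E i x)) (E j x)
      = (2 * f x * logFactor f E i x) * (if j = k then 1 else 0) := by
    have h1 := hD.metric x (E j) (E k) (E i x) (hE.smooth j) (hE.smooth k)
    have h2 : (fun y => g.inner y (E j y) (E k y))
        =ᶠ[𝓝 x] fun y => (if j = k then (1 : ℝ) else 0) • f y := by
      filter_upwards [hE.eventually] with y hy
      rw [hy.inner_eq]
      split_ifs <;> simp
    rw [mvfderiv_congr_of_eventuallyEq h2, mvfderiv_fun_smul mdifferentiableAt_const
      (hE.smooth_factor.mdifferentiableAt (by simp)), mvfderiv_const] at h1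
    rw [g.symm x (D (E k) x (E i x)), ← h1, ← hE.mvfderiv_factor]
    by_cases hjk : j = k <;> simp [hjk, mul_comm]
  have ht (i j k : Fin 4) : g.inner x (D (E j) x (E i x)) (E k x)
      - g.inner x (D (E i) x (E j x)) (E k x) = f x * structureFun g f E i j k x := by
    have h1 := hD.torsion_free x (E i) (E j) (hE.smooth i) (hE.smooth j)
    rw [hE.mlieBracket_eq] at h1
    have h2 := congrArg (fun u => g.inner x u (E k x)) h1
    simp only [map_sub, sub_apply, hE.inner_sum] at h2
    exact h2
  have hs : (if i = k then (1 : ℝ) else 0) = if k = i then 1 else 0 := by simp only [eq_comm]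
  unfold connectionFun
  have h1 := hm i j k
  have h2 := hm j k i
  have h3 := hm k i j
  have h4 := ht i j k
  have h5 := ht i k j
  have h6 := ht j k i
  rw [hs]
  -- the six-term Koszul combination of metricity and vanishing torsion
  linear_combination (h1 + h2 - h3 + h4 - h5 - h6) / 2

lemma apply_frame (i j : Fin 4) :
    D (E j) x (E i x) = ∑ k, connectionFun g f E i j k x • E k x := by
  rw [hE.eq_sum (D (E j) x (E i x))]
  refine Finset.sum_congr rfl fun k _ => ?_
  rw [hD.inner_frame hE, mul_div_cancel_left₀ _ hE.pos.ne']

/-- The Riemann tensor in a conformal frame. -/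
lemma inner_curvature_frame (i j k l : Fin 4) :
    g.inner x (curvatureAt D x (E i x) (E j x) (E k x)) (E l x)
      = f x * (mvfderiv (𝓡 4) (connectionFun g f E j k l) x (E i x)
        - mvfderiv (𝓡 4) (connectionFun g f E i k l) x (E j x)
        + ∑ m, (connectionFun g f E j k m x * connectionFun g f E i m l x
          - connectionFun g f E i k m x * connectionFun g f E j m l x
          - structureFun g f E i j m x * connectionFun g f E m k l x)) := by
  have key (i j : Fin 4) : g.inner x (D (fun y => D (E k) y (E j y)) x (E i x)) (E l x)
      = f x * (mvfderiv (𝓡 4) (connectionFun g f E j k l) x (E i x)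
        + ∑ m, connectionFun g f E j k m x * connectionFun g f E i m l x) := by
    have hsm : SmoothSectionAt (𝓡 4) E4 (fun y => ∑ m, connectionFun g f E j k m y • E m y) x :=
      SmoothSectionAt.sum fun m _ =>
        SmoothSectionAt.smul (hE.contMDiffAt_connectionFun j k m) (hE.smooth m)
    rw [D.congr_apply hsm.mdifferentiableAt (hE.eventually.mono fun y hy => hD.apply_frame hy j k),
      D.sum_smul_apply _ (fun m => hE.contMDiffAt_connectionFun j k m) hE.smooth,
      Finset.sum_add_distrib, map_add, add_apply, hE.inner_sum]
    simp only [map_sum, map_smul, sum_apply, smul_apply, hD.inner_frame hE, smul_eq_mul]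
    rw [mul_add, add_comm, Finset.mul_sum]
    congr 1
    exact Finset.sum_congr rfl fun m _ => by ring
  rw [CovariantDerivative.curvatureAt_eq_curvatureOp hD.smooth (hE.smooth i) (hE.smooth j)
    (hE.smooth k), CovariantDerivative.curvatureOp, map_sub, map_sub, sub_apply, sub_apply, key, key,
    hE.mlieBracket_eq]
  simp only [map_sum, map_smul, sum_apply, smul_apply, hD.inner_frame hE, smul_eq_mul,
    Finset.sum_sub_distrib, mul_sub, mul_add, Finset.mul_sum]
  have h1 : ∀ m, f x * (structureFun g f E i j m x * connectionFun g f E m k l x)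
      = structureFun g f E i j m x * (f x * connectionFun g f E m k l x) := fun m => by ring
  simp only [h1]
  ring

end IsLeviCivita

end ConformalFrames

/-! ### Adapted frames of a reduction -/

section AdaptedFrames

variable {M : Type*} [TopologicalSpace M] [ChartedSpace E4 M] [IsManifold (𝓡 4) ∞ M]
  {g : Metric4 M} {o : OrientationForm M}
  {N : Type*} [TopologicalSpace N] [ChartedSpace ℂ N] [IsManifold 𝓘(ℂ) ω N]
  {W : N → Type*} [TopologicalSpace (TotalSpace ℂ W)]
  [∀ p, AddCommGroup (W p)] [∀ p, Module ℝ (W p)] [∀ p, Module ℂ (W p)]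
  [∀ p, IsScalarTower ℝ ℂ (W p)]
  [∀ p, TopologicalSpace (W p)] [∀ p, IsTopologicalAddGroup (W p)]
  [∀ p, ContinuousSMul ℝ (W p)] [FiberBundle ℂ W]
  [VectorBundle ℝ ℂ W] [VectorBundle ℂ ℂ W] [ContMDiffVectorBundle ∞ ℂ W 𝓘(ℝ, ℂ)]

namespace SurfaceReduction

variable (R : SurfaceReduction g o N W)

/-- The invariant frame of `M` determined by a unit frame `w` of `W` and a unit frame `X` of `TN`:
the vertical vector fields of `w` and `iw`, and the horizontal lifts of `X` and `iX`. -/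
def frame (w : Π p, W p) (X : Π p : N, TangentSpace 𝓘(ℝ, ℂ) p) :
    Fin 4 → Π x : M, TangentSpace (𝓡 4) x :=
  ![R.vert w, R.vert fun p => Complex.I • w p, R.lift X, R.lift fun p => Complex.I • X p]

/-- The projections to `N` of the members of the adapted frame. -/
def frameProj (X : Π p : N, TangentSpace 𝓘(ℝ, ℂ) p) : Fin 4 → Π p : N, TangentSpace 𝓘(ℝ, ℂ) p :=
  ![fun _ => 0, fun _ => 0, X, fun p => Complex.I • X p]

variable {w : Π p, W p} {X : Π p : N, TangentSpace 𝓘(ℝ, ℂ) p} {x : M}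

lemma dproj_frame (i : Fin 4) (y : M) :
    R.dproj y (R.frame w X i y) = frameProj X i (R.proj y) := by
  fin_cases i
  · exact R.dproj_ι y _
  · exact R.dproj_ι y _
  · exact R.dproj_hlift y _
  · exact R.dproj_hlift y _

lemma smoothSectionAt_frameProj {p : N} (hX : SmoothSectionAt 𝓘(ℝ, ℂ) ℂ X p) (i : Fin 4) :
    SmoothSectionAt 𝓘(ℝ, ℂ) ℂ (frameProj X i) p := by
  fin_cases i
  · exact smoothSectionAt_zero p
  · exact smoothSectionAt_zero p
  · exact hX
  · exact hX.I_smul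

lemma smooth_I_smul {p : N} (hw : SmoothSectionAt 𝓘(ℝ, ℂ) ℂ w p) :
    SmoothSectionAt 𝓘(ℝ, ℂ) ℂ (fun q => Complex.I • w q) p :=
  isComplexLineBundle_of_vectorBundle.smul_smooth p _ w contMDiffAt_const hw

lemma smoothSectionAt_frame (hw : SmoothSectionAt 𝓘(ℝ, ℂ) ℂ w (R.proj x))
    (hX : SmoothSectionAt 𝓘(ℝ, ℂ) ℂ X (R.proj x)) (i : Fin 4) :
    SmoothSectionAt (𝓡 4) E4 (R.frame w X i) x := by
  fin_cases i
  · exact R.ι_smooth x w hw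
  · exact R.ι_smooth x _ (smooth_I_smul hw)
  · exact R.smoothSectionAt_lift hX
  · exact R.smoothSectionAt_lift hX.I_smul

lemma mlieBracket_symmetry_frame {K : Π x : M, TangentSpace (𝓡 4) x} (hK : K ∈ R.𝔥)
    (hw : SmoothSectionAt 𝓘(ℝ, ℂ) ℂ w (R.proj x)) (hX : SmoothSectionAt 𝓘(ℝ, ℂ) ℂ X (R.proj x))
    (i : Fin 4) : mlieBracket (𝓡 4) K (R.frame w X i) x = 0 := by
  fin_cases i
  · change mlieBracket (𝓡 4) K (R.vert w) x = 0
    exact R.ι_invariant x w hw K hK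
  · change mlieBracket (𝓡 4) K (R.vert fun p => Complex.I • w p) x = 0
    exact R.ι_invariant x _ (smooth_I_smul hw) K hK
  · change mlieBracket (𝓡 4) K (R.lift X) x = 0
    exact R.mlieBracket_symmetry_lift hK hX
  · change mlieBracket (𝓡 4) K (R.lift fun p => Complex.I • X p) x = 0
    exact R.mlieBracket_symmetry_lift hK hX.I_smul

lemma inner_frame (hw : R.hW.form (R.proj x) (w (R.proj x)) (w (R.proj x)) = 1)
    (hX : R.hN.form (R.proj x) (X (R.proj x)) (X (R.proj x)) = 1) (i j : Fin 4) :
    g.inner x (R.frame w X i x) (R.frame w X j x) = if i = j then R.f x else 0 := by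
  fin_cases i <;> fin_cases j <;>
    simp [frame, vert, lift, inner_ι_ι, inner_hlift, inner_ι_hlift, dproj_ι, dproj_hlift, hw, hX]

lemma isConformalFrameAt_frame (hw : IsUnitFrameAt R.hW w (R.proj x))
    (hX : IsUnitFrameAt R.hN X (R.proj x)) : IsConformalFrameAt g R.f (R.frame w X) x := by
  filter_upwards [R.eventually_proj hw.eventually, R.eventually_proj hX.eventually] with y h1 h2
  exact ⟨R.f_pos y, R.contMDiffAt_f y, R.smoothSectionAt_frame h1.smooth h2.smooth,
    R.inner_frame h1.form_self h2.form_self⟩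

lemma orientation_frame (hw : w (R.proj x) ≠ 0) (hX : X (R.proj x) ≠ 0) :
    0 < o.form x fun i => R.frame w X i x := by
  have h1 : R.hlift x (X (R.proj x)) ≠ 0 := by
    intro h0
    have h2 := R.dproj_hlift x (X (R.proj x))
    rw [h0, map_zero] at h2
    exact hX h2.symm
  have h2 := R.orientation x (w (R.proj x)) (R.hlift x (X (R.proj x)))
    (R.hlift x (Complex.I • X (R.proj x))) hw h1 (R.isHorizontal_hlift x _) (R.isHorizontal_hlift x _)
    (by rw [R.dproj_hlift, R.dproj_hlift])
  convert h2 using 2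
  funext i
  fin_cases i <;> rfl

section StructureFunctions

variable (hw : IsUnitFrameAt R.hW w (R.proj x)) (hX : IsUnitFrameAt R.hN X (R.proj x))

include hw hX

/-- The structure functions of the adapted frame are constant along the orbits: by the Jacobi
identity, brackets of fields which commute with a symmetry commute with it. -/
lemma mvfderiv_structureFun_vertical (i j k : Fin 4) (v : W (R.proj x)) :
    mvfderiv (𝓡 4) (structureFun g R.f (R.frame w X) i j k) x (R.ι x v) = 0 := by
  obtain ⟨K, hK, hKx⟩ := R.exists_symmetry_eq (R.dproj_ι x v)
  have hE := R.isConformalFrameAt_frame hw hX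
  have hKs := (R.symmetry.conformal K hK).1 x
  have hKE : ∀ i, ∀ᶠ y in 𝓝 x, mlieBracket (𝓡 4) K (R.frame w X i) y = 0 := fun i => by
    filter_upwards [R.eventually_proj hw.eventually, R.eventually_proj hX.eventually] with y h1 h2
    exact R.mlieBracket_symmetry_frame hK h1.smooth h2.smooth i
  have h1 := mlieBracket_jacobi hKs (hE.smooth i) (hE.smooth j)
  rw [mlieBracket_congr_of_eventuallyEq (hKE i) (Filter.Eventually.of_forall fun _ => rfl),
    mlieBracket_congr_of_eventuallyEq (Filter.Eventually.of_forall fun _ => rfl) (hKE j),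
    mlieBracket_congr_of_eventuallyEq (X := K) (Filter.Eventually.of_forall fun _ => rfl)
      (hE.eventually.mono fun y hy => hy.mlieBracket_eq i j),
    mlieBracket_fun_sum_right _ fun k =>
      SmoothSectionAt.smul (hE.contMDiffAt_structureFun i j k) (hE.smooth k)] at h1
  have h2 : mlieBracket (𝓡 4) (fun _ => (0 : TangentSpace (𝓡 4) _)) (R.frame w X j) x = 0 :=
    congrFun (mlieBracket_zero_left (I := 𝓡 4) (W := R.frame w X j)) x
  have h3 : mlieBracket (𝓡 4) (R.frame w X i) (fun _ => (0 : TangentSpace (𝓡 4) _)) x = 0 :=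
    congrFun (mlieBracket_zero_right (I := 𝓡 4) (W := R.frame w X i)) x
  simp only [mlieBracket_fun_smul_right (hE.contMDiffAt_structureFun i j _) (hE.smooth _),
    (hKE _).self_of_nhds, smul_zero, add_zero, h2, h3, hKx] at h1
  have h4 := congrArg (fun u => g.inner x u (R.frame w X k x)) h1
  simp only [hE.inner_sum, map_zero, zero_apply] at h4
  exact (mul_eq_zero.1 h4).resolve_left hE.pos.ne'

lemma dproj_mlieBracket_frame (i j : Fin 4) :
    R.dproj x (mlieBracket (𝓡 4) (R.frame w X i) (R.frame w X j) x)
      = mlieBracket 𝓘(ℝ, ℂ) (frameProj X i) (frameProj X j) (R.proj x) :=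
  R.dproj_mlieBracket (R.smoothSectionAt_frame hw.smooth hX.smooth i)
    (R.smoothSectionAt_frame hw.smooth hX.smooth j) (smoothSectionAt_frameProj hX.smooth i)
    (smoothSectionAt_frameProj hX.smooth j) (Filter.Eventually.of_forall (R.dproj_frame i))
    (Filter.Eventually.of_forall (R.dproj_frame j))

/-- The horizontal components of brackets of the adapted frame are those of the brackets of the
projections. -/
lemma structureFun_lift (i j : Fin 4) (X' : Π p : N, TangentSpace 𝓘(ℝ, ℂ) p) :
    g.inner x (mlieBracket (𝓡 4) (R.frame w X i) (R.frame w X j) x) (R.lift X' x) / R.f x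
      = (R.hN.form (R.proj x) (X' (R.proj x))
          (mlieBracket 𝓘(ℝ, ℂ) (frameProj X i) (frameProj X j) (R.proj x))).re := by
  rw [g.symm, lift, R.inner_hlift, R.dproj_mlieBracket_frame hw hX,
    mul_div_cancel_left₀ _ (R.f_pos x).ne']

/-- Brackets with an invariant vertical vector field are vertical. -/
lemma structureFun_vertical_left (i j k : Fin 4) (hi : i < 2) (hk : 2 ≤ k) :
    structureFun g R.f (R.frame w X) i j k x = 0 := by
  have h0 : frameProj X i = fun _ => 0 := by
    fin_cases i
    · rfl
    · rfl
    · exact absurd hi (by decide)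
    · exact absurd hi (by decide)
  have h1 : mlieBracket 𝓘(ℝ, ℂ) (frameProj X i) (frameProj X j) (R.proj x) = 0 := by
    rw [h0]
    exact congrFun (mlieBracket_zero_left (I := 𝓘(ℝ, ℂ)) (W := frameProj X j)) (R.proj x)
  fin_cases k
  · exact absurd hk (by decide)
  · exact absurd hk (by decide)
  · refine (R.structureFun_lift hw hX i j X).trans ?_
    rw [h1]; simp
  · refine (R.structureFun_lift hw hX i j fun p => Complex.I • X p).trans ?_
    rw [h1]; simp

lemma structureFun_two_three_two :
    structureFun g R.f (R.frame w X) 2 3 2 x = (frameBracket R.hN X (R.proj x)).re :=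
  R.structureFun_lift hw hX 2 3 X

lemma structureFun_two_three_three :
    structureFun g R.f (R.frame w X) 2 3 3 x = (frameBracket R.hN X (R.proj x)).im := by
  refine (R.structureFun_lift hw hX 2 3 fun p => Complex.I • X p).trans ?_
  rw [map_smulₛₗ]
  simp only [Complex.conj_I, LinearMap.smul_apply, smul_eq_mul]
  change (-Complex.I * frameBracket R.hN X (R.proj x)).re = _
  simp

end StructureFunctions

end SurfaceReduction

/-- The component `⟨X, C(w, w)⟩` of `C` in unit frames `w` of `W` and `X` of `TN`. -/
def SpinorVortexData.frameC (S : SpinorVortexData W)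
    (hN : HermitianMetric (fun p : N => TangentSpace 𝓘(ℝ, ℂ) p)) (w : Π p, W p)
    (X : Π p : N, TangentSpace 𝓘(ℝ, ℂ) p) (p : N) : ℂ :=
  hN.form p (X p) (S.C p (w p) (w p))

namespace SurfaceReduction.Defines

variable {R : SurfaceReduction g o N W} {S : SpinorVortexData W} (hS : R.Defines S)
  {w : Π p, W p} {X : Π p : N, TangentSpace 𝓘(ℝ, ℂ) p} {x : M}
  (hw : IsUnitFrameAt R.hW w (R.proj x)) (hX : IsUnitFrameAt R.hN X (R.proj x))

include hS hw hX

/-- The equation defining `C` and `∂̄`, for a section `U` with value `a w` at the point and paired with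
`V = c w`. -/
lemma C_frame (U : Π p, W p) (hU : SmoothSectionAt 𝓘(ℝ, ℂ) ℂ U (R.proj x)) (V : W (R.proj x))
    (a c : ℂ) (ha : U (R.proj x) = a • w (R.proj x)) (hc : V = c • w (R.proj x)) :
    (g.inner x (mlieBracket (𝓡 4) (R.lift X) (R.vert U) x) (R.ι x V)
      + g.inner x (mlieBracket (𝓡 4) (R.lift fun p => Complex.I • X p)
          (R.vert fun p => Complex.I • U p) x) (R.ι x V)) / R.f x
      = (2 * R.hW.form (R.proj x) (S.dbar.op U (R.proj x) (X (R.proj x))) V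
          + 2 * (a * c * S.frameC R.hN w X (R.proj x))).re := by
  have h1 := hS.C_eq x U X _ _ V hU hX.smooth (R.isHorizontalLift_lift X)
    (R.isHorizontalLift_lift fun p => Complex.I • X p)
  have hγ : S.C (R.proj x) (w (R.proj x)) (w (R.proj x))
      = S.frameC R.hN w X (R.proj x) • X (R.proj x) :=
    hX.eq_smul isComplexLineBundle_tangent _
  rw [map_sub, map_add, sub_apply, add_apply, R.inner_ι_ι, ha, hc] at h1
  rw [div_eq_iff (R.f_pos x).ne', hc]
  simp only [map_smul, LinearMap.smul_apply, hγ, map_smulₛₗ, smul_eq_mul, hX.form_self,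
    Complex.conj_I] at h1 ⊢
  generalize S.frameC R.hN w X (R.proj x) = γ at *
  generalize R.hW.form (R.proj x) (S.dbar.op U (R.proj x) (X (R.proj x))) (w (R.proj x)) = b at *
  rw [eq_add_of_sub_eq h1]
  simp
  ring

lemma dbar_frame : S.dbar.op w (R.proj x) (X (R.proj x))
    = (S.dbar.connForm R.hW w (R.proj x) (X (R.proj x))) • w (R.proj x) :=
  hw.eq_smul isComplexLineBundle_of_vectorBundle _

lemma structureFun_C_zero :
    structureFun g R.f (R.frame w X) 2 0 0 x + structureFun g R.f (R.frame w X) 3 1 0 x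
      = 2 * (S.dbar.connForm R.hW w (R.proj x) (X (R.proj x))).re
        + 2 * (S.frameC R.hN w X (R.proj x)).re := by
  have h := hS.C_frame hw hX w hw.smooth (w (R.proj x)) 1 1 (one_smul ..).symm (one_smul ..).symm
  rw [hS.dbar_frame hw hX, LinearMap.map_smulₛₗ (R.hW.form (R.proj x)), LinearMap.smul_apply,
    hw.form_self, add_div] at h
  refine Eq.trans h ?_
  simp

lemma structureFun_C_one :
    structureFun g R.f (R.frame w X) 2 0 1 x + structureFun g R.f (R.frame w X) 3 1 1 x
      = 2 * (S.dbar.connForm R.hW w (R.proj x) (X (R.proj x))).im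
        - 2 * (S.frameC R.hN w X (R.proj x)).im := by
  have h := hS.C_frame hw hX w hw.smooth (Complex.I • w (R.proj x)) 1 Complex.I
    (one_smul ..).symm rfl
  rw [hS.dbar_frame hw hX, LinearMap.map_smulₛₗ (R.hW.form (R.proj x)), LinearMap.smul_apply,
    LinearMap.map_smul (R.hW.form (R.proj x) (w (R.proj x))), hw.form_self, add_div] at h
  refine Eq.trans h ?_
  simp
  ring

/-- The equation defining `C` and `∂̄`, for the section `i w` and paired with `V = k w`. -/
lemma C_frame_I (V : W (R.proj x)) (k : ℂ) (hc : V = k • w (R.proj x)) :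
    (g.inner x (mlieBracket (𝓡 4) (R.frame w X 2) (R.frame w X 1) x) (R.ι x V)
      - g.inner x (mlieBracket (𝓡 4) (R.frame w X 3) (R.frame w X 0) x) (R.ι x V)) / R.f x
      = (-2 * Complex.I * starRingEnd ℂ (S.dbar.connForm R.hW w (R.proj x) (X (R.proj x))) * k
          + 2 * (Complex.I * k * (S.frameC R.hN w X (R.proj x)))).re := by
  have h := hS.C_frame hw hX _ (smooth_I_smul hw.smooth) V Complex.I k rfl hc
  have h1 : (R.vert fun p => Complex.I • (Complex.I • w p)) = fun y => (-1 : ℝ) • R.frame w X 0 y := by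
    funext y
    change R.ι y (Complex.I • (Complex.I • w (R.proj y))) = (-1 : ℝ) • R.ι y (w (R.proj y))
    rw [smul_smul, Complex.I_mul_I, neg_one_smul, neg_one_smul, map_neg]
  have h2 : S.dbar.op (fun p => Complex.I • w p) (R.proj x) (X (R.proj x))
      = (Complex.I * (S.dbar.connForm R.hW w (R.proj x) (X (R.proj x)))) • w (R.proj x) := by
    have h3 : dbarFun (fun _ : N => Complex.I) (R.proj x) (X (R.proj x)) = 0 := by
      simp [dbarFun, mvfderiv_const]
    rw [S.dbar.leibniz (fun _ => Complex.I) w _ _ contMDiffAt_const hw.smooth, h3,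
      hS.dbar_frame hw hX, zero_smul, add_zero, smul_smul]
  have h4 := mlieBracket_fun_smul_right (X := R.lift fun p => Complex.I • X p) (x := x)
    (f := fun _ => (-1 : ℝ)) contMDiffAt_const (R.smoothSectionAt_frame hw.smooth hX.smooth 0)
  rw [h1, h4, mvfderiv_const, zero_apply, zero_smul, zero_add, neg_one_smul, map_neg, neg_apply,
    ← sub_eq_add_neg, h2, hc, LinearMap.map_smulₛₗ (R.hW.form (R.proj x)), LinearMap.smul_apply,
    LinearMap.map_smul (R.hW.form (R.proj x) (w (R.proj x))), hw.form_self] at h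
  rw [hc]
  refine Eq.trans h ?_
  simp
  ring

lemma structureFun_C_I_zero :
    structureFun g R.f (R.frame w X) 2 1 0 x - structureFun g R.f (R.frame w X) 3 0 0 x
      = -2 * (S.dbar.connForm R.hW w (R.proj x) (X (R.proj x))).im
        - 2 * (S.frameC R.hN w X (R.proj x)).im := by
  have h := hS.C_frame_I hw hX (w (R.proj x)) 1 (one_smul ..).symm
  rw [sub_div] at h
  refine Eq.trans h ?_
  simp
  ring

lemma structureFun_C_I_one :
    structureFun g R.f (R.frame w X) 2 1 1 x - structureFun g R.f (R.frame w X) 3 0 1 x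
      = 2 * (S.dbar.connForm R.hW w (R.proj x) (X (R.proj x))).re
        - 2 * (S.frameC R.hN w X (R.proj x)).re := by
  have h := hS.C_frame_I hw hX (Complex.I • w (R.proj x)) Complex.I rfl
  rw [sub_div] at h
  refine Eq.trans h ?_
  simp
  ring

lemma isDualVector_frame :
    IsDualVector R.hW (R.proj x) (S.ψ (R.proj x))
      (starRingEnd ℂ (S.ψ (R.proj x) (w (R.proj x))) • w (R.proj x)) := by
  intro u
  rw [hw.eq_smul isComplexLineBundle_of_vectorBundle u]
  simp [hw.form_self, mul_comm]

/-- The equation defining `ψ`, for the section `w` and paired with `V = k w`. -/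
lemma psi_frame (V : W (R.proj x)) (k : ℂ) (hc : V = k • w (R.proj x)) :
    (g.inner x (mlieBracket (𝓡 4) (R.frame w X 0) (R.frame w X 1) x) (R.ι x V)
      - g.inner x (mlieBracket (𝓡 4) (R.frame w X 2) (R.frame w X 3) x) (R.ι x V)) / R.f x
      = (-2 * Complex.I * S.ψ (R.proj x) (w (R.proj x)) * k).re := by
  have h := hS.psi_eq x w X _ _ _ hw.smooth hX.smooth (R.isHorizontalLift_lift X)
    (R.isHorizontalLift_lift fun p => Complex.I • X p) (by rw [hw.form_self, hX.form_self])
    (hS.isDualVector_frame hw hX)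
  have h1 := R.isHorizontal_iff.1 h V
  rw [g.symm, map_sub, map_add, map_neg, sub_apply, add_apply, neg_apply, R.inner_ι_ι, hX.form_self,
    hc] at h1
  simp only [map_smul, LinearMap.smul_apply, map_smulₛₗ, smul_eq_mul, hw.form_self,
    Complex.conj_I, map_mul, Complex.conj_conj] at h1
  rw [div_eq_iff (R.f_pos x).ne', hc]
  refine Eq.trans ?_ ((eq_of_sub_eq_zero h1).trans ?_)
  · exact sub_eq_neg_add _ _
  · simp
    ring

lemma structureFun_psi_zero :
    structureFun g R.f (R.frame w X) 0 1 0 x - structureFun g R.f (R.frame w X) 2 3 0 x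
      = 2 * (S.ψ (R.proj x) (w (R.proj x))).im := by
  have h := hS.psi_frame hw hX (w (R.proj x)) 1 (one_smul ..).symm
  rw [sub_div] at h
  refine Eq.trans h ?_
  simp

lemma structureFun_psi_one :
    structureFun g R.f (R.frame w X) 0 1 1 x - structureFun g R.f (R.frame w X) 2 3 1 x
      = 2 * (S.ψ (R.proj x) (w (R.proj x))).re := by
  have h := hS.psi_frame hw hX (Complex.I • w (R.proj x)) Complex.I rfl
  rw [sub_div] at h
  refine Eq.trans h ?_
  simp

end SurfaceReduction.Defines

end AdaptedFrames

/-! ### The curvature of a reduced frame -/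

section FrameAlgebra

/-- The Levi-Civita connection coefficients of a conformal frame, in terms of the structure functions
`c` and the logarithmic derivatives `θ` of the conformal factor. -/
def connCoeff (c : Fin 4 → Fin 4 → Fin 4 → ℝ) (θ : Fin 4 → ℝ) (i j k : Fin 4) : ℝ :=
  (c i j k - c i k j - c j k i) / 2 + θ i * (if j = k then 1 else 0)
    + θ j * (if i = k then 1 else 0) - θ k * (if i = j then 1 else 0)

/-- The components `⟨R(Eᵢ, Eⱼ) Eₖ, Eₗ⟩` of the Riemann tensor of a conformal frame `E`, divided by
the conformal factor; `dc l` and `dθ l` are the derivatives of `c` and `θ` along `Eₗ`. Here `dc` and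
`dθ` are independent variables, as `connCoeff` is linear in `c` and `θ`. -/
def frameRiemann (c : Fin 4 → Fin 4 → Fin 4 → ℝ) (dc : Fin 4 → Fin 4 → Fin 4 → Fin 4 → ℝ)
    (θ : Fin 4 → ℝ) (dθ : Fin 4 → Fin 4 → ℝ) (i j k l : Fin 4) : ℝ :=
  connCoeff (dc i) (dθ i) j k l - connCoeff (dc j) (dθ j) i k l
    + ∑ m, (connCoeff c θ j k m * connCoeff c θ i m l - connCoeff c θ i k m * connCoeff c θ j m l
      - c i j m * connCoeff c θ m k l)

/-- First terms of the antiselfdual bivectors `e₀ ∧ e₁ - e₂ ∧ e₃`, `e₀ ∧ e₂ - e₃ ∧ e₁`,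
`e₀ ∧ e₃ - e₁ ∧ e₂`. -/
def asdFst : Fin 3 → Fin 4 × Fin 4 := ![(0, 1), (0, 2), (0, 3)]

/-- Second terms of the antiselfdual bivectors `e₀ ∧ e₁ - e₂ ∧ e₃`, `e₀ ∧ e₂ - e₃ ∧ e₁`,
`e₀ ∧ e₃ - e₁ ∧ e₂`. -/
def asdSnd : Fin 3 → Fin 4 × Fin 4 := ![(2, 3), (3, 1), (1, 2)]

/-- The value of a 4-tensor on a pair of the antiselfdual basis bivectors. -/
def asdForm (T : Fin 4 → Fin 4 → Fin 4 → Fin 4 → ℝ) (a b : Fin 3) : ℝ :=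
  T (asdFst a).1 (asdFst a).2 (asdFst b).1 (asdFst b).2
    - T (asdFst a).1 (asdFst a).2 (asdSnd b).1 (asdSnd b).2
    - T (asdSnd a).1 (asdSnd a).2 (asdFst b).1 (asdFst b).2
    + T (asdSnd a).1 (asdSnd a).2 (asdSnd b).1 (asdSnd b).2

/-- The structure functions `c` (with derivatives `dc`) and the logarithmic derivatives `θ` (with
derivatives `dθ`) of the conformal factor of an invariant frame: the first two members of the frame
are vertical, and `c` is constant along them. No invariance of the conformal factor is assumed. -/
structure IsInvariantFrame (c : Fin 4 → Fin 4 → Fin 4 → ℝ)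
    (dc : Fin 4 → Fin 4 → Fin 4 → Fin 4 → ℝ) (θ : Fin 4 → ℝ) (dθ : Fin 4 → Fin 4 → ℝ) : Prop where
  skew : ∀ i j k, c i j k = -c j i k
  dskew : ∀ l i j k, dc l i j k = -dc l j i k
  vert : ∀ i j k, i < 2 → 2 ≤ k → c i j k = 0
  dvert : ∀ l i j k, i < 2 → 2 ≤ k → dc l i j k = 0
  inv : ∀ l i j k, l < 2 → dc l i j k = 0
  jacobi : ∀ i j k l, (dc i j k l + ∑ m, c j k m * c i m l) + (dc j k i l + ∑ m, c k i m * c j m l)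
    + (dc k i j l + ∑ m, c i j m * c k m l) = 0
  comm : ∀ i j, dθ i j - dθ j i = ∑ k, c i j k * θ k

namespace IsInvariantFrame

variable {c : Fin 4 → Fin 4 → Fin 4 → ℝ} {dc : Fin 4 → Fin 4 → Fin 4 → Fin 4 → ℝ}
  {θ : Fin 4 → ℝ} {dθ : Fin 4 → Fin 4 → ℝ} (h : IsInvariantFrame c dc θ dθ)

include h

lemma self (i k : Fin 4) : c i i k = 0 := by linarith [h.skew i i k]

lemma dself (l i k : Fin 4) : dc l i i k = 0 := by linarith [h.dskew l i i k]

lemma vert' (i j k : Fin 4) (hi : i < 2) (hk : 2 ≤ k) : c j i k = 0 := by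
  rw [h.skew, h.vert i j k hi hk, neg_zero]

lemma dvert' (l i j k : Fin 4) (hi : i < 2) (hk : 2 ≤ k) : dc l j i k = 0 := by
  rw [h.dskew, h.dvert l i j k hi hk, neg_zero]

end IsInvariantFrame

/-- The structure functions of an invariant frame whose first two members are the vertical fields of
`w`, `iw` and whose last two members are the horizontal lifts of `X`, `iX`, in terms of the components
`β` of the holomorphic structure, `γ` of the tensor `C` and `τ` of `ψ`. -/
structure IsReducedFrame (c : Fin 4 → Fin 4 → Fin 4 → ℝ)
    (dc : Fin 4 → Fin 4 → Fin 4 → Fin 4 → ℝ) (θ : Fin 4 → ℝ) (dθ : Fin 4 → Fin 4 → ℝ)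
    (β γ τ : ℂ) (dβ dγ dτ : Fin 4 → ℂ) : Prop extends IsInvariantFrame c dc θ dθ where
  C_zero : c 2 0 0 + c 3 1 0 = 2 * β.re + 2 * γ.re
  C_one : c 2 0 1 + c 3 1 1 = 2 * β.im - 2 * γ.im
  C_I_zero : c 2 1 0 - c 3 0 0 = -2 * β.im - 2 * γ.im
  C_I_one : c 2 1 1 - c 3 0 1 = 2 * β.re - 2 * γ.re
  psi_zero : c 0 1 0 - c 2 3 0 = 2 * τ.im
  psi_one : c 0 1 1 - c 2 3 1 = 2 * τ.re
  dC_zero : ∀ l, dc l 2 0 0 + dc l 3 1 0 = 2 * (dβ l).re + 2 * (dγ l).re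
  dC_one : ∀ l, dc l 2 0 1 + dc l 3 1 1 = 2 * (dβ l).im - 2 * (dγ l).im
  dC_I_zero : ∀ l, dc l 2 1 0 - dc l 3 0 0 = -2 * (dβ l).im - 2 * (dγ l).im
  dC_I_one : ∀ l, dc l 2 1 1 - dc l 3 0 1 = 2 * (dβ l).re - 2 * (dγ l).re
  dpsi_zero : ∀ l, dc l 0 1 0 - dc l 2 3 0 = 2 * (dτ l).im
  dpsi_one : ∀ l, dc l 0 1 1 - dc l 2 3 1 = 2 * (dτ l).re

namespace IsReducedFrame

variable {c : Fin 4 → Fin 4 → Fin 4 → ℝ} {dc : Fin 4 → Fin 4 → Fin 4 → Fin 4 → ℝ}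
  {θ : Fin 4 → ℝ} {dθ : Fin 4 → Fin 4 → ℝ} {β γ τ : ℂ} {dβ dγ dτ : Fin 4 → ℂ}
  (h : IsReducedFrame c dc θ dθ β γ τ dβ dγ dτ)

include h

set_option linter.unusedSimpArgs false in
/-- The components of the Riemann tensor on antiselfdual bivectors, up to multiples of the identity,
in terms of the components of the spinor-vortex data and their derivatives. Structure functions and
derivatives not determined by these data cancel by the Jacobi identities. -/
theorem asdForm_frameRiemann :
    asdForm (frameRiemann c dc θ dθ) 0 1 = (dτ 2).im + (dτ 3).re
      - 2 * (β.re * τ.im + β.im * τ.re) + 6 * (τ.re * γ.im - τ.im * γ.re) ∧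
    asdForm (frameRiemann c dc θ dθ) 0 2 = -((dτ 2).re - (dτ 3).im
      - 2 * (β.re * τ.re - β.im * τ.im) + 6 * (τ.re * γ.re + τ.im * γ.im)) ∧
    asdForm (frameRiemann c dc θ dθ) 1 2 = -4 * (((dγ 2).im + (dγ 3).re) / 2
      + (γ.im * c 2 3 3 - γ.re * c 2 3 2) / 2 - 2 * (β.re * γ.im + β.im * γ.re)) ∧
    asdForm (frameRiemann c dc θ dθ) 1 1 - asdForm (frameRiemann c dc θ dθ) 2 2 =
      -8 * (((dγ 2).re - (dγ 3).im) / 2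
      + (γ.re * c 2 3 3 + γ.im * c 2 3 2) / 2 - 2 * (β.re * γ.re - β.im * γ.im)) ∧
    2 * asdForm (frameRiemann c dc θ dθ) 0 0 - asdForm (frameRiemann c dc θ dθ) 1 1
        - asdForm (frameRiemann c dc θ dθ) 2 2 =
      -2 * (dc 2 2 3 3 - dc 3 2 3 2 - c 2 3 2 ^ 2 - c 2 3 3 ^ 2
        - (2 * (dβ 2).re + 2 * (dβ 3).im + 2 * c 2 3 2 * β.im - 2 * c 2 3 3 * β.re)
        - 4 * (τ.re ^ 2 + τ.im ^ 2) + 8 * (γ.re ^ 2 + γ.im ^ 2)) := by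
  have l0 : (0 : Fin 4) < 2 := by decide
  have l1 : (1 : Fin 4) < 2 := by decide
  have l2 : (2 : Fin 4) ≤ 2 := by decide
  have l3 : (2 : Fin 4) ≤ 3 := by decide
  have r1 : c 3 1 0 = _ := eq_sub_of_add_eq' h.C_zero
  have r2 : c 3 1 1 = _ := eq_sub_of_add_eq' h.C_one
  have r3 : c 3 0 0 = c 2 1 0 + 2 * β.im + 2 * γ.im := by linarith [h.C_I_zero]
  have r4 : c 3 0 1 = c 2 1 1 - 2 * β.re + 2 * γ.re := by linarith [h.C_I_one]
  have r5 : c 2 3 0 = c 0 1 0 - 2 * τ.im := by linarith [h.psi_zero]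
  have r6 : c 2 3 1 = c 0 1 1 - 2 * τ.re := by linarith [h.psi_one]
  have comm := h.comm
  have jac := h.jacobi
  simp only [Fin.sum_univ_four] at comm jac
  have t1 := comm 0 1
  have t2 := comm 0 2
  have t3 := comm 0 3
  have t4 := comm 1 2
  have t5 := comm 1 3
  have t6 := comm 2 3
  have j1 := jac 0 1 2 0
  have j2 := jac 0 1 2 1
  have j3 := jac 0 1 3 0
  have j4 := jac 0 1 3 1
  have j5 := jac 0 2 3 0
  have j8 := jac 1 2 3 1
  have a1 := h.dC_zero 2
  have a2 := h.dC_one 2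
  have a3 := h.dC_I_zero 2
  have a4 := h.dC_I_one 2
  have a5 := h.dpsi_zero 2
  have a6 := h.dpsi_one 2
  have b1 := h.dC_zero 3
  have b2 := h.dC_one 3
  have b3 := h.dC_I_zero 3
  have b4 := h.dC_I_one 3
  have b5 := h.dpsi_zero 3
  have b6 := h.dpsi_one 3
  simp only [asdForm, frameRiemann, asdFst, asdSnd, Matrix.cons_val, connCoeff,
    Fin.sum_univ_four, Fin.reduceEq, if_true, if_false, h.self, h.dself, h.inv _ _ _ _ l0,
    h.inv _ _ _ _ l1, h.vert _ _ _ l0 l2, h.vert _ _ _ l0 l3, h.vert _ _ _ l1 l2,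
    h.vert _ _ _ l1 l3, h.dvert _ _ _ _ l0 l2, h.dvert _ _ _ _ l0 l3, h.dvert _ _ _ _ l1 l2,
    h.dvert _ _ _ _ l1 l3, h.vert' _ _ _ l0 l2, h.vert' _ _ _ l0 l3, h.vert' _ _ _ l1 l2,
    h.vert' _ _ _ l1 l3, h.dvert' _ _ _ _ l0 l2, h.dvert' _ _ _ _ l0 l3, h.dvert' _ _ _ _ l1 l2,
    h.dvert' _ _ _ _ l1 l3, h.skew 1 0, h.skew 0 2, h.skew 0 3, h.skew 1 2, h.skew 1 3,
    h.skew 3 2, h.dskew _ 1 0, h.dskew _ 0 2, h.dskew _ 0 3, h.dskew _ 1 2, h.dskew _ 1 3,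
    h.dskew _ 3 2, r1, r2, r3, r4, r5, r6] at *
  -- after substitution of the relations, the identities are linear combinations of the commutation
  -- relations `t` for `θ`, the Jacobi identities `j`, and the differentiated relations `a`, `b`
  clear r1 r2 r3 r4 r5 r6 comm jac
  refine ⟨?_, ?_, ?_, ?_, ?_⟩
  · linear_combination t4 - t3 - j1 / 2 - j4 / 2 + a5 / 2 + b6 / 2
  · linear_combination t2 + t5 + j2 / 2 - j3 / 2 - a6 / 2 + b5 / 2
  · linear_combination t6 - t1 - j5 / 2 - j8 / 2 + a2 / 2 + a3 / 2 - b1 / 2 + b4 / 2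
  · linear_combination a4 - a1 - b2 - b3
  · linear_combination a1 + a4 + b2 - b3

end IsReducedFrame

end FrameAlgebra

/-! ### Algebraic Weyl tensors -/

section WeylAlgebra

/-- The algebraic Weyl part of a 4-tensor in an orthonormal frame. -/
def weylPart (T : Fin 4 → Fin 4 → Fin 4 → Fin 4 → ℝ) (i j k l : Fin 4) : ℝ :=
  let ric := fun j k => ∑ i, T i j k i
  let sch := fun j k => (ric j k - (∑ j, ric j j) / 6 * (if j = k then 1 else 0)) / 2
  T i j k l - (sch j k * (if i = l then 1 else 0) + sch i l * (if j = k then 1 else 0)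
    - sch i k * (if j = l then 1 else 0) - sch j l * (if i = k then 1 else 0))

/-- The components of a tensor with the algebraic symmetries of a Riemann tensor. -/
structure IsRiemannLike (T : Fin 4 → Fin 4 → Fin 4 → Fin 4 → ℝ) : Prop where
  swap_left : ∀ i j k l, T i j k l = -T j i k l
  swap_right : ∀ i j k l, T i j k l = -T i j l k
  bianchi : ∀ i j k l, T i j k l + T j k i l + T k i j l = 0

namespace IsRiemannLike

variable {T : Fin 4 → Fin 4 → Fin 4 → Fin 4 → ℝ} (h : IsRiemannLike T)

include h

/-- The pair symmetry of a Riemann tensor, a consequence of the other symmetries. -/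
lemma pair_symm (i j k l : Fin 4) : T i j k l = T k l i j := by
  have b1 := h.bianchi i j k l
  have b2 := h.bianchi j k l i
  have b3 := h.bianchi k l i j
  have b4 := h.bianchi l i j k
  linarith [h.swap_left i j k l, h.swap_left j k i l, h.swap_left k i j l, h.swap_left k l i j,
    h.swap_right i j k l, h.swap_right j k i l, h.swap_right k i j l, h.swap_right k l i j,
    h.swap_right i j l k, h.swap_left j k l i, h.swap_right j k l i, h.swap_left k l j i,
    h.swap_right k l j i, h.swap_left l j k i, h.swap_right l j k i, h.swap_left l i k j,
    h.swap_right l i k j, h.swap_left i k l j, h.swap_right i k l j, h.swap_left i j l k,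
    h.swap_left j l i k, h.swap_right j l i k, h.swap_left l i j k,
    h.swap_right l i j k]

lemma asdForm_symm (a b : Fin 3) : asdForm T a b = asdForm T b a := by
  simp only [asdForm, h.pair_symm (asdFst b).1, h.pair_symm (asdSnd b).1]
  ring

lemma self_left (i k l : Fin 4) : T i i k l = 0 := by linarith [h.swap_left i i k l]

lemma self_right (i j k : Fin 4) : T i j k k = 0 := by linarith [h.swap_right i j k k]

set_option linter.unusedSimpArgs false in
/-- The Weyl part vanishes on the bivector `e₀ ∧ e₁ - e₂ ∧ e₃` if and only if this is an eigenvector of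
the curvature on antiselfdual bivectors, with eigenvalue the mean eigenvalue. -/
lemma weylPart_eq_iff : (∀ k l, weylPart T 0 1 k l = weylPart T 2 3 k l) ↔
    asdForm T 0 1 = 0 ∧ asdForm T 0 2 = 0 ∧ 2 * asdForm T 0 0 = asdForm T 1 1 + asdForm T 2 2 := by
  have p := h.pair_symm
  -- the Bianchi identity is needed for the traces
  have b : T 0 1 2 3 + T 0 3 1 2 - T 0 2 1 3 = 0 := by
    linarith [h.bianchi 0 1 2 3, p 1 2 0 3, h.swap_left 2 0 1 3]
  constructor
  · intro hw
    have w1 := hw 0 1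
    have w3 := hw 0 2
    have w5 := hw 0 3
    simp only [weylPart, asdForm, asdFst, asdSnd, Matrix.cons_val, Fin.sum_univ_four,
      Fin.reduceEq, if_true, if_false, h.self_left, h.self_right, h.swap_left 1 0, h.swap_left 2 0,
      h.swap_left 3 0, h.swap_left 2 1, h.swap_left 3 1, h.swap_left 3 2, h.swap_right _ _ 1 0,
      h.swap_right _ _ 2 0, h.swap_right _ _ 3 0, h.swap_right _ _ 2 1, h.swap_right _ _ 3 1,
      h.swap_right _ _ 3 2,
      p 0 2 0 1, p 0 3 0 1, p 1 2 0 1, p 1 3 0 1, p 2 3 0 1, p 0 3 0 2, p 1 2 0 2, p 1 3 0 2,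
      p 2 3 0 2, p 1 2 0 3, p 1 3 0 3, p 2 3 0 3, p 1 3 1 2, p 2 3 1 2, p 2 3 1 3] at w1 w3 w5 ⊢
    exact ⟨by linear_combination 2 * w3, by linear_combination 2 * w5,
      by linear_combination 6 * w1 + 2 * b⟩
  · rintro ⟨w1, w2, w3⟩
    simp only [Fin.forall_fin_succ, IsEmpty.forall_iff, and_true, Fin.succ_zero_eq_one,
      Fin.succ_one_eq_two, Fin.reduceSucc]
    simp only [weylPart, asdForm, asdFst, asdSnd, Matrix.cons_val, Fin.sum_univ_four,
      Fin.reduceEq, if_true, if_false, h.self_left, h.self_right, h.swap_left 1 0, h.swap_left 2 0,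
      h.swap_left 3 0, h.swap_left 2 1, h.swap_left 3 1, h.swap_left 3 2, h.swap_right _ _ 1 0,
      h.swap_right _ _ 2 0, h.swap_right _ _ 3 0, h.swap_right _ _ 2 1, h.swap_right _ _ 3 1,
      h.swap_right _ _ 3 2,
      p 0 2 0 1, p 0 3 0 1, p 1 2 0 1, p 1 3 0 1, p 2 3 0 1, p 0 3 0 2, p 1 2 0 2, p 1 3 0 2,
      p 2 3 0 2, p 1 2 0 3, p 1 3 0 3, p 2 3 0 3, p 1 3 1 2, p 2 3 1 2, p 2 3 1 3] at w1 w2 w3 ⊢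
    and_intros
    · ring
    · linear_combination w3 / 6 - b / 3
    · linear_combination w1 / 2
    · linear_combination w2 / 2
    · linear_combination b / 3 - w3 / 6
    · ring
    · linear_combination -w2 / 2
    · linear_combination w1 / 2
    · linear_combination -w1 / 2
    · linear_combination w2 / 2
    · ring
    · linear_combination b / 3 - w3 / 6
    · linear_combination -w2 / 2
    · linear_combination -w1 / 2
    · linear_combination w3 / 6 - b / 3
    · ring

end IsRiemannLike

set_option linter.unusedSimpArgs false in
/-- The antiselfdual values of the curvature-like tensor of curvature one. -/
lemma asdForm_identity (a b : Fin 3) :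
    asdForm (fun i j k l => (if i = l then 1 else 0) * (if j = k then 1 else 0)
      - (if i = k then 1 else 0) * (if j = l then 1 else 0)) a b = if a = b then -2 else 0 := by
  fin_cases a <;> fin_cases b <;> simp +decide [asdForm, asdFst, asdSnd] <;> norm_num

/-- Complementary minors of a rotation matrix agree: a rotation commutes with the Hodge star operator
on bivectors. -/
lemma Matrix.minor_eq_of_orthogonal {Q : Matrix (Fin 4) (Fin 4) ℝ} (hQ : Q * Q.transpose = 1)
    (hd : Q.det = 1) :
    (Q 0 0 * Q 1 1 - Q 0 1 * Q 1 0 = Q 2 2 * Q 3 3 - Q 2 3 * Q 3 2) ∧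
    (Q 0 0 * Q 1 2 - Q 0 2 * Q 1 0 = Q 2 3 * Q 3 1 - Q 2 1 * Q 3 3) ∧
    (Q 0 0 * Q 1 3 - Q 0 3 * Q 1 0 = Q 2 1 * Q 3 2 - Q 2 2 * Q 3 1) ∧
    (Q 0 1 * Q 1 2 - Q 0 2 * Q 1 1 = Q 2 0 * Q 3 3 - Q 2 3 * Q 3 0) ∧
    (Q 0 3 * Q 1 1 - Q 0 1 * Q 1 3 = Q 2 0 * Q 3 2 - Q 2 2 * Q 3 0) ∧
    (Q 0 2 * Q 1 3 - Q 0 3 * Q 1 2 = Q 2 0 * Q 3 1 - Q 2 1 * Q 3 0) := by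
  have hs : ∀ i j, ∑ k, Q i k * Q j k = if i = j then 1 else 0 := fun i j => by
    simpa [Matrix.mul_apply, Matrix.one_apply] using congrFun (congrFun hQ i) j
  -- replace the last two rows by the basis vectors `k`, `l`, and multiply by the transpose
  have key : ∀ k l : Fin 4,
      (Matrix.of ![Q 0, Q 1, Pi.single k 1, Pi.single l 1]).det = Q 2 k * Q 3 l - Q 3 k * Q 2 l := by
    intro k l
    have h1 : (Matrix.of ![Q 0, Q 1, Pi.single k 1, Pi.single l 1]) * Q.transpose
        = Matrix.of ![Pi.single 0 1, Pi.single 1 1, fun i => Q i k, fun i => Q i l] := by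
      ext i j
      fin_cases i
      · simpa [Matrix.mul_apply, Pi.single_apply, eq_comm] using hs 0 j
      · simpa [Matrix.mul_apply, Pi.single_apply, eq_comm] using hs 1 j
      · simp [Matrix.mul_apply, Pi.single_apply]
      · simp [Matrix.mul_apply, Pi.single_apply]
    have h2 := congrArg Matrix.det h1
    rw [Matrix.det_mul, Matrix.det_transpose, hd, mul_one] at h2
    rw [h2]
    simp [Matrix.det_succ_row_zero, Fin.sum_univ_succ, Fin.succAbove, Pi.single_apply]
    ring
  have k1 := key 2 3
  have k2 := key 3 1
  have k3 := key 1 2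
  have k4 := key 0 3
  have k5 := key 0 2
  have k6 := key 0 1
  simp [Matrix.det_succ_row_zero, Fin.sum_univ_succ, Fin.succAbove, Pi.single_apply] at k1 k2 k3 k4 k5 k6
  refine ⟨?_, ?_, ?_, ?_, ?_, ?_⟩ <;> linarith

end WeylAlgebra

/-! ### Rotations and antiselfdual bivectors -/

section Rotations

/-- The values of a 2-form on the antiselfdual basis bivectors. -/
def asdPart (f : Fin 4 → Fin 4 → ℝ) (a : Fin 3) : ℝ :=
  f (asdFst a).1 (asdFst a).2 - f (asdSnd a).1 (asdSnd a).2

/-- The cyclic permutation of the last three members of a frame, which permutes the antiselfdual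
basis bivectors cyclically. -/
def cyclePerm : Equiv.Perm (Fin 4) := Equiv.swap 1 2 * Equiv.swap 2 3

lemma asdPart_cyclePerm (f : Fin 4 → Fin 4 → ℝ) (a : Fin 3) :
    asdPart (fun i j => f (cyclePerm i) (cyclePerm j)) a = asdPart f (a + 1) := by
  fin_cases a <;> rfl

lemma asdForm_cyclePerm (T : Fin 4 → Fin 4 → Fin 4 → Fin 4 → ℝ) (a b : Fin 3) :
    asdForm (fun i j k l => T (cyclePerm i) (cyclePerm j) (cyclePerm k) (cyclePerm l)) a b
      = asdForm T (a + 1) (b + 1) := by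
  fin_cases a <;> fin_cases b <;> rfl

lemma sign_cyclePerm : Equiv.Perm.sign cyclePerm = 1 := by
  rw [cyclePerm, map_mul, Equiv.Perm.sign_swap (by decide), Equiv.Perm.sign_swap (by decide)]
  rfl

/-- Rotations preserve the space of selfdual 2-forms. -/
lemma asdPart_rotate {Q : Matrix (Fin 4) (Fin 4) ℝ} (hQ : Q * Q.transpose = 1) (hd : Q.det = 1)
    {f f' : Fin 4 → Fin 4 → ℝ} (hf : ∀ i j, f i j = -f j i)
    (hff : ∀ i j, f' i j = ∑ k, ∑ l, Q i k * Q j l * f k l) (h0 : ∀ a, asdPart f a = 0)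
    (a : Fin 3) : asdPart f' a = 0 := by
  -- it suffices to treat the first bivector, by cyclic permutation
  have key : ∀ {Q : Matrix (Fin 4) (Fin 4) ℝ} {f' : Fin 4 → Fin 4 → ℝ}, Q * Q.transpose = 1 →
      Q.det = 1 → (∀ i j, f' i j = ∑ k, ∑ l, Q i k * Q j l * f k l) → asdPart f' 0 = 0 := by
    intro Q f' hQ hd hff
    obtain ⟨m1, m2, m3, m4, m5, m6⟩ := Matrix.minor_eq_of_orthogonal hQ hd
    have hs : ∀ i, f i i = 0 := fun i => by linarith [hf i i]
    have z0 := h0 0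
    have z1 := h0 1
    have z2 := h0 2
    simp only [asdPart, asdFst, asdSnd, Matrix.cons_val] at z0 z1 z2 ⊢
    rw [hff, hff]
    simp only [Fin.sum_univ_four, hs, hf 1 0, hf 2 0, hf 3 0, hf 2 1, hf 3 2, hf 1 3]
    linear_combination f 2 3 * (m1 + m6) + f 3 1 * (m2 + m5) + f 1 2 * (m3 + m4)
      + (Q 0 0 * Q 1 1 - Q 0 1 * Q 1 0 - (Q 2 0 * Q 3 1 - Q 2 1 * Q 3 0)) * z0
      + (Q 0 0 * Q 1 2 - Q 0 2 * Q 1 0 - (Q 2 0 * Q 3 2 - Q 2 2 * Q 3 0)) * z1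
      + (Q 0 0 * Q 1 3 - Q 0 3 * Q 1 0 - (Q 2 0 * Q 3 3 - Q 2 3 * Q 3 0)) * z2
  have step : ∀ {Q : Matrix (Fin 4) (Fin 4) ℝ}, Q * Q.transpose = 1 → Q.det = 1 →
      Q.submatrix cyclePerm id * (Q.submatrix cyclePerm id).transpose = 1 ∧
        (Q.submatrix cyclePerm id).det = 1 := by
    intro Q hQ hd
    constructor
    · have h1 := Matrix.submatrix_mul_equiv Q Q.transpose cyclePerm (Equiv.refl _) cyclePerm
      rw [hQ, Matrix.submatrix_one_equiv] at h1
      exact h1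
    · rw [Matrix.det_permute, sign_cyclePerm, hd]
      simp
  obtain ⟨hQ1, hd1⟩ := step hQ hd
  obtain ⟨hQ2, hd2⟩ := step hQ1 hd1
  have e1 := key (f' := fun i j => f' (cyclePerm i) (cyclePerm j)) hQ1 hd1
    fun i j => hff (cyclePerm i) (cyclePerm j)
  have e2 := key (f' := fun i j => f' (cyclePerm (cyclePerm i)) (cyclePerm (cyclePerm j))) hQ2 hd2
    fun i j => hff (cyclePerm (cyclePerm i)) (cyclePerm (cyclePerm j))
  rw [asdPart_cyclePerm] at e1
  rw [asdPart_cyclePerm (fun i j => f' (cyclePerm i) (cyclePerm j)), asdPart_cyclePerm] at e2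
  fin_cases a
  · exact key hQ hd hff
  · exact e1
  · exact e2

end Rotations

/-! ### Selfduality in a single frame -/

section SelfdualityInFrames

variable {M : Type*} [TopologicalSpace M] [ChartedSpace E4 M] [IsManifold (𝓡 4) ∞ M]
  {g : Metric4 M} {o : OrientationForm M} {x : M}

/-- Two positively oriented orthonormal frames are related by a rotation. -/
lemma IsOrientedFrame.exists_rotation {e e' : Fin 4 → TangentSpace (𝓡 4) x}
    (he : IsOrientedFrame g o x e) (he' : IsOrientedFrame g o x e') :
    ∃ Q : Matrix (Fin 4) (Fin 4) ℝ, Q * Q.transpose = 1 ∧ Q.det = 1 ∧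
      ∀ i, e' i = ∑ k, Q i k • e k := by
  have hsum : ∀ i, e' i = ∑ k, g.inner x (e' i) (e k) • e k := fun i => by
    simpa using Metric4.sum_orthogonal_eq one_pos he.1 (e' i)
  let Q : Matrix (Fin 4) (Fin 4) ℝ := fun i k => g.inner x (e' i) (e k)
  have hQ : Q * Q.transpose = 1 := by
    ext i j
    have h1 := he'.1 i j
    rw [hsum j, map_sum] at h1
    simp only [map_smul, smul_eq_mul] at h1
    rw [Matrix.mul_apply, Matrix.one_apply, ← h1]
    exact Finset.sum_congr rfl fun k _ => mul_comm _ _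
  refine ⟨Q, hQ, ?_, hsum⟩
  have hform : o.form x e' = Q.det * o.form x e := by
    have h2 := congrArg (fun f => f Q) (((o.form x).compLinearMap
      (Fintype.linearCombination ℝ e)).eq_smul_basis_det (Pi.basisFun ℝ (Fin 4)))
    have h3 : (fun i => Fintype.linearCombination ℝ e (Q i)) = e' := funext fun i => (hsum i).symm
    have h4 : (fun i => Fintype.linearCombination ℝ e (Pi.basisFun ℝ (Fin 4) i)) = e := by
      funext i
      simp
    simp only [AlternatingMap.compLinearMap_apply, Pi.basisFun_det, h4] at h2
    change o.form x (fun i => Fintype.linearCombination ℝ e (Q i)) = _ at h2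
    rw [h3] at h2
    rw [h2, mul_comm]
    rfl
  have hsq : Q.det * Q.det = 1 := by
    have := congrArg Matrix.det hQ
    rwa [Matrix.det_mul, Matrix.det_transpose, Matrix.det_one] at this
  have hpos : 0 < Q.det := by
    have := he'.2
    rw [hform] at this
    exact (pos_iff_pos_of_mul_pos this).2 he.2
  nlinarith

lemma IsOrientedFrame.cyclePerm {e : Fin 4 → TangentSpace (𝓡 4) x}
    (he : IsOrientedFrame g o x e) : IsOrientedFrame g o x (e ∘ cyclePerm) := by
  refine ⟨fun i j => by simp [he.1], ?_⟩
  rw [AlternatingMap.map_perm, sign_cyclePerm, one_smul]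
  exact he.2

variable {D : CovariantDerivative (𝓡 4) E4 (fun x : M => TangentSpace (𝓡 4) x)}

lemma IsLeviCivita.isRiemannLike (hD : IsLeviCivita g D) (e : Fin 4 → TangentSpace (𝓡 4) x) :
    IsRiemannLike (riemannComp g D x e) := by
  refine ⟨fun i j k l => ?_, fun i j k l => hD.inner_curvatureAt_swap .., fun i j k l => ?_⟩
  · simp only [riemannComp]
    rw [CovariantDerivative.curvatureAt_swap hD.smooth, map_neg, neg_apply]
  · simp only [riemannComp]
    rw [← add_apply, ← add_apply, ← map_add, ← map_add, hD.bianchi, map_zero, zero_apply]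

/-- The components of a skew form under a change of frame. -/
lemma bilinear_sum {V : Type*} [AddCommGroup V] [Module ℝ V] {F : V → V → ℝ}
    (hadd : ∀ u u' v, F (u + u') v = F u v + F u' v) (hsmul : ∀ (c : ℝ) u v, F (c • u) v = c * F u v)
    (hswap : ∀ u v, F u v = -F v u) {e e' : Fin 4 → V} {Q : Matrix (Fin 4) (Fin 4) ℝ}
    (he : ∀ i, e' i = ∑ k, Q i k • e k) (i j : Fin 4) :
    F (e' i) (e' j) = ∑ k, ∑ l, Q i k * Q j l * F (e k) (e l) := by
  let L : V →ₗ[ℝ] V →ₗ[ℝ] ℝ := LinearMap.mk₂ ℝ F hadd hsmul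
    (fun u v v' => by rw [hswap, hadd, hswap v, hswap v']; ring)
    (fun c u v => by rw [hswap, hsmul, hswap v]; simp)
  change L (e' i) (e' j) = ∑ k, ∑ l, Q i k * Q j l * L (e k) (e l)
  rw [he, he]
  simp only [map_sum, map_smul, LinearMap.sum_apply, LinearMap.smul_apply, smul_eq_mul,
    Finset.mul_sum]
  rw [Finset.sum_comm]
  exact Finset.sum_congr rfl fun k _ => Finset.sum_congr rfl fun l _ => by ring

/-- If the curvature acts on antiselfdual bivectors as a multiple of the identity in one positively
oriented orthonormal frame, it does so in all of them. -/
lemma IsLeviCivita.asdForm_rotate (hD : IsLeviCivita g D) {e e' : Fin 4 → TangentSpace (𝓡 4) x}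
    (he : IsOrientedFrame g o x e) (he' : IsOrientedFrame g o x e') {t : ℝ}
    (h : ∀ a b, asdForm (riemannComp g D x e) a b = if a = b then t else 0) (a b : Fin 3) :
    asdForm (riemannComp g D x e') a b = if a = b then t else 0 := by
  obtain ⟨Q, hQ, hd, hQe⟩ := he.exists_rotation he'
  -- the curvature minus the multiple of the identity is tensorial, and vanishes on pairs of
  -- antiselfdual bivectors of `e`; rotate the two bivectors one after the other
  let T : TangentSpace (𝓡 4) x → TangentSpace (𝓡 4) x → TangentSpace (𝓡 4) x →
      TangentSpace (𝓡 4) x → ℝ := fun u v w z => g.inner x (curvatureAt D x u v w) z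
    + t / 2 * (g.inner x u z * g.inner x v w - g.inner x u w * g.inner x v z)
  have hT : ∀ {e : Fin 4 → TangentSpace (𝓡 4) x}, IsOrientedFrame g o x e → ∀ a b,
      asdForm (fun i j k l => T (e i) (e j) (e k) (e l)) a b
        = asdForm (riemannComp g D x e) a b - if a = b then t else 0 := by
    intro e he a b
    have h1 := asdForm_identity a b
    simp only [T, he.1]
    simp only [asdForm] at h1 ⊢
    simp only [riemannComp]
    have h2 : (if a = b then t else 0) = - (t / 2) * (if a = b then -2 else 0) := by
      split_ifs <;> ring
    rw [h2, ← h1]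
    ring
  have hl : ∀ w z, (∀ u u' v, T (u + u') v w z = T u v w z + T u' v w z) ∧
      (∀ (c : ℝ) u v, T (c • u) v w z = c * T u v w z) ∧ ∀ u v, T u v w z = -T v u w z := by
    refine fun w z => ⟨fun u u' v => ?_, fun c u v => ?_, fun u v => ?_⟩
    · simp only [T, CovariantDerivative.curvatureAt_add_left hD.smooth, map_add, add_apply]; ring
    · simp only [T, CovariantDerivative.curvatureAt_smul_left hD.smooth, map_smul, smul_apply,
        smul_eq_mul]; ring
    · simp only [T, CovariantDerivative.curvatureAt_swap hD.smooth u v, map_neg, neg_apply]; ring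
  have hr : ∀ u v, (∀ w w' z, T u v (w + w') z = T u v w z + T u v w' z) ∧
      (∀ (c : ℝ) w z, T u v (c • w) z = c * T u v w z) ∧ ∀ w z, T u v w z = -T u v z w := by
    refine fun u v => ⟨fun w w' z => ?_, fun c w z => ?_, fun w z => ?_⟩
    · simp only [T, CovariantDerivative.curvatureAt_add_right hD.smooth, map_add, add_apply]; ring
    · simp only [T, CovariantDerivative.curvatureAt_smul_right hD.smooth, map_smul, smul_apply,
        smul_eq_mul]; ring
    · simp only [T, hD.inner_curvatureAt_swap u v w z]; ring
  have h0 : ∀ a b, asdForm (fun i j k l => T (e i) (e j) (e k) (e l)) a b = 0 := fun a b => by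
    rw [hT he, h, sub_self]
  have h1 : ∀ a b, asdPart (fun i j => asdPart (fun k l => T (e' i) (e' j) (e k) (e l)) b) a = 0 := by
    intro a b
    refine asdPart_rotate hQ hd (f := fun i j => asdPart (fun k l => T (e i) (e j) (e k) (e l)) b)
      (fun i j => ?_) (fun i j => ?_) (fun a => ?_) a
    · simp only [asdPart, (hl _ _).2.2 (e i) (e j)]; ring
    · simp only [asdPart, bilinear_sum (hl _ _).1 (hl _ _).2.1 (hl _ _).2.2 hQe, mul_sub,
        Finset.sum_sub_distrib]
    · rw [← h0 a b]; simp only [asdPart, asdForm]; ring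
  have h2 : ∀ a b, asdPart (fun k l => asdPart (fun i j => T (e' i) (e' j) (e' k) (e' l)) a) b = 0 := by
    intro a b
    refine asdPart_rotate hQ hd (f := fun k l => asdPart (fun i j => T (e' i) (e' j) (e k) (e l)) a)
      (fun i j => ?_) (fun i j => ?_) (fun b => ?_) b
    · simp only [asdPart, (hr _ _).2.2 (e i) (e j)]; ring
    · simp only [asdPart, bilinear_sum (hr _ _).1 (hr _ _).2.1 (hr _ _).2.2 hQe, mul_sub,
        Finset.sum_sub_distrib]
    · rw [← h1 a b]; simp only [asdPart]; ring
  have h3 := hT he' a b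
  have h4 : asdForm (fun i j k l => T (e' i) (e' j) (e' k) (e' l)) a b = 0 := by
    rw [← h2 a b]; simp only [asdPart, asdForm]; ring
  linarith

/-- Selfduality at a point can be tested in a single positively oriented orthonormal frame: the
curvature has to act on the antiselfdual bivectors as a multiple of the identity. -/
lemma IsLeviCivita.weylComp_iff (hD : IsLeviCivita g D) {e : Fin 4 → TangentSpace (𝓡 4) x}
    (he : IsOrientedFrame g o x e) :
    (∀ e' : Fin 4 → TangentSpace (𝓡 4) x, IsOrientedFrame g o x e' →
      ∀ k l, weylComp g D x e' 0 1 k l = weylComp g D x e' 2 3 k l) ↔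
    asdForm (riemannComp g D x e) 0 1 = 0 ∧ asdForm (riemannComp g D x e) 0 2 = 0 ∧
    asdForm (riemannComp g D x e) 1 2 = 0 ∧
    asdForm (riemannComp g D x e) 1 1 - asdForm (riemannComp g D x e) 2 2 = 0 ∧
    2 * asdForm (riemannComp g D x e) 0 0 - asdForm (riemannComp g D x e) 1 1
      - asdForm (riemannComp g D x e) 2 2 = 0 := by
  have hS := hD.isRiemannLike e
  constructor
  · intro h
    -- the frame `e` gives all conditions but two, and its cyclic permutation the remaining ones
    have h1 := hS.weylPart_eq_iff.1 (h e he)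
    have h2 := (hD.isRiemannLike _).weylPart_eq_iff.1 (h _ he.cyclePerm)
    have h3 : ∀ a b, asdForm (riemannComp g D x (e ∘ _root_.cyclePerm)) a b
      = asdForm (riemannComp g D x e) (a + 1) (b + 1) :=
      asdForm_cyclePerm (riemannComp g D x e)
    simp only [h3] at h2
    have h4 : asdForm (riemannComp g D x e) 1 2 = 0 := h2.1
    have h5 : 2 * asdForm (riemannComp g D x e) 1 1
      = asdForm (riemannComp g D x e) 2 2 + asdForm (riemannComp g D x e) 0 0 := h2.2.2
    refine ⟨h1.1, h1.2.1, h4, ?_, ?_⟩ <;> linarith [h1.2.2]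
  · rintro ⟨h1, h2, h3, h4, h5⟩ e' he'
    have h6 : ∀ a b, asdForm (riemannComp g D x e) a b
        = if a = b then asdForm (riemannComp g D x e) 0 0 else 0 := by
      intro a b
      fin_cases a <;> fin_cases b
      · rfl
      · exact h1
      · exact h2
      · exact (hS.asdForm_symm ..).trans h1
      · change asdForm _ 1 1 = asdForm _ 0 0
        linarith
      · exact h3
      · exact (hS.asdForm_symm ..).trans h2
      · exact (hS.asdForm_symm ..).trans h3
      · change asdForm _ 2 2 = asdForm _ 0 0
        linarith
    have h7 := hD.asdForm_rotate he he' h6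
    refine (hD.isRiemannLike e').weylPart_eq_iff.2 ⟨h7 0 1, h7 0 2, ?_⟩
    rw [h7 0 0, h7 1 1, h7 2 2, if_pos rfl, if_pos rfl, if_pos rfl]
    ring

end SelfdualityInFrames

/-! ### The curvature of an adapted frame -/

section ReducedFrames

variable {M : Type*} [TopologicalSpace M] [ChartedSpace E4 M] [IsManifold (𝓡 4) ∞ M]
  {g : Metric4 M} {o : OrientationForm M}
  {N : Type*} [TopologicalSpace N] [ChartedSpace ℂ N] [IsManifold 𝓘(ℂ) ω N]
  {W : N → Type*} [TopologicalSpace (TotalSpace ℂ W)]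
  [∀ p, AddCommGroup (W p)] [∀ p, Module ℝ (W p)] [∀ p, Module ℂ (W p)]
  [∀ p, IsScalarTower ℝ ℂ (W p)]
  [∀ p, TopologicalSpace (W p)] [∀ p, IsTopologicalAddGroup (W p)]
  [∀ p, ContinuousSMul ℝ (W p)] [FiberBundle ℂ W]
  [VectorBundle ℝ ℂ W] [VectorBundle ℂ ℂ W] [ContMDiffVectorBundle ∞ ℂ W 𝓘(ℝ, ℂ)]

namespace SpinorVortexData

variable (S : SpinorVortexData W) (hN : HermitianMetric (fun p : N => TangentSpace 𝓘(ℝ, ℂ) p))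
  (hW : HermitianMetric W)

/-- The component of `ψ` in a frame `w` of `W`. -/
def framePsi (w : Π p, W p) (p : N) : ℂ := S.ψ p (w p)

/-- The component `⟨w, ∂̄_X w⟩` of `∂̄` in frames `w` of `W` and `X` of `TN`. -/
def frameDbar (w : Π p, W p) (X : Π p : N, TangentSpace 𝓘(ℝ, ℂ) p) (p : N) : ℂ :=
  S.dbar.connForm hW w p (X p)

/-- The component of `(∂̄_X C)(w, w)` along `X` in unit frames `w` and `X`. -/
def frameDbarC (w : Π p, W p) (X : Π p : N, TangentSpace 𝓘(ℝ, ℂ) p) (p : N) : ℂ :=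
  dbarFun (S.frameC hN w X) p (X p) - Complex.I / 2 * frameBracket hN X p * S.frameC hN w X p
    - 2 * S.frameDbar hW w X p * S.frameC hN w X p

/-- The value of `∂̄ ψ + 3 C ψ̄` on unit frames `X` and `w`. -/
def frameDbarPsi (w : Π p, W p) (X : Π p : N, TangentSpace 𝓘(ℝ, ℂ) p) (p : N) : ℂ :=
  dbarFun (S.framePsi w) p (X p) - S.frameDbar hW w X p * S.framePsi w p
    + 3 * starRingEnd ℂ (S.framePsi w p) * S.frameC hN w X p

/-- The difference `s - (|ψ|² - 2 |C|²)` in unit frames: the dual vector of `ψ` enters through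
`|ψ|² = 4 |ψ(w)|²`, and the four components of the real tensor `C` all have norm `|C(w, w)|`. -/
def frameScalar (w : Π p, W p) (X : Π p : N, TangentSpace 𝓘(ℝ, ℂ) p) (p : N) : ℝ :=
  (tangentHolomorphicStructure hN).frameCurvature hN hN X X p - S.dbar.frameCurvature hW hN w X p
    - (4 * Complex.normSq (S.framePsi w p) - 8 * Complex.normSq (S.frameC hN w X p))

variable {S hN hW} {w : Π p, W p} {X : Π p : N, TangentSpace 𝓘(ℝ, ℂ) p} {p : N}
  (hw : IsUnitFrameAt hW w p) (hX : IsUnitFrameAt hN X p)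

include hw in
lemma contMDiffAt_framePsi : ContMDiffAt 𝓘(ℝ, ℂ) 𝓘(ℝ, ℂ) ∞ (S.framePsi w) p :=
  S.ψ_smooth p w hw.smooth

include hw hX

lemma contMDiffAt_frameDbar : ContMDiffAt 𝓘(ℝ, ℂ) 𝓘(ℝ, ℂ) ∞ (S.frameDbar hW w X) p :=
  S.dbar.contMDiffAt_connForm hw.smooth hX.smooth

lemma contMDiffAt_frameC : ContMDiffAt 𝓘(ℝ, ℂ) 𝓘(ℝ, ℂ) ∞ (S.frameC hN w X) p :=
  hN.smooth p X _ hX.smooth (S.C_smooth p w w hw.smooth hw.smooth)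

end SpinorVortexData

namespace SurfaceReduction

/-- The components of the Riemann tensor in the adapted frame, divided by the conformal factor. -/
def frameCurvature (R : SurfaceReduction g o N W) (w : Π p, W p)
    (X : Π p : N, TangentSpace 𝓘(ℝ, ℂ) p) (x : M) : Fin 4 → Fin 4 → Fin 4 → Fin 4 → ℝ :=
  frameRiemann (fun i j k => structureFun g R.f (R.frame w X) i j k x)
    (fun l i j k => mvfderiv (𝓡 4) (structureFun g R.f (R.frame w X) i j k) x (R.frame w X l x))
    (fun i => logFactor R.f (R.frame w X) i x)
    (fun l i => mvfderiv (𝓡 4) (logFactor R.f (R.frame w X) i) x (R.frame w X l x))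

variable {R : SurfaceReduction g o N W}

/-- The derivative of a relation between two functions on `M` and the pullbacks of two functions on
`N`. -/
lemma mvfderiv_combination {x : M} {F G : M → ℝ} {y z : N → ℂ} {r : ℝ} {a b : ℂ}
    (hF : ContMDiffAt (𝓡 4) 𝓘(ℝ, ℝ) ∞ F x) (hG : ContMDiffAt (𝓡 4) 𝓘(ℝ, ℝ) ∞ G x)
    (hy : ContMDiffAt 𝓘(ℝ, ℂ) 𝓘(ℝ, ℂ) ∞ y (R.proj x))
    (hz : ContMDiffAt 𝓘(ℝ, ℂ) 𝓘(ℝ, ℂ) ∞ z (R.proj x))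
    (h : ∀ᶠ q in 𝓝 x, F q + r * G q = (a * y (R.proj q) + b * z (R.proj q)).re)
    (u : TangentSpace (𝓡 4) x) :
    mvfderiv (𝓡 4) F x u + r * mvfderiv (𝓡 4) G x u
      = (a * mvfderiv 𝓘(ℝ, ℂ) y (R.proj x) (R.dproj x u)
        + b * mvfderiv 𝓘(ℝ, ℂ) z (R.proj x) (R.dproj x u)).re := by
  have dF := hF.mdifferentiableAt (by simp)
  have dG := hG.mdifferentiableAt (by simp)
  have dy := hy.mdifferentiableAt (by simp)
  have dz := hz.mdifferentiableAt (by simp)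
  have day : MDifferentiableAt 𝓘(ℝ, ℂ) 𝓘(ℝ, ℂ) (fun q => a * y q) (R.proj x) :=
    (contMDiffAt_const.complex_mul hy).mdifferentiableAt (by simp)
  have dbz : MDifferentiableAt 𝓘(ℝ, ℂ) 𝓘(ℝ, ℂ) (fun q => b * z q) (R.proj x) :=
    (contMDiffAt_const.complex_mul hz).mdifferentiableAt (by simp)
  have h1 : mvfderiv (𝓡 4) (fun q => F q + r * G q) x u
      = mvfderiv (𝓡 4) F x u + r * mvfderiv (𝓡 4) G x u := by
    have h2 := mvfderiv_fun_smul (I := 𝓡 4) (x := x) (a := fun _ : M => r) mdifferentiableAt_const dG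
    have h3 : MDifferentiableAt (𝓡 4) 𝓘(ℝ, ℝ) (fun q => r • G q) x := dG.const_smul r
    simp only [smul_eq_mul] at h2 h3
    rw [mvfderiv_fun_add dF h3, add_apply, h2, mvfderiv_const]
    simp
  have dyz : MDifferentiableAt 𝓘(ℝ, ℂ) 𝓘(ℝ, ℝ) (fun q => (a * y q + b * z q).re) (R.proj x) :=
    ((contMDiffAt_const.complex_mul hy).add (contMDiffAt_const.complex_mul hz)).re.mdifferentiableAt
      (by simp)
  have h2 := mvfderiv_re (f := fun q => a * y q + b * z q) (day.add dbz) (R.dproj x u)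
  rw [← h1, mvfderiv_congr_of_eventuallyEq h, R.mvfderiv_comp_proj dyz, h2,
    mvfderiv_fun_add day dbz, add_apply, mvfderiv_const_mul a dy, mvfderiv_const_mul b dz]

namespace Defines

variable {S : SpinorVortexData W} (hS : R.Defines S)
  {w : Π p, W p} {X : Π p : N, TangentSpace 𝓘(ℝ, ℂ) p} {x : M}
  (hw : IsUnitFrameAt R.hW w (R.proj x)) (hX : IsUnitFrameAt R.hN X (R.proj x))

include hS hw hX

/-- The structure functions of the adapted frame at a point are those of a reduced frame. -/
theorem isReducedFrame : IsReducedFrame (fun i j k => structureFun g R.f (R.frame w X) i j k x)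
    (fun l i j k => mvfderiv (𝓡 4) (structureFun g R.f (R.frame w X) i j k) x (R.frame w X l x))
    (fun i => logFactor R.f (R.frame w X) i x)
    (fun l i => mvfderiv (𝓡 4) (logFactor R.f (R.frame w X) i) x (R.frame w X l x))
    (S.frameDbar R.hW w X (R.proj x)) (S.frameC R.hN w X (R.proj x)) (S.framePsi w (R.proj x))
    (fun l => mvfderiv 𝓘(ℝ, ℂ) (S.frameDbar R.hW w X) (R.proj x) (frameProj X l (R.proj x)))
    (fun l => mvfderiv 𝓘(ℝ, ℂ) (S.frameC R.hN w X) (R.proj x) (frameProj X l (R.proj x)))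
    (fun l => mvfderiv 𝓘(ℝ, ℂ) (S.framePsi w) (R.proj x) (frameProj X l (R.proj x))) := by
  have hE := R.isConformalFrameAt_frame hw hX
  have hc := hE.contMDiffAt_structureFun
  have hβ := SpinorVortexData.contMDiffAt_frameDbar (S := S) hw hX
  have hγ := SpinorVortexData.contMDiffAt_frameC (S := S) hw hX
  have hτ := SpinorVortexData.contMDiffAt_framePsi (S := S) hw
  have hev : ∀ᶠ y in 𝓝 x, IsUnitFrameAt R.hW w (R.proj y) ∧ IsUnitFrameAt R.hN X (R.proj y) :=
    (R.eventually_proj hw.eventually).and (R.eventually_proj hX.eventually)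
  have hd : ∀ l, R.dproj x (R.frame w X l x) = frameProj X l (R.proj x) :=
    fun l => R.dproj_frame l x
  refine
  { skew := fun i j k => hE.structureFun_swap i j k x
    dskew := fun l i j k => ?_
    vert := fun i j k hi hk => R.structureFun_vertical_left hw hX i j k hi hk
    dvert := fun l i j k hi hk => ?_
    inv := fun l i j k hl => ?_
    jacobi := fun i j k l => hE.jacobi i j k l
    comm := fun i j => hE.mvfderiv_logFactor_comm i j
    C_zero := hS.structureFun_C_zero hw hX
    C_one := hS.structureFun_C_one hw hX
    C_I_zero := hS.structureFun_C_I_zero hw hX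
    C_I_one := hS.structureFun_C_I_one hw hX
    psi_zero := hS.structureFun_psi_zero hw hX
    psi_one := hS.structureFun_psi_one hw hX
    dC_zero := fun l => ?_
    dC_one := fun l => ?_
    dC_I_zero := fun l => ?_
    dC_I_one := fun l => ?_
    dpsi_zero := fun l => ?_
    dpsi_one := fun l => ?_ }
  · have h1 : structureFun g R.f (R.frame w X) i j k
        = fun y => -structureFun g R.f (R.frame w X) j i k y :=
      funext fun y => hE.structureFun_swap i j k y
    rw [h1]
    exact congrArg (fun A : TangentSpace (𝓡 4) x →L[ℝ] ℝ => A (R.frame w X l x))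
      (mvfderiv_neg (g := structureFun g R.f (R.frame w X) j i k))
  · have h1 : structureFun g R.f (R.frame w X) i j k =ᶠ[𝓝 x] fun _ => (0 : ℝ) :=
      hev.mono fun y hy => R.structureFun_vertical_left hy.1 hy.2 i j k hi hk
    rw [mvfderiv_congr_of_eventuallyEq h1, mvfderiv_const, zero_apply]
  · fin_cases l
    · exact R.mvfderiv_structureFun_vertical hw hX i j k (w (R.proj x))
    · exact R.mvfderiv_structureFun_vertical hw hX i j k (Complex.I • w (R.proj x))
    · exact absurd hl (by decide)
    · exact absurd hl (by decide)
  · have h1 := R.mvfderiv_combination (r := 1) (a := 2) (b := 2) (hc 2 0 0) (hc 3 1 0) hβ hγ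
      (hev.mono fun y hy => by
        rw [one_mul, hS.structureFun_C_zero hy.1 hy.2]; simp [SpinorVortexData.frameDbar])
      (R.frame w X l x)
    rw [hd, one_mul] at h1
    simpa using h1
  · have h1 := R.mvfderiv_combination (r := 1) (a := -2 * Complex.I) (b := 2 * Complex.I)
      (hc 2 0 1) (hc 3 1 1) hβ hγ
      (hev.mono fun y hy => by
        rw [one_mul, hS.structureFun_C_one hy.1 hy.2]; simp [SpinorVortexData.frameDbar, sub_eq_add_neg])
      (R.frame w X l x)
    rw [hd, one_mul] at h1
    simpa [sub_eq_add_neg] using h1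
  · have h1 := R.mvfderiv_combination (r := -1) (a := 2 * Complex.I) (b := 2 * Complex.I)
      (hc 2 1 0) (hc 3 0 0) hβ hγ
      (hev.mono fun y hy => by
        rw [neg_one_mul, ← sub_eq_add_neg, hS.structureFun_C_I_zero hy.1 hy.2]
        simp [SpinorVortexData.frameDbar, sub_eq_add_neg])
      (R.frame w X l x)
    rw [hd, neg_one_mul] at h1
    simpa [sub_eq_add_neg] using h1
  · have h1 := R.mvfderiv_combination (r := -1) (a := 2) (b := -2)
      (hc 2 1 1) (hc 3 0 1) hβ hγ
      (hev.mono fun y hy => by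
        rw [neg_one_mul, ← sub_eq_add_neg, hS.structureFun_C_I_one hy.1 hy.2]
        simp [SpinorVortexData.frameDbar, sub_eq_add_neg])
      (R.frame w X l x)
    rw [hd, neg_one_mul] at h1
    simpa [sub_eq_add_neg] using h1
  · have h1 := R.mvfderiv_combination (r := -1) (a := -2 * Complex.I) (b := 0)
      (hc 0 1 0) (hc 2 3 0) hτ hτ
      (hev.mono fun y hy => by
        rw [neg_one_mul, ← sub_eq_add_neg, hS.structureFun_psi_zero hy.1 hy.2]
        simp [SpinorVortexData.framePsi])
      (R.frame w X l x)
    rw [hd, neg_one_mul] at h1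
    simpa [sub_eq_add_neg] using h1
  · have h1 := R.mvfderiv_combination (r := -1) (a := 2) (b := 0)
      (hc 0 1 1) (hc 2 3 1) hτ hτ
      (hev.mono fun y hy => by
        rw [neg_one_mul, ← sub_eq_add_neg, hS.structureFun_psi_one hy.1 hy.2]
        simp [SpinorVortexData.framePsi])
      (R.frame w X l x)
    rw [hd, neg_one_mul] at h1
    simpa [sub_eq_add_neg] using h1

/-- The values of the curvature of a Levi-Civita connection on the antiselfdual bivectors of an
adapted frame. -/
lemma asdForm_frame {D : CovariantDerivative (𝓡 4) E4 (fun x : M => TangentSpace (𝓡 4) x)}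
    (hD : IsLeviCivita g D) (a b : Fin 3) :
    asdForm (riemannComp g D x fun i => R.frame w X i x) a b
      = R.f x * asdForm (R.frameCurvature w X x) a b := by
  have hE := R.isConformalFrameAt_frame hw hX
  have hc := fun i j k => (hE.contMDiffAt_structureFun i j k).mdifferentiableAt
    (n := ∞) (by simp)
  have hl := fun i => (hE.contMDiffAt_logFactor i).mdifferentiableAt (n := ∞) (by simp)
  have hd : ∀ i j k l, mvfderiv (𝓡 4) (connectionFun g R.f (R.frame w X) i j k) x (R.frame w X l x)
      = connCoeff
        (fun i j k => mvfderiv (𝓡 4) (structureFun g R.f (R.frame w X) i j k) x (R.frame w X l x))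
        (fun i => mvfderiv (𝓡 4) (logFactor R.f (R.frame w X) i) x (R.frame w X l x)) i j k := by
    intro i j k l
    have hs : ∀ (r : ℝ) {F : M → ℝ}, MDifferentiableAt (𝓡 4) 𝓘(ℝ, ℝ) F x →
        mvfderiv (𝓡 4) (fun y => F y * r) x (R.frame w X l x)
          = mvfderiv (𝓡 4) F x (R.frame w X l x) * r := fun r F hF => by
      have h2 := mvfderiv_fun_smul (I := 𝓡 4) (x := x) (a := F) (g := fun _ : M => r) hF
        mdifferentiableAt_const
      simp only [smul_eq_mul] at h2
      rw [h2, mvfderiv_const]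
      simp
    have ha : ∀ {F G : M → ℝ}, MDifferentiableAt (𝓡 4) 𝓘(ℝ, ℝ) F x →
        MDifferentiableAt (𝓡 4) 𝓘(ℝ, ℝ) G x →
        mvfderiv (𝓡 4) (fun y => F y - G y) x (R.frame w X l x)
          = mvfderiv (𝓡 4) F x (R.frame w X l x) - mvfderiv (𝓡 4) G x (R.frame w X l x) :=
      fun hF hG => congrArg (fun A : TangentSpace (𝓡 4) x →L[ℝ] ℝ => A (R.frame w X l x))
        (mvfderiv_sub hF hG)
    have hs' : ∀ (r : ℝ) {F : M → ℝ}, MDifferentiableAt (𝓡 4) 𝓘(ℝ, ℝ) F x →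
        MDifferentiableAt (𝓡 4) 𝓘(ℝ, ℝ) (fun y => F y * r) x := fun r F hF =>
      hF.mul mdifferentiableAt_const
    have hA : ∀ {F G : M → ℝ}, MDifferentiableAt (𝓡 4) 𝓘(ℝ, ℝ) F x →
        MDifferentiableAt (𝓡 4) 𝓘(ℝ, ℝ) G x →
        MDifferentiableAt (𝓡 4) 𝓘(ℝ, ℝ) (fun y => F y + G y) x := fun hF hG => hF.add hG
    have hB : ∀ {F G : M → ℝ}, MDifferentiableAt (𝓡 4) 𝓘(ℝ, ℝ) F x →
        MDifferentiableAt (𝓡 4) 𝓘(ℝ, ℝ) G x →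
        MDifferentiableAt (𝓡 4) 𝓘(ℝ, ℝ) (fun y => F y - G y) x := fun hF hG => hF.sub hG
    have m1 := hB (hc i j k) (hc i k j)
    have m2 := hs' 2⁻¹ (hB m1 (hc j k i))
    have m3 := hs' (if j = k then 1 else 0) (hl i)
    have m4 := hs' (if i = k then 1 else 0) (hl j)
    have m5 := hA m2 m3
    have e1 : connectionFun g R.f (R.frame w X) i j k = fun y =>
        (structureFun g R.f (R.frame w X) i j k y - structureFun g R.f (R.frame w X) i k j y
          - structureFun g R.f (R.frame w X) j k i y) * 2⁻¹
        + logFactor R.f (R.frame w X) i y * (if j = k then 1 else 0)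
        + logFactor R.f (R.frame w X) j y * (if i = k then 1 else 0)
        - logFactor R.f (R.frame w X) k y * (if i = j then 1 else 0) := rfl
    rw [e1, ha (hA m5 m4) (hs' _ (hl k)), mvfderiv_fun_add m5 m4, add_apply,
      mvfderiv_fun_add m2 m3, add_apply, hs _ (hB m1 (hc j k i)), ha m1 (hc j k i), ha (hc i j k) (hc i k j),
      hs _ (hl i), hs _ (hl j), hs _ (hl k), connCoeff, div_eq_mul_inv]
  simp only [asdForm, riemannComp, hD.inner_curvature_frame hE, hd]
  simp only [frameCurvature, frameRiemann, connCoeff, connectionFun]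
  ring

/-- The curvature components in an adapted frame are the spinor-vortex expressions. -/
lemma asdForm_frameCurvature :
    asdForm (R.frameCurvature w X x) 0 1 = 2 * (S.frameDbarPsi R.hN R.hW w X (R.proj x)).im ∧
    asdForm (R.frameCurvature w X x) 0 2 = -2 * (S.frameDbarPsi R.hN R.hW w X (R.proj x)).re ∧
    asdForm (R.frameCurvature w X x) 1 2 = -4 * (S.frameDbarC R.hN R.hW w X (R.proj x)).im ∧
    asdForm (R.frameCurvature w X x) 1 1 - asdForm (R.frameCurvature w X x) 2 2
      = -8 * (S.frameDbarC R.hN R.hW w X (R.proj x)).re ∧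
    2 * asdForm (R.frameCurvature w X x) 0 0 - asdForm (R.frameCurvature w X x) 1 1
      - asdForm (R.frameCurvature w X x) 2 2
        = -2 * S.frameScalar R.hN R.hW w X (R.proj x) := by
  obtain ⟨h01, h02, h12, h11, h00⟩ := (hS.isReducedFrame hw hX).asdForm_frameRiemann
  have hev : ∀ᶠ y in 𝓝 x, IsUnitFrameAt R.hW w (R.proj y) ∧ IsUnitFrameAt R.hN X (R.proj y) :=
    (R.eventually_proj hw.eventually).and (R.eventually_proj hX.eventually)
  have hb := contMDiffAt_frameBracket (hN := R.hN) hX.smooth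
  have hbd := hb.mdifferentiableAt (by simp)
  have d1 : mvfderiv (𝓡 4) (structureFun g R.f (R.frame w X) 2 3 3) x (R.frame w X 2 x)
      = (mvfderiv 𝓘(ℝ, ℂ) (frameBracket R.hN X) (R.proj x) (X (R.proj x))).im := by
    rw [mvfderiv_congr_of_eventuallyEq
      (hev.mono fun y hy => R.structureFun_two_three_three hy.1 hy.2),
      R.mvfderiv_comp_proj (φ := fun q => (frameBracket R.hN X q).im)
        (hb.im.mdifferentiableAt (by simp)), mvfderiv_im hbd, R.dproj_frame]
    rfl
  have d2 : mvfderiv (𝓡 4) (structureFun g R.f (R.frame w X) 2 3 2) x (R.frame w X 3 x)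
      = (mvfderiv 𝓘(ℝ, ℂ) (frameBracket R.hN X) (R.proj x) (Complex.I • X (R.proj x))).re := by
    rw [mvfderiv_congr_of_eventuallyEq
      (hev.mono fun y hy => R.structureFun_two_three_two hy.1 hy.2),
      R.mvfderiv_comp_proj (φ := fun q => (frameBracket R.hN X q).re)
        (hb.re.mdifferentiableAt (by simp)), mvfderiv_re hbd, R.dproj_frame]
    rfl
  have e2 : frameProj X 2 (R.proj x) = X (R.proj x) := rfl
  have e3 : frameProj X 3 (R.proj x) = Complex.I • X (R.proj x) := rfl
  have p2 := R.structureFun_two_three_two hw hX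
  have p3 := R.structureFun_two_three_three hw hX
  simp only [e2, e3, d1, d2, p2, p3] at h01 h02 h12 h11 h00
  have hre : ∀ z u : ℂ, ((z + Complex.I * u) / 2).re = (z.re - u.im) / 2 := fun z u => by
    simp [sub_eq_add_neg]
  have him : ∀ z u : ℂ, ((z + Complex.I * u) / 2).im = (z.im + u.re) / 2 := fun z u => by
    simp
  refine ⟨h01.trans ?_, h02.trans ?_, h12.trans ?_, h11.trans ?_, h00.trans ?_⟩
  · simp [SpinorVortexData.frameDbarPsi, dbarFun, him]
    ring
  · simp [SpinorVortexData.frameDbarPsi, dbarFun, hre]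
    ring
  · simp [SpinorVortexData.frameDbarC, dbarFun, him]
    ring
  · simp [SpinorVortexData.frameDbarC, dbarFun, hre]
    ring
  · have hcurv : S.dbar.frameCurvature R.hW R.hN w X (R.proj x)
        = 2 * (mvfderiv 𝓘(ℝ, ℂ) (S.frameDbar R.hW w X) (R.proj x) (X (R.proj x))).re
          + 2 * (mvfderiv 𝓘(ℝ, ℂ) (S.frameDbar R.hW w X) (R.proj x) (Complex.I • X (R.proj x))).im
          + 2 * (frameBracket R.hN X (R.proj x)).re * (S.frameDbar R.hW w X (R.proj x)).im
          - 2 * (frameBracket R.hN X (R.proj x)).im * (S.frameDbar R.hW w X (R.proj x)).re := rfl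
    simp only [SpinorVortexData.frameScalar, frameCurvature_tangent hX, Complex.normSq_apply, hcurv]
    ring

/-- Selfduality along the fibre of `p` in terms of the spinor-vortex expressions at `p`. -/
theorem weylComp_iff_frame
    {D : CovariantDerivative (𝓡 4) E4 (fun x : M => TangentSpace (𝓡 4) x)}
    (hD : IsLeviCivita g D) :
    (∀ e : Fin 4 → TangentSpace (𝓡 4) x, IsOrientedFrame g o x e →
      ∀ k l, weylComp g D x e 0 1 k l = weylComp g D x e 2 3 k l) ↔
    S.frameDbarC R.hN R.hW w X (R.proj x) = 0 ∧ S.frameDbarPsi R.hN R.hW w X (R.proj x) = 0 ∧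
      S.frameScalar R.hN R.hW w X (R.proj x) = 0 := by
  have hE := R.isConformalFrameAt_frame hw hX
  have hf : 0 < Real.sqrt (R.f x) := Real.sqrt_pos.2 (R.f_pos x)
  have hff : Real.sqrt (R.f x) * Real.sqrt (R.f x) = R.f x := Real.mul_self_sqrt (R.f_pos x).le
  -- the orthonormal frame obtained by rescaling the adapted frame
  have he : IsOrientedFrame g o x fun i => (Real.sqrt (R.f x))⁻¹ • R.frame w X i x := by
    refine ⟨fun i j => ?_, ?_⟩
    · rw [map_smul, map_smul, smul_apply, hE.inner_eq, smul_eq_mul, smul_eq_mul, ← mul_assoc,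
        ← mul_inv, hff]
      split_ifs
      · exact inv_mul_cancel₀ (R.f_pos x).ne'
      · exact mul_zero _
    · rw [AlternatingMap.map_smul_univ (o.form x)]
      have := R.orientation_frame hw.ne_zero hX.ne_zero
      positivity
  have hsc : ∀ a b, asdForm (riemannComp g D x fun i => (Real.sqrt (R.f x))⁻¹ • R.frame w X i x) a b
      = (R.f x)⁻¹ * asdForm (R.frameCurvature w X x) a b := by
    intro a b
    have h1 : ∀ i j k l, riemannComp g D x (fun i => (Real.sqrt (R.f x))⁻¹ • R.frame w X i x) i j k l
        = (R.f x)⁻¹ * (R.f x)⁻¹ * riemannComp g D x (fun i => R.frame w X i x) i j k l := by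
      intro i j k l
      have hr : ∀ (c : ℝ) (u v z : TangentSpace (𝓡 4) x), curvatureAt D x u (c • v) z
          = c • curvatureAt D x u v z := fun c u v z => by
        rw [CovariantDerivative.curvatureAt_swap hD.smooth,
          CovariantDerivative.curvatureAt_smul_left hD.smooth,
          CovariantDerivative.curvatureAt_swap hD.smooth v, smul_neg, neg_neg]
      simp only [riemannComp, CovariantDerivative.curvatureAt_smul_left hD.smooth, hr,
        CovariantDerivative.curvatureAt_smul_right hD.smooth, map_smul, smul_apply, smul_eq_mul]
      have hi : (R.f x)⁻¹ = (Real.sqrt (R.f x))⁻¹ * (Real.sqrt (R.f x))⁻¹ := by rw [← mul_inv, hff]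
      rw [hi]
      ring
    have h2 : ∀ (T : Fin 4 → Fin 4 → Fin 4 → Fin 4 → ℝ) (r : ℝ),
        asdForm (fun i j k l => r * T i j k l) a b = r * asdForm T a b := fun T r => by
      simp only [asdForm]
      ring
    have h3 := h2 (riemannComp g D x fun i => R.frame w X i x) ((R.f x)⁻¹ * (R.f x)⁻¹)
    simp only [← h1] at h3
    rw [h3, hS.asdForm_frame hw hX hD, mul_assoc, inv_mul_cancel_left₀ (R.f_pos x).ne']
  obtain ⟨h01, h02, h12, h11, h00⟩ := hS.asdForm_frameCurvature hw hX
  rw [hD.weylComp_iff he, Complex.ext_iff, Complex.ext_iff]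
  simp only [hsc, ← mul_sub, mul_left_comm (2 : ℝ), mul_eq_zero, inv_eq_zero, (R.f_pos x).ne',
    false_or, h01, h02, h12, h11, h00, Complex.zero_re, Complex.zero_im]
  norm_num
  tauto

end Defines

end SurfaceReduction

end ReducedFrames

/-! ### Complex antilinearity of holomorphic structures -/

section HolomorphicStructureAntilinear

variable {N : Type*} [TopologicalSpace N] [ChartedSpace ℂ N] [IsManifold 𝓘(ℂ) ω N]
  {L : N → Type*} [TopologicalSpace (TotalSpace ℂ L)]
  [∀ p, AddCommGroup (L p)] [∀ p, Module ℝ (L p)] [∀ p, Module ℂ (L p)]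
  [∀ p, IsScalarTower ℝ ℂ (L p)]
  [∀ p, TopologicalSpace (L p)] [∀ p, IsTopologicalAddGroup (L p)]
  [∀ p, ContinuousSMul ℝ (L p)] [FiberBundle ℂ L] [VectorBundle ℝ ℂ L]
  [ContMDiffVectorBundle ∞ ℂ L 𝓘(ℝ, ℂ)]

lemma HolomorphicStructure.op_smul_vector (d : HolomorphicStructure L) {s : Π p, L p} {p : N}
    (hs : SmoothSectionAt 𝓘(ℝ, ℂ) ℂ s p) (c : ℂ) (X : TangentSpace 𝓘(ℝ, ℂ) p) :
    d.op s p (c • X) = starRingEnd ℂ c • d.op s p X := by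
  rw [complex_smul_eq_re_add_im p c X, complex_smul_eq_re_add_im p _ (d.op s p X), map_add, map_smul,
    map_smul, d.antilinear s p X hs]
  simp

end HolomorphicStructureAntilinear

/-! ### The spinor-vortex equations in unit frames -/

section FrameEquations

variable {N : Type*} [TopologicalSpace N] [ChartedSpace ℂ N] [IsManifold 𝓘(ℂ) ω N]
  {W : N → Type*} [TopologicalSpace (TotalSpace ℂ W)]
  [∀ p, AddCommGroup (W p)] [∀ p, Module ℝ (W p)] [∀ p, Module ℂ (W p)]
  [∀ p, IsScalarTower ℝ ℂ (W p)]
  [∀ p, TopologicalSpace (W p)] [∀ p, IsTopologicalAddGroup (W p)]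
  [∀ p, ContinuousSMul ℝ (W p)] [FiberBundle ℂ W]
  [VectorBundle ℝ ℂ W] [VectorBundle ℂ ℂ W] [ContMDiffVectorBundle ∞ ℂ W 𝓘(ℝ, ℂ)]

lemma dbarFun_smul_vector (f : N → ℂ) (p : N) (c : ℂ) (X : TangentSpace 𝓘(ℝ, ℂ) p) :
    dbarFun f p (c • X) = starRingEnd ℂ c * dbarFun f p X := by
  rw [complex_smul_eq_re_add_im p c X, dbarFun_vector_add, dbarFun_vector_smul, dbarFun_vector_smul,
    dbarFun_I_smul]
  apply Complex.ext <;> simp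

namespace SpinorVortexData

variable {S : SpinorVortexData W} {hN : HermitianMetric (fun p : N => TangentSpace 𝓘(ℝ, ℂ) p)}
  {hW : HermitianMetric W} {w : Π p, W p} {X : Π p : N, TangentSpace 𝓘(ℝ, ℂ) p} {p : N}
  (hw : IsUnitFrameAt hW w p) (hX : IsUnitFrameAt hN X p)

include hw

/-- The Leibniz rule for the expansion of a section in a unit frame. -/
lemma op_eq {s : Π p, W p} (hs : SmoothSectionAt 𝓘(ℝ, ℂ) ℂ s p) :
    S.dbar.op s p (X p) = (hW.form p (w p) (s p) * S.frameDbar hW w X p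
      + dbarFun (fun q => hW.form q (w q) (s q)) p (X p)) • w p := by
  have hL : IsComplexLineBundle W := isComplexLineBundle_of_vectorBundle
  have ha : ContMDiffAt 𝓘(ℝ, ℂ) 𝓘(ℝ, ℂ) ∞ (fun q => hW.form q (w q) (s q)) p :=
    hW.smooth p w s hw.smooth hs
  rw [S.dbar.op_congr (hL.smul_smooth p _ w ha hw.smooth)
    (hw.eventually.mono fun q hq => hq.eq_smul hL (s q)), S.dbar.leibniz _ w p _ ha hw.smooth,
    add_smul, mul_smul]
  congr 2
  exact hw.eq_smul hL _

lemma isDualVector_iff {v : W p} :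
    IsDualVector hW p (S.ψ p) v ↔ v = starRingEnd ℂ (S.framePsi w p) • w p := by
  have hL : IsComplexLineBundle W := isComplexLineBundle_of_vectorBundle
  constructor
  · intro hv
    rw [framePsi, hv (w p), ← hW.symm]
    exact hw.eq_smul hL v
  · rintro rfl u
    rw [hw.eq_smul hL u]
    simp [hw.form_self, framePsi, mul_comm]

/-- The equation for `∂̄ ψ` is tensorial: its value on `c X` and `s` is a multiple of its value on the
unit frames. -/
lemma dbarPsi_eq {s : Π p, W p} (hs : SmoothSectionAt 𝓘(ℝ, ℂ) ℂ s p) (c : ℂ) {v : W p}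
    (hv : IsDualVector hW p (S.ψ p) v) :
    dbarFun (fun q => S.ψ q (s q)) p (c • X p) - S.ψ p (S.dbar.op s p (c • X p))
        + 3 * hN.form p (c • X p) (S.C p v (s p))
      = starRingEnd ℂ c * hW.form p (w p) (s p) * S.frameDbarPsi hN hW w X p := by
  have hL : IsComplexLineBundle W := isComplexLineBundle_of_vectorBundle
  have ha : ContMDiffAt 𝓘(ℝ, ℂ) 𝓘(ℝ, ℂ) ∞ (fun q => hW.form q (w q) (s q)) p :=
    hW.smooth p w s hw.smooth hs
  have hψ : (fun q => S.ψ q (s q)) =ᶠ[𝓝 p] fun q => hW.form q (w q) (s q) * S.framePsi w q :=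
    hw.eventually.mono fun q hq => by
      change S.ψ q (s q) = _ * S.ψ q (w q)
      conv_lhs => rw [hq.eq_smul hL (s q)]
      rw [map_smul, smul_eq_mul]
  have hC : S.C p v (s p) = (starRingEnd ℂ (S.framePsi w p) * hW.form p (w p) (s p))
      • S.C p (w p) (w p) := by
    rw [(isDualVector_iff hw).1 hv]
    conv_lhs => rw [hw.eq_smul hL (s p)]
    simp only [map_smul, LinearMap.smul_apply, smul_smul]
    rw [mul_comm]
  rw [dbarFun_smul_vector, S.dbar.op_smul_vector hs, op_eq hw hs, dbarFun_congr hψ,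
    dbarFun_mul (ha.mdifferentiableAt (by simp))
      ((contMDiffAt_framePsi hw).mdifferentiableAt (by simp)), hC]
  simp only [map_smul, map_smulₛₗ, LinearMap.smul_apply, smul_eq_mul]
  change _ - starRingEnd ℂ c * (_ * S.framePsi w p)
    + 3 * (_ * (starRingEnd ℂ c * S.frameC hN w X p)) = _
  rw [frameDbarPsi]
  ring

include hX

/-- The equation for `∂̄ C` is tensorial: its value on `c X`, `s` and `t` is a multiple of its value on
the unit frames. -/
lemma dbarC_eq {s t : Π p, W p} (hs : SmoothSectionAt 𝓘(ℝ, ℂ) ℂ s p)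
    (ht : SmoothSectionAt 𝓘(ℝ, ℂ) ℂ t p) (c : ℂ) :
    dbarTangent (fun q => S.C q (s q) (t q)) p (c • X p)
        - S.C p (S.dbar.op s p (c • X p)) (t p) - S.C p (s p) (S.dbar.op t p (c • X p))
      = (starRingEnd ℂ c * hW.form p (w p) (s p) * hW.form p (w p) (t p)
          * S.frameDbarC hN hW w X p) • X p := by
  have hL : IsComplexLineBundle W := isComplexLineBundle_of_vectorBundle
  have ha : ContMDiffAt 𝓘(ℝ, ℂ) 𝓘(ℝ, ℂ) ∞ (fun q => hW.form q (w q) (s q)) p :=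
    hW.smooth p w s hw.smooth hs
  have hb : ContMDiffAt 𝓘(ℝ, ℂ) 𝓘(ℝ, ℂ) ∞ (fun q => hW.form q (w q) (t q)) p :=
    hW.smooth p w t hw.smooth ht
  have hγ : ContMDiffAt 𝓘(ℝ, ℂ) 𝓘(ℝ, ℂ) ∞ (S.frameC hN w X) p := contMDiffAt_frameC hw hX
  have hCw : S.C p (w p) (w p) = S.frameC hN w X p • X p :=
    hX.eq_smul isComplexLineBundle_tangent _
  have hC : ∀ᶠ q in 𝓝 p, S.C q (s q) (t q)
      = (hW.form q (w q) (s q) * hW.form q (w q) (t q) * S.frameC hN w X q) • X q := by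
    filter_upwards [hw.eventually, hX.eventually] with q h1 h2
    have h3 : S.C q (w q) (w q) = S.frameC hN w X q • X q :=
      h2.eq_smul isComplexLineBundle_tangent _
    conv_lhs => rw [h1.eq_smul hL (s q), h1.eq_smul hL (t q)]
    simp only [map_smul, LinearMap.smul_apply, h3, smul_smul]
    congr 1
    ring
  have hm : ContMDiffAt 𝓘(ℝ, ℂ) 𝓘(ℝ, ℂ) ∞
      (fun q => hW.form q (w q) (s q) * hW.form q (w q) (t q) * S.frameC hN w X q) p :=
    (ha.complex_mul hb).complex_mul hγ
  have hd : dbarTangent (fun q => S.C q (s q) (t q)) p (X p)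
      = (hW.form p (w p) (s p) * hW.form p (w p) (t p) * S.frameC hN w X p)
          • dbarTangent X p (X p)
        + dbarFun (fun q => hW.form q (w q) (s q) * hW.form q (w q) (t q) * S.frameC hN w X q) p (X p)
          • X p := by
    rw [← tangentHolomorphicStructure_op hN (S.C_smooth p s t hs ht),
      ← tangentHolomorphicStructure_op hN hX.smooth,
      (tangentHolomorphicStructure hN).op_congr
        (isComplexLineBundle_tangent.smul_smooth p _ X hm hX.smooth) hC,
      (tangentHolomorphicStructure hN).leibniz _ X p _ hm hX.smooth]
  have hda := ha.mdifferentiableAt (n := ∞) (by simp)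
  have hdb := hb.mdifferentiableAt (n := ∞) (by simp)
  have hdγ := hγ.mdifferentiableAt (n := ∞) (by simp)
  rw [dbarFun_mul ((ha.complex_mul hb).mdifferentiableAt (by simp)) hdγ, dbarFun_mul hda hdb,
    dbarTangent_unitFrame hX, smul_smul, ← add_smul] at hd
  have hcd : dbarTangent (fun q => S.C q (s q) (t q)) p (c • X p)
      = starRingEnd ℂ c • dbarTangent (fun q => S.C q (s q) (t q)) p (X p) := by
    rw [← tangentHolomorphicStructure_op hN (S.C_smooth p s t hs ht),
      ← tangentHolomorphicStructure_op hN (S.C_smooth p s t hs ht),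
      (tangentHolomorphicStructure hN).op_smul_vector (S.C_smooth p s t hs ht)]
  have h1 : S.C p (S.dbar.op s p (c • X p)) (t p) = (starRingEnd ℂ c
      * (hW.form p (w p) (s p) * S.frameDbar hW w X p
        + dbarFun (fun q => hW.form q (w q) (s q)) p (X p)) * hW.form p (w p) (t p)
      * S.frameC hN w X p) • X p := by
    rw [S.dbar.op_smul_vector hs, op_eq hw hs]
    conv_lhs => rw [hw.eq_smul hL (t p)]
    simp only [map_smul, LinearMap.smul_apply, hCw, smul_smul]
    congr 1
    ring
  have h2 : S.C p (s p) (S.dbar.op t p (c • X p)) = (starRingEnd ℂ c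
      * (hW.form p (w p) (t p) * S.frameDbar hW w X p
        + dbarFun (fun q => hW.form q (w q) (t q)) p (X p)) * hW.form p (w p) (s p)
      * S.frameC hN w X p) • X p := by
    rw [S.dbar.op_smul_vector ht, op_eq hw ht]
    conv_lhs => rw [hw.eq_smul hL (s p)]
    simp only [map_smul, LinearMap.smul_apply, hCw, smul_smul]
    congr 1
    ring
  rw [hcd, hd, h1, h2, smul_smul, ← sub_smul, ← sub_smul]
  congr 1
  rw [frameDbarC]
  ring

/-- The equation for the scalar curvature in unit frames. The unit vector `u` used for the norm of `C`
may differ from the frame by a phase. -/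
lemma curvature_eq {sN sW : N → ℝ} (h1 : IsNormalizedScalarCurvature hN dbarTangent hN sN)
    (h2 : IsNormalizedScalarCurvature hN (fun s p X => S.dbar.op s p X) hW sW) {u v : W p}
    (hu : hW.form p u u = 1) (hv : IsDualVector hW p (S.ψ p) v) :
    sN p - sW p - ((hW.form p ((2 * Complex.I) • v) ((2 * Complex.I) • v)).re
      - 2 * tensorNormSq hN p (S.C p) u) = S.frameScalar hN hW w X p := by
  have hL : IsComplexLineBundle W := isComplexLineBundle_of_vectorBundle
  have hT : IsComplexLineBundle (fun p : N => TangentSpace 𝓘(ℝ, ℂ) p) := isComplexLineBundle_tangent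
  rw [((isNormalizedScalarCurvature_tangent_iff hN).1 h1).eq_frameCurvature hT hT hX hX,
    h2.eq_frameCurvature hL hT hw hX, frameScalar]
  have hCw : S.C p (w p) (w p) = S.frameC hN w X p • X p := hX.eq_smul hT _
  have e1 : (hW.form p ((2 * Complex.I) • v) ((2 * Complex.I) • v)).re
      = 4 * Complex.normSq (S.framePsi w p) := by
    rw [(isDualVector_iff hw).1 hv]
    simp [hw.form_self, Complex.normSq_apply]
    ring
  have e2 : tensorNormSq hN p (S.C p) u = 4 * Complex.normSq (S.frameC hN w X p) := by
    set a := hW.form p (w p) u with hadef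
    have hua : u = a • w p := hw.eq_smul hL u
    have ha : a.re ^ 2 + a.im ^ 2 = 1 := by
      rw [hua] at hu
      simp only [map_smul, map_smulₛₗ, LinearMap.smul_apply, smul_eq_mul, hw.form_self] at hu
      have := congrArg Complex.re hu
      simp at this
      linarith
    have hz : ∀ z : ℂ, (hN.form p (z • X p) (z • X p)).re = Complex.normSq z := fun z => by
      simp [hX.form_self, Complex.normSq_apply]
    have hab : ∀ y z : ℂ, S.C p (y • w p) (z • w p) = (y * z * S.frameC hN w X p) • X p :=
      fun y z => by
        simp only [map_smul, LinearMap.smul_apply, hCw, smul_smul]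
        congr 1
        ring
    rw [tensorNormSq, hua]
    simp only [smul_smul, hab, hz, Complex.normSq_mul, Complex.normSq_I]
    have hn : Complex.normSq a = 1 := by rw [Complex.normSq_apply]; linarith
    rw [hn]
    ring
  rw [e1, e2]
  ring

end SpinorVortexData

/-- The spinor-vortex equations hold if and only if their components vanish in unit frames. -/
theorem SpinorVortexData.isSpinorVortex_iff (S : SpinorVortexData W)
    (hN : HermitianMetric (fun p : N => TangentSpace 𝓘(ℝ, ℂ) p)) (hW : HermitianMetric W) :
    S.IsSpinorVortex hN hW ↔ ∀ (p : N) (w : Π p, W p) (X : Π p : N, TangentSpace 𝓘(ℝ, ℂ) p),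
      IsUnitFrameAt hW w p → IsUnitFrameAt hN X p →
      S.frameDbarC hN hW w X p = 0 ∧ S.frameDbarPsi hN hW w X p = 0 ∧
        S.frameScalar hN hW w X p = 0 := by
  have hL : IsComplexLineBundle W := isComplexLineBundle_of_vectorBundle
  have hT : IsComplexLineBundle (fun p : N => TangentSpace 𝓘(ℝ, ℂ) p) := isComplexLineBundle_tangent
  constructor
  · intro h p w X hw hX
    have hv := (isDualVector_iff (S := S) hw).2 rfl
    refine ⟨?_, ?_, ?_⟩
    · have h1 := dbarC_eq (S := S) hw hX hw.smooth hw.smooth 1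
      rw [h.dbar_C p w w _ hw.smooth hw.smooth, hw.form_self] at h1
      simpa [hX.ne_zero] using h1.symm
    · have h1 := dbarPsi_eq (S := S) (hN := hN) (X := X) hw hw.smooth 1 hv
      rw [h.dbar_ψ p w _ _ hw.smooth hv, hw.form_self] at h1
      simpa using h1.symm
    · obtain ⟨sN, sW, h1, h2, h3⟩ := h.curvature
      rw [← curvature_eq hw hX h1 h2 hw.form_self hv, h3 p (w p) _ hw.form_self hv, sub_self]
  · intro h
    choose w hw using hW.exists_isUnitFrameAt
    choose X hX using hN.exists_isUnitFrameAt
    refine ⟨fun p s t V hs ht => ?_, fun p s V v hs hv => ?_, ?_⟩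
    · rw [(hX p).eq_smul hT V, dbarC_eq (S := S) (hw p) (hX p) hs ht,
        (h p _ _ (hw p) (hX p)).1, mul_zero, zero_smul]
    · have h1 := dbarPsi_eq (S := S) (hN := hN) (X := X p) (hw p) hs (hN.form p (X p p) V) hv
      rw [← (hX p).eq_smul hT V, (h p _ _ (hw p) (hX p)).2.1, mul_zero] at h1
      linear_combination h1
    · obtain ⟨sN, h1⟩ := exists_isNormalizedScalarCurvature (tangentHolomorphicStructure hN) hN hN hT hT
      obtain ⟨sW, h2⟩ := exists_isNormalizedScalarCurvature S.dbar hW hN hL hT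
      have h1' := (isNormalizedScalarCurvature_tangent_iff hN).2 h1
      refine ⟨sN, sW, h1', h2, fun p u v hu hv => ?_⟩
      have h3 := curvature_eq (hw p) (hX p) h1' h2 hu hv
      rw [(h p _ _ (hw p) (hX p)).2.2] at h3
      exact sub_eq_zero.1 h3

end FrameEquations

end

theorem mainTheorem4
    {M : Type*} [TopologicalSpace M] [T2Space M] [SecondCountableTopology M]
    [ChartedSpace E4 M] [IsManifold (𝓡 4) ∞ M]
    {N : Type*} [TopologicalSpace N] [T2Space N] [ChartedSpace ℂ N] [IsManifold 𝓘(ℂ) ω N]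
    {W : N → Type*} [TopologicalSpace (TotalSpace ℂ W)]
    [∀ p, AddCommGroup (W p)] [∀ p, Module ℝ (W p)] [∀ p, Module ℂ (W p)]
    [∀ p, IsScalarTower ℝ ℂ (W p)]
    [∀ p, TopologicalSpace (W p)] [∀ p, IsTopologicalAddGroup (W p)]
    [∀ p, ContinuousSMul ℝ (W p)] [FiberBundle ℂ W]
    [VectorBundle ℝ ℂ W] [VectorBundle ℂ ℂ W] [ContMDiffVectorBundle ∞ ℂ W 𝓘(ℝ, ℂ)]
    (g : Metric4 M) (o : OrientationForm M)
    (R : SurfaceReduction g o N W) (S : SpinorVortexData W) (hS : R.Defines S) :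
    IsSelfdual g o ↔ S.IsSpinorVortex R.hN R.hW := by
  rw [S.isSpinorVortex_iff]
  constructor
  · rintro ⟨D, hD, h⟩ p w X hw hX
    -- the components on `N` are read off at any point of the fibre
    obtain ⟨x, rfl⟩ := R.proj_surjective p
    exact (hS.weylComp_iff_frame hw hX hD).1 (h x)
  · intro h
    have hD := isLeviCivita_leviCivita g
    refine ⟨leviCivita g, hD, fun x => ?_⟩
    obtain ⟨w, hw⟩ := R.hW.exists_isUnitFrameAt (R.proj x)
    obtain ⟨X, hX⟩ := R.hN.exists_isUnitFrameAt (R.proj x)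
    exact (hS.weylComp_iff_frame hw hX hD).2 (h _ w X hw hX)
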